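/- Let $R$ be a commutative noetherian normal local domain with finite residue field and field of fractions $K$. Let $A$ be an $R$-order in a central simple $K$-algebra, that is, a finitely generated torsion-free $R$-algebra such that $K\otimes_R A$ is a central simple $K$-algebra. Let $z\in\operatorname{rad}A$ (the Jacobson radical) be regular (not a left or right zero divisor) and normal ($zA=Az$), and put $\bar A=A/(z)$. We say that $z$ gives a *homogeneous slice* of $A$ if every left submodule of finite colength of the left $A$-module $A/zA$ is isomorphic to $A/zA$. For a ring $B$ with only finitely many left ideals of each finite index, let $$\zeta_B(s)=\sum_{I}|B/I|^{-s},$$ a formal Dirichlet series, where $I$ runs over the left ideals of $B$ with $B/I$ finite. 1. The element $z$ gives a homogeneous slice of $A$ if and only if $\bar A$ is isomorphic to a finite product of maximal orders (in simple artinian rings) over discrete valuation rings. Here an order over a discrete valuation ring $D$ is a finitely generated torsion-free $D$-algebra $\Lambda$ such that $\operatorname{Frac}(D)\otimes_D\Lambda$ is simple artinian, and it is maximal if no strictly larger $D$-subalgebra of $\operatorname{Frac}(D)\otimes_D\Lambda$ is finitely generated as a $D$-module. 2. Suppose that these equivalent conditions hold and that there is a ring isomorphism $A/\operatorname{rad}A\simeq\prod^m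 M_r(\mathbb F_q)$. Then $A$ and $\bar A$ have only finitely many left ideals of each finite index, and as formal Dirichlet series (infinite products converging coefficientwise), with $t=q^{-s}$, $$\zeta_A(s)=\prod_{n\ge 1}\prod_{j=1}^{r}\bigl(1-q^{nr-j}q^{-nrs}\bigr)^{-m}=\prod_{n\ge 1}\prod_{j=1}^{r}\bigl(1-q^{-j}(qt)^{nr}\bigr)^{-m}.$$ Moreover $$\zeta_A(s)=\prod_{n\ge 0}\zeta_{\bar A}\bigl((n+1)s-n\bigr),\qquad \zeta_{\bar A}(s)=\prod_{j=0}^{r-1}\bigl(1-q^{j-rs}\bigr)^{-m}.$$ -/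

import Mathlib

open scoped TensorProduct

universe u

/-! ### Orders -/

/-- `A` is an `R`-order: a finitely generated torsion-free `R`-algebra such that
`K(R) ⊗ A` is a simple artinian ring. -/
structure IsOrder (R : Type*) (A : Type*) [CommRing R] [IsDomain R] [Ring A] [Algebra R A] :
    Prop where
  finite : Module.Finite R A
  torsionFree : Module.IsTorsionFree R A
  simple : IsSimpleRing (FractionRing R ⊗[R] A)
  artinian : IsArtinianRing (FractionRing R ⊗[R] A)

/-- `A` is an `R`-order in a central simple `K(R)`-algebra. -/
structure IsCentralOrder (R : Type*) (A : Type*) [CommRing R] [IsDomain R] [Ring A]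
    [Algebra R A] : Prop extends IsOrder R A where
  central : Algebra.IsCentral (FractionRing R) (FractionRing R ⊗[R] A)

/-- `A` is a maximal `R`-order: no `R`-order in `K(R) ⊗ A` contains (the image of) `A`
strictly. -/
structure IsMaximalOrder (R : Type*) (A : Type*) [CommRing R] [IsDomain R] [Ring A]
    [Algebra R A] : Prop extends IsOrder R A where
  maximal : ∀ B : Subalgebra R (FractionRing R ⊗[R] A),
    (Algebra.TensorProduct.includeRight : A →ₐ[R] FractionRing R ⊗[R] A).range ≤ B →
    Module.Finite R B →
    B = (Algebra.TensorProduct.includeRight : A →ₐ[R] FractionRing R ⊗[R] A).range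

/-- The ring `B` is isomorphic to a finite product of maximal orders (in simple artinian
rings) over discrete valuation rings. -/
def IsProductOfMaximalOrders (B : Type u) [Ring B] : Prop :=
  ∃ (n : ℕ) (D Λ : Fin n → Type u)
    (_ : ∀ i, CommRing (D i)) (_ : ∀ i, IsDomain (D i))
    (_ : ∀ i, IsDiscreteValuationRing (D i))
    (_ : ∀ i, Ring (Λ i)) (_ : ∀ i, Algebra (D i) (Λ i)),
    (∀ i, IsMaximalOrder (D i) (Λ i)) ∧ Nonempty (B ≃+* (∀ i, Λ i))

/-! ### Homogeneous slices -/

/-- `z` is normal: `zA = Az`. -/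
def IsNormalElement {A : Type*} [Ring A] (z : A) : Prop :=
  (∀ a : A, ∃ b : A, z * a = b * z) ∧ (∀ a : A, ∃ b : A, a * z = z * b)

/-- The submodule of `M` generated by `zM` (it is `zM` itself when `z` is normal). -/
def sliceSubmodule {A : Type*} [Ring A] (M : Type*) [AddCommGroup M] [Module A M] (z : A) :
    Submodule A M :=
  Submodule.span A (Set.range fun x : M => z • x)

/-- The element `z` gives a homogeneous slice of the (projective, left) `A`-module `M`. -/
structure IsHomogeneousSlice {A : Type*} [Ring A] (M : Type*) [AddCommGroup M] [Module A M]
    (z : A) : Prop where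
  projective : Module.Projective A M
  regular : IsRegular z
  normal : IsNormalElement z
  mem_radical : z ∈ Ring.jacobson A
  homogeneous : ∀ N : Submodule A (M ⧸ sliceSubmodule M z),
    IsFiniteLength A ((M ⧸ sliceSubmodule M z) ⧸ N) →
    Nonempty (N ≃ₗ[A] (M ⧸ sliceSubmodule M z))

/-- The ring `A/(z)`, the quotient of `A` by the two-sided ideal generated by `z`. -/
abbrev SliceRing {A : Type*} [Ring A] (z : A) : Type _ :=
  (TwoSidedIdeal.span {z}).ringCon.Quotient

/-! ### Formal Dirichlet series

A formal Dirichlet series `∑ aₙ n⁻ˢ` is the arithmetic function `n ↦ aₙ`, with Dirichlet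
convolution as product. -/

/-- There are only finitely many left ideals of each finite index, so that the zeta function
of `B` is defined as a formal Dirichlet series. -/
def ZetaDefined (B : Type*) [Ring B] : Prop :=
  ∀ n : ℕ, n ≠ 0 → {I : Ideal B | Nat.card (B ⧸ I) = n}.Finite

/-- The zeta function of the ring `B`: the coefficient of `n⁻ˢ` is the number of left ideals
`I` of `B` with `|B/I| = n`. -/
noncomputable def zetaSeries (B : Type*) [Ring B] : ArithmeticFunction ℚ where
  toFun n := if n = 0 then 0 else ({I : Ideal B | Nat.card (B ⧸ I) = n}.ncard : ℚ)
  map_zero' := if_pos rfl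

/-- The formal Dirichlet series `a b⁻ˢ`, for `b ≠ 0`. -/
noncomputable def dirichletTerm (a : ℚ) (b : ℕ) : ArithmeticFunction ℚ where
  toFun n := if n = 0 then 0 else if n = b then a else 0
  map_zero' := if_pos rfl

/-- The substitution `s ↦ (n + 1) s - n`, which takes `∑ aₖ k⁻ˢ` to
`∑ aₖ kⁿ (kⁿ⁺¹)⁻ˢ`. -/
noncomputable def dirichletSubst (n : ℕ) (f : ArithmeticFunction ℚ) : ArithmeticFunction ℚ where
  toFun N := ∑ k ∈ N.divisors with k ^ (n + 1) = N, (k : ℚ) ^ n * f k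
  map_zero' := by simp

/-- `g` is the (unconditional, coefficientwise) formal infinite product of the `f i`: each
coefficient of the finite partial products is eventually equal to that of `g`. -/
def HasFormalProd {ι : Type*} (f : ι → ArithmeticFunction ℚ) (g : ArithmeticFunction ℚ) : Prop :=
  ∀ k : ℕ, ∀ᶠ s : Finset ι in Filter.atTop, (∏ i ∈ s, f i) k = g k

/-!
Write `B = A / zA`. The order `A` is semilocal with finite residue rings, so a left `A`-module of
finite length is a finite module, and `z` gives a homogeneous slice if and only if `B` is
*homogeneous*: every left ideal `N` of finite index has the form `B y`, with `y` not annihilated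
from the left (`IsHomogeneousRing`, `isHomogeneousSlice_iff`).

**From homogeneous to maximal.** Let `J` be the radical of `B`. Then `J = B x = x B` with `x`
regular, and comparison of indices shows that conjugation by `x` fixes every maximal two-sided ideal
of `B` (`exists_regular_normal_generator`, `conj_mem_ker_of_homogeneous`). Conjugation by `z` induces
an automorphism `τ` of `B`, and the decisive point is that it permutes the maximal two-sided ideals
transitively: an idempotent modulo `J` invariant under `τ` lifts, after raising to a high power, to
an element of `A` that is central modulo a given power of the maximal ideal of `R`, and as the
centre of `A` is the integrally closed ring `R`, the idempotent is a scalar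
(`exists_scalar_mod_jacobson`). So every nonzero `τ`-invariant central element of `B` is a unit times
a power of `x`. These elements form a discrete valuation ring over which `B` is finite and torsion
free (`exists_discreteValuationRing_of_invariant`). The ring obtained from `B` by inverting `x` is
semisimple, `B` is maximal in it, and its Wedderburn decomposition decomposes `B`
(`isProductOfMaximalOrders_of_homogeneous`).

**From maximal to homogeneous.** In a maximal order over a discrete valuation ring the maximal
two-sided ideals are invertible (`exists_mul_eq_smul_top`). Hence a maximal left ideal needs one
generator at each maximal two-sided ideal, and it is principal by the Chinese remainder theorem and
Nakayama's lemma (`exists_eq_span_singleton_of_isMaximal`). Induction on the index gives all left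
ideals of finite index.

**The zeta function of `B`.** Consider the left ideals whose image in `B / J = ∏ M_r(F)` has rows
with arbitrary values at a set `S` of columns. If `S` grows by one column, the ideals that get lost
are those for which this column depends on the others. Its coefficients are unique, and such an ideal
has the form `I' y`, where `y` generates an ideal of index `q ^ r` and depends on the coefficients
only. This is a recursion (`fullSeries_eq_insert_add`) that starts with the unit ideal and ends with
all left ideals: Hey's formula (`zetaSeries_mul_prod_eq_one`).

**The zeta function of `A`.** To a left ideal `I` of `A` one attaches its image in `B` and the left
ideal `G = {a | z a ∈ I}`. A pair of left ideals, `G` of `A` and `L ⊆ π(G)` of `B`, comes from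
exactly `|B / π(G)|` ideals `I` (`card_fibre_eq`). With
`f n = ∑ |B / π(I)| ^ n (|A / I| |B / π(I)| ^ n) ^ (-s)` this amounts to
`f n = ζ_B ((n + 1) s - n) * f (n + 1)` (`sliceSeries_eq_mul`). As `f 0` is the zeta function of `A`
and `f n` tends to `1`, the infinite product follows.
-/

/-! ### The radical of a finite algebra over a local ring -/

section Radical

variable (R : Type*) {B : Type*} [CommRing R] [Ring B] [Algebra R B]

/-- The Jacobson radical of an `R`-algebra, as an element of the semiring of its
`R`-submodules, where products and powers of ideals are taken. -/
def radicalSubmodule (B : Type*) [Ring B] [Algebra R B] : Submodule R B :=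
  (Ring.jacobson B).restrictScalars R

theorem mem_radicalSubmodule {b : B} : b ∈ radicalSubmodule R B ↔ b ∈ Ring.jacobson B := Iff.rfl

theorem mul_mem_jacobson_right {B : Type*} [Ring B] {a : B} (ha : a ∈ Ring.jacobson B) (b : B) :
    a * b ∈ Ring.jacobson B :=
  Ideal.mul_mem_right b _ ha

theorem mul_mem_jacobson_left {B : Type*} [Ring B] {a : B} (ha : a ∈ Ring.jacobson B) (b : B) :
    b * a ∈ Ring.jacobson B :=
  Ideal.mul_mem_left _ b ha

/-- The two-sided ideal `I B` of an `R`-algebra `B` generated by an ideal `I` of `R`. -/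
def smulTopIdeal {R : Type*} (B : Type*) [CommRing R] [Ring B] [Algebra R B] (I : Ideal R) :
    Ideal B :=
  { (I • ⊤ : Submodule R B) with
    smul_mem' := fun a b hb => by
      refine Submodule.smul_induction_on (p := fun b => a • b ∈ (I • ⊤ : Submodule R B)) hb
        (fun r hr b _ => ?_) (fun b c hb hc => ?_)
      · rw [smul_eq_mul, mul_smul_comm]
        exact Submodule.smul_mem_smul hr Submodule.mem_top
      · rw [smul_add]; exact add_mem hb hc }

theorem mem_smulTopIdeal {R B : Type*} [CommRing R] [Ring B] [Algebra R B] {I : Ideal R} {b : B} :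
    b ∈ smulTopIdeal B I ↔ b ∈ (I • ⊤ : Submodule R B) := Iff.rfl

instance {R B : Type*} [CommRing R] [Ring B] [Algebra R B] (I : Ideal R) :
    (smulTopIdeal B I).IsTwoSided where
  mul_mem_of_left {b} a hb := by
    rw [mem_smulTopIdeal] at hb ⊢
    refine Submodule.smul_induction_on (p := fun b => b * a ∈ (I • ⊤ : Submodule R B)) hb
      (fun r hr b _ => ?_) (fun b c hb hc => ?_)
    · rw [smul_mul_assoc]
      exact Submodule.smul_mem_smul hr Submodule.mem_top
    · rw [add_mul]; exact add_mem hb hc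

/-- A power of the radical annihilates a given finite module. -/
theorem exists_radicalSubmodule_pow_le (I : Ideal B) [Finite (B ⧸ I)] :
    ∃ c : ℕ, radicalSubmodule R B ^ c ≤ I.restrictScalars R := by
  let F : ℕ → Submodule B (B ⧸ I) := fun n => Nat.rec ⊤ (fun _ N => Ring.jacobson B • N) n
  have hF (n : ℕ) : F (n + 1) = Ring.jacobson B • F n := rfl
  have hanti : Antitone F := antitone_nat_of_succ_le fun n => by
    rw [hF]; exact Submodule.smul_le_right
  obtain ⟨n, hn⟩ : ∃ n, F n = F (n + 1) := by
    obtain ⟨n, hn⟩ := IsArtinian.monotone_stabilizes ⟨F, hanti⟩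
    exact ⟨n, hn (n + 1) (Nat.le_succ n)⟩
  have hbot : F n = ⊥ :=
    Submodule.FG.eq_bot_of_le_jacobson_smul (IsNoetherian.noetherian _) (by rw [← hF]; exact hn.le)
  refine ⟨n, ?_⟩
  have key : ∀ k, ∀ b ∈ radicalSubmodule R B ^ k, (Submodule.Quotient.mk b : B ⧸ I) ∈ F k := by
    intro k
    induction k with
    | zero => intro b _; exact Submodule.mem_top
    | succ k ih =>
      intro b hb
      rw [pow_succ'] at hb
      refine Submodule.mul_induction_on hb (fun a ha c hc => ?_) (fun a c ha hc => ?_)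
      · rw [hF]
        exact Submodule.smul_mem_smul (N := F k) ha (ih c hc)
      · exact (F (k + 1)).add_mem ha hc
  intro b hb
  have := key n b hb
  rw [hbot] at this
  exact (Submodule.Quotient.mk_eq_zero I).1 ((Submodule.mem_bot B).1 this)

variable {R}

theorem isUnit_of_isUnit_mod_jacobson {B : Type*} [Ring B] {b c d : B}
    (hc : c * b - 1 ∈ Ring.jacobson B) (hd : b * d - 1 ∈ Ring.jacobson B) : IsUnit b := by
  have key : ∀ y : B, y - 1 ∈ Ring.jacobson B → ∃ w, w * y = 1 := by
    intro y hy
    by_contra h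
    have hne : Ideal.span {y} ≠ ⊤ := fun h' => h (by
      have : (1 : B) ∈ Ideal.span {y} := h' ▸ Submodule.mem_top
      obtain ⟨w, hw⟩ := Ideal.mem_span_singleton'.1 this
      exact ⟨w, hw⟩)
    obtain ⟨N, hN, hle⟩ := Ideal.exists_le_maximal _ hne
    refine hN.ne_top ((Ideal.eq_top_iff_one N).2 ?_)
    have h1 := Ring.jacobson_le_of_isMaximal N hy
    have h2 := hle (Ideal.mem_span_singleton_self y)
    simpa using N.sub_mem h2 h1
  have unit : ∀ y : B, y - 1 ∈ Ring.jacobson B → IsUnit y := by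
    intro y hy
    obtain ⟨w, hw⟩ := key y hy
    have hw1 : w - 1 ∈ Ring.jacobson B := by
      have := mul_mem_jacobson_left hy (-w)
      have h2 : w - 1 = -w * (y - 1) := by rw [mul_sub, neg_mul, hw]; simp; abel
      rwa [h2]
    obtain ⟨v, hv⟩ := key w hw1
    have : v = y := by rw [← mul_one v, ← hw, ← mul_assoc, hv, one_mul]
    exact ⟨⟨y, w, this ▸ hv, hw⟩, rfl⟩
  obtain ⟨u, hu⟩ := unit _ hc
  obtain ⟨v, hv⟩ := unit _ hd
  refine isUnit_iff_exists.2 ⟨d * ↑v⁻¹, ?_, ?_⟩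
  · rw [← mul_assoc, ← hv, Units.mul_inv]
  · have h1 : (↑u⁻¹ * c) * b = 1 := by rw [mul_assoc, ← hu, Units.inv_mul]
    have h2 : b * (d * ↑v⁻¹) = 1 := by rw [← mul_assoc, ← hv, Units.mul_inv]
    rwa [← left_inv_eq_right_inv h1 h2]

/-- The semisimple quotient `B / rad B` as a product of simple rings, presented by a surjection
from `B` itself. -/
theorem exists_radical_quotient_decomposition (B : Type u) [Ring B]
    [IsArtinianRing (B ⧸ Ring.jacobson B)] :
    ∃ (n : ℕ) (S : Fin n → Type u) (_ : ∀ i, Ring (S i)) (ψ : B →+* ∀ i, S i),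
      (∀ i, IsSimpleRing (S i)) ∧ (∀ i, IsSemisimpleRing (S i)) ∧ Function.Surjective ψ ∧
      ∀ b, ψ b = 0 ↔ b ∈ Ring.jacobson B := by
  have : IsSemisimpleRing (B ⧸ Ring.jacobson B) :=
    IsArtinianRing.isSemisimpleRing_iff_jacobson.2 (Ring.jacobson_quotient_jacobson B)
  obtain ⟨n, D, d, _, hd, ⟨e⟩⟩ :=
    IsSemisimpleRing.exists_ringEquiv_pi_matrix_divisionRing (B ⧸ Ring.jacobson B)
  refine ⟨n, fun i => Matrix (Fin (d i)) (Fin (d i)) (D i), fun i => inferInstance,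
    (e : _ →+* _).comp (Ideal.Quotient.mk (Ring.jacobson B)), fun i => inferInstance,
    fun i => inferInstance, e.surjective.comp Ideal.Quotient.mk_surjective, fun b => ?_⟩
  rw [← Ideal.Quotient.eq_zero_iff_mem]
  simp

section Local

variable (R) [IsLocalRing R] [Module.Finite R B]

theorem algebraMap_mem_jacobson {r : R} (hr : r ∈ IsLocalRing.maximalIdeal R) :
    algebraMap R B r ∈ Ring.jacobson B := by
  rw [Ring.jacobson_eq_sInf_isMaximal, Submodule.mem_sInf]
  intro N hN
  by_contra h
  have htop : N ⊔ Ideal.span {algebraMap R B r} = ⊤ := by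
    refine (Ideal.isMaximal_def.1 hN).2 _ ?_
    rw [left_lt_sup, Ideal.span_singleton_le_iff_mem]
    exact h
  have : (⊤ : Submodule R B) ≤ N.restrictScalars R := by
    refine Submodule.le_of_le_smul_of_le_jacobson_bot (I := IsLocalRing.maximalIdeal R)
      Module.Finite.fg_top (IsLocalRing.jacobson_eq_maximalIdeal ⊥ bot_ne_top).ge ?_
    intro b _
    have hb : b ∈ N ⊔ Ideal.span {algebraMap R B r} := htop ▸ Submodule.mem_top
    obtain ⟨a, ha, c, hc, rfl⟩ := Submodule.mem_sup.1 hb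
    obtain ⟨w, rfl⟩ := Ideal.mem_span_singleton'.1 hc
    refine Submodule.add_mem_sup ha ?_
    rw [← Algebra.commutes, ← Algebra.smul_def]
    exact Submodule.smul_mem_smul hr Submodule.mem_top
  exact hN.ne_top (eq_top_iff.2 this)

theorem smul_top_le_radicalSubmodule :
    (IsLocalRing.maximalIdeal R • ⊤ : Submodule R B) ≤ radicalSubmodule R B :=
  Submodule.smul_le.2 fun r hr b _ => by
    rw [Algebra.smul_def]
    exact mul_mem_jacobson_right (algebraMap_mem_jacobson R hr) b

variable [IsNoetherianRing R] [Finite (IsLocalRing.ResidueField R)]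

theorem finite_quotient_maximalIdeal_pow_smul_top (M : Type*) [AddCommGroup M] [Module R M]
    [Module.Finite R M] (k : ℕ) :
    Finite (M ⧸ (IsLocalRing.maximalIdeal R ^ k • ⊤ : Submodule R M)) := by
  have : Finite (R ⧸ IsLocalRing.maximalIdeal R) :=
    inferInstanceAs (Finite (IsLocalRing.ResidueField R))
  have : Finite (R ⧸ IsLocalRing.maximalIdeal R ^ k) :=
    Ideal.finite_quotient_pow (IsNoetherian.noetherian _) k
  have : Module.Finite (R ⧸ IsLocalRing.maximalIdeal R ^ k)
      (M ⧸ (IsLocalRing.maximalIdeal R ^ k • ⊤ : Submodule R M)) :=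
    Module.Finite.of_restrictScalars_finite R _ _
  exact Module.finite_of_finite (R ⧸ IsLocalRing.maximalIdeal R ^ k)

theorem radicalSubmodule_pow_le_smul_top (k : ℕ) :
    ∃ c : ℕ, radicalSubmodule R B ^ c ≤ (IsLocalRing.maximalIdeal R ^ k • ⊤ : Submodule R B) := by
  have : Finite (B ⧸ smulTopIdeal B (IsLocalRing.maximalIdeal R ^ k)) :=
    finite_quotient_maximalIdeal_pow_smul_top R B k
  exact exists_radicalSubmodule_pow_le R (smulTopIdeal B (IsLocalRing.maximalIdeal R ^ k))

theorem finite_quotient_jacobson (R B : Type*) [CommRing R] [IsLocalRing R] [IsNoetherianRing R]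
    [Finite (IsLocalRing.ResidueField R)] [Ring B] [Algebra R B] [Module.Finite R B] :
    Finite (B ⧸ Ring.jacobson B) := by
  have := finite_quotient_maximalIdeal_pow_smul_top R B 1
  have hle : (IsLocalRing.maximalIdeal R ^ 1 • ⊤ : Submodule R B) ≤ radicalSubmodule R B := by
    rw [pow_one]; exact smul_top_le_radicalSubmodule R
  exact Finite.of_surjective _ (Submodule.factor_surjective hle)

end Local

end Radical

/-! ### Rings whose left ideals of finite index are free of rank one -/

/-- Every left ideal of finite index is generated by an element without left annihilator, i.e.
is isomorphic to the regular left module. -/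
def IsHomogeneousRing (B : Type*) [Ring B] : Prop :=
  ∀ N : Ideal B, Finite (B ⧸ N) → ∃ y, N = Ideal.span {y} ∧ ∀ b, b * y = 0 → b = 0

/-- The left ideal `N y`. -/
def mulRightIdeal {B : Type*} [Ring B] (N : Ideal B) (y : B) : Ideal B :=
  Submodule.map (LinearMap.toSpanSingleton B B y) N

theorem mem_mulRightIdeal {B : Type*} [Ring B] {N : Ideal B} {y b : B} :
    b ∈ mulRightIdeal N y ↔ ∃ a ∈ N, a * y = b := by
  simp [mulRightIdeal]

theorem card_quotient_mulRightIdeal {B : Type*} [Ring B] {y : B} (hy : ∀ b, b * y = 0 → b = 0)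
    (N : Ideal B) :
    Nat.card (B ⧸ mulRightIdeal N y) = Nat.card (B ⧸ N) * Nat.card (B ⧸ Ideal.span {y}) := by
  let f : B →+ B := AddMonoidHom.mulRight y
  have hf : Function.Injective f := (injective_iff_map_eq_zero f).2 hy
  have h1 : (mulRightIdeal N y).toAddSubgroup = N.toAddSubgroup.map f := by
    ext b; exact mem_mulRightIdeal
  have h2 : (Ideal.span {y}).toAddSubgroup = f.range := by
    ext b; exact Ideal.mem_span_singleton'
  have := AddSubgroup.index_map_of_injective N.toAddSubgroup hf
  rw [← h1, ← h2] at this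
  exact this

theorem mulRightIdeal_injective {B : Type*} [Ring B] {y : B} (hy : ∀ b, b * y = 0 → b = 0) :
    Function.Injective fun N : Ideal B => mulRightIdeal N y :=
  Submodule.map_injective_of_injective
    ((injective_iff_map_eq_zero (LinearMap.toSpanSingleton B B y)).2 (by simpa using hy))

theorem exists_mulRightIdeal_eq {B : Type*} [Ring B] {y : B} {N : Ideal B}
    (h : N ≤ Ideal.span {y}) : ∃ N' : Ideal B, mulRightIdeal N' y = N := by
  refine ⟨Submodule.comap (LinearMap.toSpanSingleton B B y) N, ?_⟩
  ext b
  rw [mem_mulRightIdeal]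
  constructor
  · rintro ⟨a, ha, rfl⟩
    simpa using ha
  · intro hb
    obtain ⟨a, rfl⟩ := Ideal.mem_span_singleton'.1 (h hb)
    exact ⟨a, by simpa using hb, rfl⟩

/-! ### Normal elements -/

theorem exists_algHom_of_mul_eq (R : Type*) {B : Type*} [CommRing R] [Ring B] [Algebra R B] {x : B}
    (hx : ∀ b, b * x = 0 → b = 0) (h : ∀ b, ∃ c, x * b = c * x) :
    ∃ σ : B →ₐ[R] B, ∀ b, x * b = σ b * x := by
  choose f hf using h
  have canc : ∀ {a b}, a * x = b * x → a = b := fun {a b} hab =>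
    sub_eq_zero.1 (hx _ (by rw [sub_mul, hab, sub_self]))
  refine ⟨AlgHom.mk' (R := R)
    { toFun := f
      map_one' := canc (by rw [← hf]; simp)
      map_mul' := fun a b => canc (by rw [← hf, mul_assoc, ← hf, ← mul_assoc, hf, mul_assoc])
      map_zero' := canc (by rw [← hf]; simp)
      map_add' := fun a b => canc (by rw [← hf, add_mul, ← hf, ← hf, mul_add]) } ?_, hf⟩
  intro r b
  refine canc ?_
  change f (r • b) * x = (r • f b) * x
  rw [← hf, smul_mul_assoc, ← hf, mul_smul_comm]

/-- Conjugation by a regular normal element. -/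
theorem exists_algEquiv_of_isNormalElement (R : Type*) {B : Type*} [CommRing R] [Ring B]
    [Algebra R B] {x : B} (hreg : IsRegular x) (hx : IsNormalElement x) :
    ∃ σ : B ≃ₐ[R] B, ∀ b, x * b = σ b * x := by
  obtain ⟨σ, hσ⟩ := exists_algHom_of_mul_eq R
    (fun b hb => hreg.right (by simpa using hb) : ∀ b, b * x = 0 → b = 0) hx.1
  refine ⟨AlgEquiv.ofBijective σ ⟨(injective_iff_map_eq_zero σ).2 fun b hb => ?_, fun b => ?_⟩, hσ⟩
  · have := hσ b
    rw [hb, zero_mul] at this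
    exact hreg.left (by simpa using this)
  · obtain ⟨c, hc⟩ := hx.2 b
    exact ⟨c, hreg.right (by simp only [← hσ, hc])⟩

theorem exists_mem_map_eq_one {B S : Type*} [Ring B] [Ring S] [IsSimpleRing S] (f : B →+* S)
    (hf : Function.Surjective f) (T : Ideal B) [T.IsTwoSided] {b : B} (hb : b ∈ T)
    (hfb : f b ≠ 0) : ∃ w ∈ T, f w = 1 := by
  let I : TwoSidedIdeal S := TwoSidedIdeal.mk' {s | ∃ t ∈ T, f t = s} ⟨0, T.zero_mem, map_zero f⟩
    (by
      rintro _ _ ⟨a, ha, rfl⟩ ⟨c, hc, rfl⟩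
      exact ⟨a + c, T.add_mem ha hc, map_add f a c⟩)
    (by
      rintro _ ⟨a, ha, rfl⟩
      exact ⟨-a, T.neg_mem ha, map_neg f a⟩)
    (by
      rintro s _ ⟨a, ha, rfl⟩
      obtain ⟨t, rfl⟩ := hf s
      exact ⟨t * a, T.mul_mem_left t ha, map_mul f t a⟩)
    (by
      rintro _ s ⟨a, ha, rfl⟩
      obtain ⟨t, rfl⟩ := hf s
      exact ⟨a * t, T.mul_mem_right t ha, map_mul f a t⟩)
  have := IsSimpleRing.one_mem_of_ne_zero_mem I hfb (by
    rw [TwoSidedIdeal.mem_mk']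
    exact ⟨b, hb, rfl⟩)
  rw [TwoSidedIdeal.mem_mk'] at this
  exact this

section Generator

variable {R B : Type*} [CommRing R] [IsLocalRing R] [IsNoetherianRing R]
  [Finite (IsLocalRing.ResidueField R)] [Ring B] [Algebra R B] [Module.Finite R B]

/-- The endomorphism `b ↦ x b x⁻¹` reflects the radical `J = B x`: with `I` its preimage of `J`
and `I = B y`, one has `J y ⊆ J x`, and comparing indices gives `|B / J| ≤ |B / I|`. -/
theorem mem_jacobson_of_conj_mem (H : IsHomogeneousRing B) {x : B}
    (hJ : Ring.jacobson B = Ideal.span {x}) (hx : ∀ b, b * x = 0 → b = 0) (σ : B →ₐ[R] B)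
    (hσ : ∀ b, x * b = σ b * x) {b : B} (hb : σ b ∈ Ring.jacobson B) : b ∈ Ring.jacobson B := by
  have hfin := finite_quotient_jacobson R B
  have hxJ : x ∈ Ring.jacobson B := hJ ▸ Ideal.mem_span_singleton_self x
  have hσJ : ∀ a ∈ Ring.jacobson B, σ a ∈ Ring.jacobson B := by
    intro a ha
    rw [hJ] at ha
    obtain ⟨c, rfl⟩ := Ideal.mem_span_singleton'.1 ha
    have hσx : σ x = x := sub_eq_zero.1 (hx _ (by rw [sub_mul, ← hσ, sub_self]))
    rw [map_mul, hσx]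
    exact mul_mem_jacobson_left hxJ _
  let I : Ideal B :=
    { carrier := {b | σ b ∈ Ring.jacobson B}
      add_mem' := fun {a c} ha hc => by
        change σ (a + c) ∈ Ring.jacobson B
        rw [map_add]; exact add_mem ha hc
      zero_mem' := by simp
      smul_mem' := fun c a ha => by
        change σ (c * a) ∈ Ring.jacobson B
        rw [map_mul]; exact mul_mem_jacobson_left ha _ }
  have hle : Ring.jacobson B ≤ I := fun a ha => hσJ a ha
  have : Finite (B ⧸ I) := Finite.of_surjective _ (Submodule.factor_surjective hle)
  obtain ⟨y, hIy, hy⟩ := H I this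
  have hsub : mulRightIdeal (Ring.jacobson B) y ≤ mulRightIdeal (Ring.jacobson B) x := by
    intro a ha
    obtain ⟨c, hc, rfl⟩ := mem_mulRightIdeal.1 ha
    rw [hJ] at hc
    obtain ⟨d, rfl⟩ := Ideal.mem_span_singleton'.1 hc
    have hyI : y ∈ I := hIy ▸ Ideal.mem_span_singleton_self y
    refine mem_mulRightIdeal.2 ⟨d * σ y, mul_mem_jacobson_left hyI _, ?_⟩
    rw [mul_assoc, mul_assoc, hσ]
  have h1 := card_quotient_mulRightIdeal hy (Ring.jacobson B)
  have h2 := card_quotient_mulRightIdeal hx (Ring.jacobson B)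
  rw [← hIy] at h1
  rw [← hJ] at h2
  have hJpos : 0 < Nat.card (B ⧸ Ring.jacobson B) := Nat.card_pos
  have hIpos : 0 < Nat.card (B ⧸ I) := Nat.card_pos
  have hfin2 : Finite (B ⧸ mulRightIdeal (Ring.jacobson B) y) :=
    Nat.finite_of_card_ne_zero (by rw [h1]; positivity)
  have h3 := Nat.card_le_card_of_surjective _ (Submodule.factor_surjective hsub)
  rw [h1, h2] at h3
  have h4 : Nat.card (B ⧸ Ring.jacobson B) ≤ Nat.card (B ⧸ I) := Nat.le_of_mul_le_mul_left h3 hJpos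
  -- the surjection `B / J → B / I` is injective for reasons of cardinality
  have hbij : Function.Bijective (Submodule.factor hle) :=
    (Nat.bijective_iff_surjective_and_card _).2 ⟨Submodule.factor_surjective hle,
      le_antisymm h4 (Nat.card_le_card_of_surjective _ (Submodule.factor_surjective hle))⟩
  have h5 : Submodule.factor hle (Submodule.Quotient.mk b) = Submodule.factor hle 0 := by
    rw [map_zero]
    exact (Submodule.Quotient.mk_eq_zero I).2 hb
  exact (Submodule.Quotient.mk_eq_zero _).1 (hbij.1 h5)

/-- In a homogeneous ring the radical is generated by a regular normal element. -/
theorem exists_regular_normal_generator (H : IsHomogeneousRing B) :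
    ∃ (x : B) (σ : B ≃ₐ[R] B), IsRegular x ∧ Ring.jacobson B = Ideal.span {x} ∧
      ∀ b, x * b = σ b * x := by
  have hfin := finite_quotient_jacobson R B
  obtain ⟨x, hJ, hx⟩ := H (Ring.jacobson B) hfin
  have hxJ : x ∈ Ring.jacobson B := hJ ▸ Ideal.mem_span_singleton_self x
  have hnorm : ∀ b, ∃ c, x * b = c * x := by
    intro b
    have := mul_mem_jacobson_right hxJ b
    rw [hJ] at this
    obtain ⟨c, hc⟩ := Ideal.mem_span_singleton'.1 this
    exact ⟨c, hc.symm⟩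
  obtain ⟨σ, hσ⟩ := exists_algHom_of_mul_eq R hx hnorm
  have hσx : σ x = x := sub_eq_zero.1 (hx _ (by rw [sub_mul, ← hσ, sub_self]))
  have hrefl : ∀ b, σ b ∈ Ring.jacobson B → b ∈ Ring.jacobson B := fun b =>
    mem_jacobson_of_conj_mem H hJ hx σ hσ
  -- `σ` induces an injective, hence surjective, endomorphism of the finite ring `B / J`
  have hmod : ∀ b, ∃ c d, b = σ c + d * x := by
    let f : B ⧸ Ring.jacobson B →+* B ⧸ Ring.jacobson B :=
      Ideal.Quotient.lift _ ((Ideal.Quotient.mk _).comp (σ : B →+* B)) (by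
        intro a ha
        rw [hJ] at ha
        obtain ⟨c, rfl⟩ := Ideal.mem_span_singleton'.1 ha
        refine Ideal.Quotient.eq_zero_iff_mem.2 ?_
        simp only [RingHom.coe_coe, map_mul, hσx]
        exact mul_mem_jacobson_left hxJ _)
    have hinj : Function.Injective f := by
      rw [injective_iff_map_eq_zero]
      intro a ha
      obtain ⟨a, rfl⟩ := Ideal.Quotient.mk_surjective a
      exact Ideal.Quotient.eq_zero_iff_mem.2 (hrefl a (Ideal.Quotient.eq_zero_iff_mem.1 ha))
    intro b
    obtain ⟨c, hc⟩ := Finite.surjective_of_injective hinj (Ideal.Quotient.mk _ b)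
    obtain ⟨c, rfl⟩ := Ideal.Quotient.mk_surjective c
    have h : b - σ c ∈ Ring.jacobson B := (Ideal.Quotient.eq).1 hc.symm
    rw [hJ] at h
    obtain ⟨d, hd⟩ := Ideal.mem_span_singleton'.1 h
    exact ⟨c, d, by rw [hd]; abel⟩
  have hpow : ∀ n : ℕ, ∀ b, ∃ c d, b = σ c + d * x ^ n := by
    intro n
    induction n with
    | zero => exact fun b => ⟨0, b, by simp⟩
    | succ n ih =>
      intro b
      obtain ⟨c, d, rfl⟩ := ih b
      obtain ⟨c', d', rfl⟩ := hmod d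
      refine ⟨c + c' * x ^ n, d', ?_⟩
      rw [map_add, map_mul, map_pow, hσx, add_mul, pow_succ', mul_assoc]
      abel
  have hsurj : Function.Surjective σ := by
    obtain ⟨c, hc⟩ := radicalSubmodule_pow_le_smul_top R (B := B) 1
    rw [pow_one] at hc
    have hmem : ∀ d, d * x ^ c ∈ (IsLocalRing.maximalIdeal R • ⊤ : Submodule R B) := by
      intro d
      have h1 : x ^ c ∈ (IsLocalRing.maximalIdeal R • ⊤ : Submodule R B) :=
        hc (Submodule.pow_mem_pow (radicalSubmodule R B) hxJ c)
      exact (smulTopIdeal B (IsLocalRing.maximalIdeal R)).mul_mem_left d h1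
    have : (⊤ : Submodule R B) ≤ LinearMap.range σ.toLinearMap := by
      refine Submodule.le_of_le_smul_of_le_jacobson_bot (I := IsLocalRing.maximalIdeal R)
        Module.Finite.fg_top (IsLocalRing.jacobson_eq_maximalIdeal ⊥ bot_ne_top).ge ?_
      intro b _
      obtain ⟨a, d, hb⟩ := hpow c b
      rw [hb]
      exact Submodule.add_mem_sup ⟨a, rfl⟩ (hmem d)
    intro b
    exact this (Submodule.mem_top : b ∈ ⊤)
  have hinj : Function.Injective σ := by
    have : IsNoetherian R B := isNoetherian_of_isNoetherianRing_of_finite R B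
    exact IsNoetherian.injective_of_surjective_endomorphism σ.toLinearMap hsurj
  refine ⟨x, AlgEquiv.ofBijective σ ⟨hinj, hsurj⟩, ⟨?_, ?_⟩, hJ, hσ⟩
  · intro a b hab
    refine hinj (sub_eq_zero.1 (hx _ ?_))
    rw [sub_mul, ← hσ, ← hσ]
    exact sub_eq_zero.2 hab
  · intro a b hab
    refine sub_eq_zero.1 (hx _ ?_)
    rw [sub_mul]
    exact sub_eq_zero.2 hab

/-- Conjugation by the generator of the radical of a homogeneous ring fixes the maximal two-sided
ideals `M`: otherwise, writing `M = B y`, one would have `M = M y`. -/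
theorem conj_mem_ker_of_homogeneous (H : IsHomogeneousRing B) {x : B}
    (hJ : Ring.jacobson B = Ideal.span {x}) (σ : B ≃ₐ[R] B) (hσ : ∀ b, x * b = σ b * x)
    {n : ℕ} {S : Fin n → Type*} [∀ i, Ring (S i)] [∀ i, IsSimpleRing (S i)] (ψ : B →+* ∀ i, S i)
    (hψ : Function.Surjective ψ) (hker : ∀ b, ψ b = 0 ↔ b ∈ Ring.jacobson B) (i : Fin n) {b : B}
    (hb : ψ b i = 0) : ψ (σ b) i = 0 := by
  by_contra hne
  have hfin := finite_quotient_jacobson R B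
  let f : B →+* S i := (Pi.evalRingHom S i).comp ψ
  have hf : Function.Surjective f := (Function.surjective_eval i).comp hψ
  let M : Ideal B := RingHom.ker f
  have hJM : Ring.jacobson B ≤ M := fun a ha => congrFun ((hker a).2 ha) i
  have : Finite (B ⧸ M) := Finite.of_surjective _ (Submodule.factor_surjective hJM)
  obtain ⟨y, hMy, hy⟩ := H M this
  have hyM : y ∈ M := hMy ▸ Ideal.mem_span_singleton_self y
  have hxM : x ∈ M := hJM (hJ ▸ Ideal.mem_span_singleton_self x)
  obtain ⟨w, hw, hw1⟩ : ∃ w ∈ M, f (σ w) = 1 :=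
    exists_mem_map_eq_one (f.comp (σ : B →+* B)) (hf.comp σ.surjective) M (b := b) hb hne
  have hu : 1 - σ w ∈ M := by
    change f (1 - σ w) = 0
    rw [map_sub, hw1, map_one, sub_self]
  obtain ⟨g, hg⟩ := Ideal.mem_span_singleton'.1 (hMy ▸ hxM)
  obtain ⟨h, hh⟩ := Ideal.mem_span_singleton'.1 (hMy ▸ hw)
  have hx' : x = ((1 - σ w) * g + x * h) * y := by
    rw [add_mul, mul_assoc, hg, mul_assoc, hh, hσ, sub_mul, one_mul]; abel
  have hmM : (1 - σ w) * g + x * h ∈ M :=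
    M.add_mem (Ideal.mul_mem_right _ _ hu) (Ideal.mul_mem_right _ _ hxM)
  obtain ⟨e, he⟩ := hψ (fun j => if j = i then 0 else 1)
  have hye : y - e * y ∈ Ring.jacobson B := by
    rw [← hker]
    funext j
    rw [map_sub, map_mul, he]
    by_cases hj : j = i
    · subst hj
      have : ψ y j = 0 := hyM
      simp [this]
    · simp [hj]
  rw [hJ] at hye
  obtain ⟨c, hc⟩ := Ideal.mem_span_singleton'.1 hye
  have heM : e ∈ M := by
    change ψ e i = 0
    rw [he]; simp
  have hfinal : (1 - (e + c * ((1 - σ w) * g + x * h))) * y = 0 := by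
    rw [sub_mul, add_mul, mul_assoc c, ← hx', hc, one_mul]; abel
  have h1 := hy _ hfinal
  have h2 : (1 : B) ∈ M := by
    rw [sub_eq_zero.1 h1]
    exact M.add_mem heM (M.mul_mem_left _ hmM)
  have : f 1 = 0 := h2
  rw [map_one] at this
  exact one_ne_zero this

end Generator

theorem mem_ker_of_map_mem_ker {R B : Type*} [CommRing R] [Ring B] [Algebra R B] (σ : B ≃ₐ[R] B)
    {n : ℕ} {S : Fin n → Type*} [∀ i, Ring (S i)] [∀ i, IsSimpleRing (S i)] (ψ : B →+* ∀ i, S i)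
    (hψ : Function.Surjective ψ) (i : Fin n) (hσ : ∀ b, ψ b i = 0 → ψ (σ b) i = 0) {b : B}
    (hb : ψ (σ b) i = 0) : ψ b i = 0 := by
  by_contra hne
  let f : B →+* S i := (Pi.evalRingHom S i).comp ψ
  have hf : Function.Surjective f := (Function.surjective_eval i).comp hψ
  obtain ⟨w, hw, hw1⟩ : ∃ w ∈ RingHom.ker (f.comp (σ : B →+* B)), f w = 1 :=
    exists_mem_map_eq_one f hf (RingHom.ker (f.comp (σ : B →+* B))) (b := b) hb hne
  have h1 : ψ (σ (w - 1)) i = 0 := hσ _ (by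
    change f (w - 1) = 0
    rw [map_sub, hw1, map_one, sub_self])
  have h2 : f (σ (w - 1)) = 0 := h1
  have h3 : f (σ w) = 0 := hw
  rw [map_sub, map_sub, h3, map_one, map_one, zero_sub, neg_eq_zero] at h2
  exact one_ne_zero h2

/-! ### Torsion-free algebras inside their generic fibre -/

section GenericFibre

variable {R A : Type*} [CommRing R] [IsDomain R] [Ring A] [Algebra R A]

theorem isLocalizedModule_includeRight {R A : Type*} [CommRing R] [Ring A] [Algebra R A] :
    IsLocalizedModule (nonZeroDivisors R)
      (Algebra.TensorProduct.includeRight : A →ₐ[R] FractionRing R ⊗[R] A).toLinearMap :=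
  inferInstanceAs (IsLocalizedModule (nonZeroDivisors R) (TensorProduct.mk R (FractionRing R) A 1))

theorem smul_eq_zero_of_torsionFree [Module.IsTorsionFree R A] {r : R} (hr : r ≠ 0) {a : A}
    (h : r • a = 0) : a = 0 :=
  Module.IsTorsionFree.isSMulRegular (IsRegular.of_ne_zero hr) (by simpa using h)

theorem includeRight_injective_of_torsionFree [Module.IsTorsionFree R A] :
    Function.Injective (Algebra.TensorProduct.includeRight : A →ₐ[R] FractionRing R ⊗[R] A) := by
  have := isLocalizedModule_includeRight (R := R) (A := A)
  rw [injective_iff_map_eq_zero]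
  intro a ha
  obtain ⟨s, hs⟩ := (IsLocalizedModule.eq_zero_iff (nonZeroDivisors R)
    (Algebra.TensorProduct.includeRight : A →ₐ[R] FractionRing R ⊗[R] A).toLinearMap).1 ha
  exact smul_eq_zero_of_torsionFree (nonZeroDivisors.ne_zero s.2) hs

theorem exists_smul_eq_includeRight (t : FractionRing R ⊗[R] A) :
    ∃ (s : R) (a : A), s ≠ 0 ∧ s • t = Algebra.TensorProduct.includeRight (R := R) a := by
  have := isLocalizedModule_includeRight (R := R) (A := A)
  obtain ⟨⟨a, s⟩, h⟩ := IsLocalizedModule.surj (nonZeroDivisors R)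
    (Algebra.TensorProduct.includeRight : A →ₐ[R] FractionRing R ⊗[R] A).toLinearMap t
  exact ⟨s, a, nonZeroDivisors.ne_zero s.2, h⟩

/-- The centre of an order in a central simple algebra over the fraction field of a normal domain
`R` is `R`. -/
theorem exists_algebraMap_eq_of_central [IsIntegrallyClosed R] (hA : IsCentralOrder R A) {a : A}
    (ha : ∀ b, a * b = b * a) : ∃ r, a = algebraMap R A r := by
  have := hA.finite
  have := hA.torsionFree
  have := hA.simple
  have hmem : (1 : FractionRing R) ⊗ₜ[R] a ∈
      Subalgebra.center (FractionRing R) (FractionRing R ⊗[R] A) := by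
    rw [Subalgebra.mem_center_iff]
    intro t
    induction t with
    | zero => simp
    | add x y hx hy => rw [add_mul, mul_add, hx, hy]
    | tmul k b => simp [ha]
  have hbot := hA.central.out hmem
  rw [Algebra.mem_bot] at hbot
  obtain ⟨k, hk⟩ := hbot
  have hint : IsIntegral R k := by
    have h1 : IsIntegral R ((1 : FractionRing R) ⊗ₜ[R] a) :=
      (Algebra.IsIntegral.isIntegral (R := R) a).map
        (Algebra.TensorProduct.includeRight : A →ₐ[R] FractionRing R ⊗[R] A)
    rw [← hk] at h1
    exact (isIntegral_algHom_iff
      (Algebra.TensorProduct.includeLeft : FractionRing R →ₐ[R] FractionRing R ⊗[R] A)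
      (algebraMap (FractionRing R) (FractionRing R ⊗[R] A)).injective).1 h1
  obtain ⟨r, rfl⟩ := IsIntegrallyClosed.isIntegral_iff.1 hint
  refine ⟨r, includeRight_injective_of_torsionFree (R := R) ?_⟩
  rw [AlgHom.commutes, Algebra.TensorProduct.includeRight_apply, ← hk,
    IsScalarTower.algebraMap_apply R (FractionRing R) (FractionRing R ⊗[R] A)]

end GenericFibre

/-! ### Approximately central elements -/

section Approximation

/-- By Artin–Rees, an element commuting with everything up to a high power of the maximal ideal is
congruent to a central element. -/
theorem exists_pow_forall_commutator_mem {R A : Type*} [CommRing R] [IsNoetherianRing R] [Ring A]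
    [Algebra R A] [Module.Finite R A] (m : Ideal R)
    (hcenter : ∀ a : A, (∀ b, a * b = b * a) → ∃ r, a = algebraMap R A r) :
    ∃ N : ℕ, ∀ a : A, (∀ y, a * y - y * a ∈ (m ^ N • ⊤ : Submodule R A)) →
      ∃ r : R, a - algebraMap R A r ∈ (m • ⊤ : Submodule R A) := by
  obtain ⟨s, hs⟩ := (Module.Finite.fg_top : (⊤ : Submodule R A).FG)
  let f : A →ₗ[R] (s → A) :=
    LinearMap.pi fun g => LinearMap.mulRight R (g : A) - LinearMap.mulLeft R (g : A)
  have hf : ∀ a g, f a g = a * g - g * a := fun a g => rfl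
  obtain ⟨k, hk⟩ := Ideal.exists_pow_inf_eq_pow_smul m (LinearMap.range f)
  refine ⟨k + 1, fun a ha => ?_⟩
  have h1 : f a ∈ (m ^ (k + 1) • ⊤ : Submodule R (s → A)) := by
    classical
    rw [← Finset.univ_sum_single (f a)]
    refine Submodule.sum_mem _ fun g _ => ?_
    have h := Submodule.mem_map_of_mem (f := LinearMap.single R (fun _ : s => A) g) (ha g)
    rw [Submodule.map_smul''] at h
    exact (smul_mono_right (m ^ (k + 1)) le_top :
      _ ≤ (m ^ (k + 1) • ⊤ : Submodule R (s → A))) h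
  have h2 : f a ∈ m • LinearMap.range f := by
    have h3 := hk (k + 1) (Nat.le_succ k)
    have h4 : f a ∈ (m ^ (k + 1) • ⊤ : Submodule R (s → A)) ⊓ LinearMap.range f := ⟨h1, a, rfl⟩
    rw [h3, Nat.add_sub_cancel_left, pow_one] at h4
    exact (smul_mono_right m inf_le_right : _ ≤ m • LinearMap.range f) h4
  rw [LinearMap.range_eq_map, ← Submodule.map_smul''] at h2
  obtain ⟨a', ha', haa'⟩ := h2
  have hcomm : ∀ b, (a - a') * b = b * (a - a') := by
    intro b
    have hb : b ∈ Submodule.span R (s : Set A) := hs ▸ Submodule.mem_top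
    induction hb using Submodule.span_induction with
    | mem g hg =>
      have := congrFun haa' ⟨g, hg⟩
      rw [hf, hf] at this
      rw [sub_mul, mul_sub, sub_eq_sub_iff_sub_eq_sub, this]
    | zero => simp
    | add x y _ _ hx hy => rw [mul_add, add_mul, hx, hy]
    | smul r x _ hx => rw [mul_smul_comm, smul_mul_assoc, hx]
  obtain ⟨r, hr⟩ := hcenter _ hcomm
  exact ⟨r, by rw [← hr]; simpa using ha'⟩

/-- If the commutator with `a` raises the `z`-adic order modulo a two-sided ideal `E` containing a
power of `z` and a positive integer, then some power of `a` is central modulo `E`. -/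
theorem exists_pow_commutator_mem {A : Type*} [Ring A] (E : Ideal A) [E.IsTwoSided] {z a : A}
    (hz : ∀ c, ∃ d, c * z = z * d) {N Q : ℕ} (hN : z ^ N ∈ E) (hQ : (Q : A) ∈ E) (hQ0 : Q ≠ 0)
    (ha : ∀ y, ∃ c, a * y - y * a - z * c ∈ E) (haz : ∃ c, a * z - z * a - z ^ 2 * c ∈ E) :
    ∃ n : ℕ, n ≠ 0 ∧ ∀ y, a ^ n * y - y * a ^ n ∈ E := by
  -- `P i` is the ideal `zⁱ A + E`
  let P : ℕ → A → Prop := fun i w => ∃ c, w - z ^ i * c ∈ E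
  have hPadd : ∀ i w w', P i w → P i w' → P i (w + w') := by
    rintro i w w' ⟨c, hc⟩ ⟨c', hc'⟩
    refine ⟨c + c', ?_⟩
    have := E.add_mem hc hc'
    rwa [show w - z ^ i * c + (w' - z ^ i * c') = w + w' - z ^ i * (c + c') by
      rw [mul_add]; abel] at this
  have hPE : ∀ i w, w ∈ E → P i w := fun i w hw => ⟨0, by simpa using hw⟩
  have hPr : ∀ i w b, P i w → P i (w * b) := by
    rintro i w b ⟨c, hc⟩
    refine ⟨c * b, ?_⟩
    have := E.mul_mem_right b hc
    rwa [sub_mul, mul_assoc] at this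
  have hPz : ∀ i w, P i w → P (i + 1) (z * w) := by
    rintro i w ⟨c, hc⟩
    refine ⟨c, ?_⟩
    have := E.mul_mem_left z hc
    rwa [mul_sub, ← mul_assoc, ← pow_succ'] at this
  have hzpow : ∀ i, P (i + 1) (a * z ^ i - z ^ i * a) := by
    intro i
    induction i with
    | zero => exact ⟨0, by simp⟩
    | succ i ih =>
      have h1 : a * z ^ (i + 1) - z ^ (i + 1) * a =
          z * (a * z ^ i - z ^ i * a) + (a * z - z * a) * z ^ i := by
        rw [pow_succ', mul_sub, sub_mul]; simp only [mul_assoc]; abel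
      rw [h1]
      refine hPadd _ _ _ (hPz _ _ ih) ?_
      obtain ⟨c, hc⟩ := haz
      have hcz : ∀ j, ∃ d, c * z ^ j = z ^ j * d := by
        intro j
        induction j with
        | zero => exact ⟨c, by simp⟩
        | succ j ihj =>
          obtain ⟨d, hd⟩ := ihj
          obtain ⟨d', hd'⟩ := hz d
          exact ⟨d', by rw [pow_succ, ← mul_assoc, hd, mul_assoc, hd', mul_assoc]⟩
      obtain ⟨d, hd⟩ := hcz i
      refine ⟨d, ?_⟩
      have := E.mul_mem_right (z ^ i) hc
      rwa [sub_mul, mul_assoc (z ^ 2), hd, ← mul_assoc, ← pow_add, add_comm 2 i] at this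
  have hδ : ∀ i w, P i w → P (i + 1) (a * w - w * a) := by
    rintro i w ⟨c, hc⟩
    have h1 : a * w - w * a = (a * z ^ i - z ^ i * a) * c + z ^ i * (a * c - c * a) +
        (a * (w - z ^ i * c) - (w - z ^ i * c) * a) := by
      simp only [mul_sub, sub_mul, mul_assoc]; abel
    rw [h1]
    refine hPadd _ _ _ (hPadd _ _ _ (hPr _ _ _ (hzpow i)) ?_)
      (hPE _ _ (E.sub_mem (E.mul_mem_left _ hc) (E.mul_mem_right _ hc)))
    obtain ⟨d, hd⟩ := ha c
    refine ⟨d, ?_⟩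
    have := E.mul_mem_left (z ^ i) hd
    rwa [mul_sub, ← mul_assoc, ← pow_succ] at this
  let D : Module.End ℤ A := LinearMap.mulLeft ℤ a - LinearMap.mulRight ℤ a
  have hD : ∀ w, D w = a * w - w * a := fun w => rfl
  have hDpow : ∀ i w, P i ((D ^ i) w) := by
    intro i
    induction i with
    | zero => exact fun w => ⟨w, by simp⟩
    | succ i ih =>
      intro w
      rw [pow_succ', Module.End.mul_apply, hD]
      exact hδ _ _ (ih w)
  -- the exponent makes all binomial coefficients `n.choose i`, `0 < i < N`, multiples of `Q`
  refine ⟨Q * N.factorial, mul_ne_zero hQ0 N.factorial_ne_zero, fun y => ?_⟩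
  set n := Q * N.factorial with hn
  have hcomm : Commute D (LinearMap.mulRight ℤ a) :=
    ((LinearMap.commute_mulLeft_right (R := ℤ) a a).sub_left (Commute.refl _))
  have hexp : a ^ n * y =
      ∑ i ∈ Finset.range (n + 1), (D ^ i) (y * a ^ (n - i)) * (n.choose i : A) := by
    have h1 : LinearMap.mulLeft ℤ a = D + LinearMap.mulRight ℤ a := by simp [D]
    have h2 : a ^ n * y = (LinearMap.mulLeft ℤ a ^ n) y := by
      rw [LinearMap.pow_mulLeft, LinearMap.mulLeft_apply]
    rw [h2, h1, hcomm.add_pow, LinearMap.sum_apply]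
    refine Finset.sum_congr rfl fun i _ => ?_
    have h3 : D ^ i * LinearMap.mulRight ℤ a ^ (n - i) * ((n.choose i : ℕ) : Module.End ℤ A) =
        ((n.choose i : ℕ) : Module.End ℤ A) * (D ^ i * LinearMap.mulRight ℤ a ^ (n - i)) :=
      ((Nat.cast_commute _ _).eq).symm
    rw [h3, Module.End.mul_apply, Module.End.mul_apply, LinearMap.pow_mulRight,
      LinearMap.mulRight_apply, Module.End.natCast_apply, nsmul_eq_mul, (Nat.cast_commute _ _).eq]
  rw [hexp, Finset.sum_range_succ']
  simp only [pow_zero, Module.End.one_apply, Nat.sub_zero, Nat.choose_zero_right, Nat.cast_one,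
    mul_one, add_sub_cancel_right]
  refine Submodule.sum_mem _ fun i _ => ?_
  by_cases hi : i + 1 ≤ N
  · refine E.mul_mem_left _ ?_
    have hdvd : Q ∣ n.choose (i + 1) := by
      obtain ⟨k, hk⟩ := Nat.dvd_factorial (Nat.succ_pos i) hi
      have hnpos : n = (n - 1) + 1 :=
        (Nat.succ_pred_eq_of_ne_zero (mul_ne_zero hQ0 N.factorial_ne_zero)).symm
      have h4 := Nat.add_one_mul_choose_eq (n - 1) i
      rw [← hnpos] at h4
      refine ⟨k * (n - 1).choose i, Nat.eq_of_mul_eq_mul_right (Nat.succ_pos i) ?_⟩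
      rw [← h4, hn, hk]
      ring
    obtain ⟨k, hk⟩ := hdvd
    rw [hk, Nat.cast_mul]
    exact E.mul_mem_right _ hQ
  · refine E.mul_mem_right _ ?_
    obtain ⟨c, hc⟩ := hDpow (i + 1) (y * a ^ (n - (i + 1)))
    have h5 : z ^ (i + 1) * c ∈ E := by
      obtain ⟨j, hj⟩ := Nat.exists_eq_add_of_le (Nat.le_of_not_le hi)
      rw [hj, pow_add]
      exact E.mul_mem_right _ (E.mul_mem_right _ hN)
    simpa using E.add_mem hc h5

end Approximation

/-! ### Indecomposability modulo a normal element -/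

theorem exists_coprime_powers {R B : Type*} [CommRing R] [Ring B] [Algebra R B]
    {I I' : Submodule R B} (hI : I * ⊤ ≤ I) (hI' : I' * ⊤ ≤ I') {u v : B} (hu : u ∈ I)
    (hv : v ∈ I') (huv : u + v = 1) (n : ℕ) :
    ∃ e ∈ I ^ (n + 1), ∃ f ∈ I' ^ (n + 1), e + f = 1 := by
  have hpow : ∀ K : Submodule R B, K * ⊤ ≤ K → K ^ (n + 1) * ⊤ ≤ K ^ (n + 1) := fun K hK => by
    rw [pow_succ, mul_assoc]
    exact mul_le_mul_right hK _
  have hco : IsCoprime (Polynomial.X : Polynomial ℤ) (1 - Polynomial.X) := ⟨1, 1, by ring⟩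
  obtain ⟨p, q, hpq⟩ := hco.pow (m := n + 1) (n := n + 1)
  have h := congrArg (Polynomial.aeval u) hpq
  rw [mul_comm p, mul_comm q] at h
  simp only [map_add, map_mul, map_pow, map_sub, map_one, Polynomial.aeval_X] at h
  rw [show 1 - u = v from sub_eq_of_eq_add' huv.symm] at h
  exact ⟨_, hpow I hI (Submodule.mul_mem_mul (Submodule.pow_mem_pow _ hu _) Submodule.mem_top),
    _, hpow I' hI' (Submodule.mul_mem_mul (Submodule.pow_mem_pow _ hv _) Submodule.mem_top), h⟩

theorem pow_mul_pow_le {S : Type*} [Semiring S] [PartialOrder S] [MulLeftMono S] [MulRightMono S]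
    {I I' J : S} (h : I * I' ≤ J) (hI : I * J ≤ J * I) (n : ℕ) : I ^ n * I' ^ n ≤ J ^ n := by
  have hcomm : ∀ n : ℕ, I ^ n * J ≤ J * I ^ n := by
    intro n
    induction n with
    | zero => simp
    | succ n ih =>
      calc I ^ (n + 1) * J = I ^ n * (I * J) := by rw [pow_succ, mul_assoc]
        _ ≤ I ^ n * (J * I) := mul_le_mul_right hI _
        _ = I ^ n * J * I := (mul_assoc _ _ _).symm
        _ ≤ J * I ^ n * I := mul_le_mul_left ih _
        _ = J * I ^ (n + 1) := by rw [pow_succ, mul_assoc]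
  induction n with
  | zero => simp
  | succ n ih =>
    calc I ^ (n + 1) * I' ^ (n + 1) = I ^ n * (I * I') * I' ^ n := by
          rw [pow_succ I, pow_succ' I']; simp only [mul_assoc]
      _ ≤ I ^ n * J * I' ^ n := mul_le_mul_left (mul_le_mul_right h _) _
      _ ≤ J * I ^ n * I' ^ n := mul_le_mul_left (hcomm n) _
      _ = J * (I ^ n * I' ^ n) := mul_assoc _ _ _
      _ ≤ J * J ^ n := mul_le_mul_right ih _
      _ = J ^ (n + 1) := (pow_succ' _ _).symm

/-- Let `B = A / z A` with `z` normal in the radical of `A`, and suppose that `A` has centre `R`.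
If two complementary ideals of `B` modulo the radical `J` are stable under conjugation by `z`, then
the corresponding central idempotent of `B / J` comes from `R`.

An idempotent modulo `Jⁿ` lifts to `a ∈ A` whose commutators raise the `z`-adic order up to a small
error, so some power of `a` is approximately central, hence close to an element of the centre. -/
theorem exists_scalar_mod_jacobson {R A B : Type*} [CommRing R] [IsLocalRing R]
    [IsNoetherianRing R] [Finite (IsLocalRing.ResidueField R)] [Ring A] [Algebra R A]
    [Module.Finite R A] [Ring B] [Algebra R B]
    (hcenter : ∀ a : A, (∀ b, a * b = b * a) → ∃ r, a = algebraMap R A r)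
    {z : A} (hnorm : IsNormalElement z) (hz : z ∈ Ring.jacobson A)
    (τ : A ≃ₐ[R] A) (hτ : ∀ a, z * a = τ a * z) (π : A →ₐ[R] B) (hπ : Function.Surjective π)
    (hker : ∀ a, π a = 0 ↔ ∃ c, a = z * c) (τ' : B ≃ₐ[R] B) (hττ' : ∀ a, π (τ a) = τ' (π a))
    {I I' : Submodule R B} (hIl : ⊤ * I ≤ I) (hIr : I * ⊤ ≤ I) (hIl' : ⊤ * I' ≤ I')
    (hIr' : I' * ⊤ ≤ I')
    (h1 : I * I' ≤ radicalSubmodule R B) (h2 : I' * I ≤ radicalSubmodule R B)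
    (hJ : I * radicalSubmodule R B ≤ radicalSubmodule R B * I)
    (hJ' : I' * radicalSubmodule R B ≤ radicalSubmodule R B * I')
    (hτI : I.map τ'.toLinearMap ≤ I) (hτI' : I'.map τ'.toLinearMap ≤ I')
    {u v : B} (hu : u ∈ I) (hv : v ∈ I') (huv : u + v = 1) :
    ∃ e ∈ I, ∃ f ∈ I', e + f = 1 ∧ ∃ r : R, e - algebraMap R B r ∈ Ring.jacobson B := by
  set m := IsLocalRing.maximalIdeal R with hm
  obtain ⟨N₀, hN₀⟩ := exists_pow_forall_commutator_mem m hcenter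
  obtain ⟨n, hn⟩ := radicalSubmodule_pow_le_smul_top R (B := A) N₀
  have hn1 : radicalSubmodule R A ^ (n + 1) ≤ (m ^ N₀ • ⊤ : Submodule R A) := by
    rw [pow_succ]
    exact Submodule.mul_le.2 fun a ha b _ =>
      (smulTopIdeal A (m ^ N₀)).mul_mem_right b (hn ha)
  have hmapJ : ∀ k, ∀ b ∈ radicalSubmodule R B ^ k, ∃ a ∈ radicalSubmodule R A ^ k, π a = b := by
    intro k b hb
    have hle : radicalSubmodule R B ≤ (radicalSubmodule R A).map π.toLinearMap := by
      intro b hb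
      obtain ⟨a, rfl⟩ := hπ b
      have : RingHomSurjective (π : A →+* B) := ⟨hπ⟩
      have hk : RingHom.ker (π : A →+* B) ≤ Ring.jacobson A := by
        intro c hc
        obtain ⟨d, rfl⟩ := (hker c).1 hc
        exact mul_mem_jacobson_right hz d
      have := Ring.map_jacobson_of_ker_le (f := (π : A →+* B)) hk
      have hb' : π a ∈ Ring.jacobson B := hb
      rw [← this] at hb'
      obtain ⟨c, hc, hca⟩ := hb'
      exact ⟨c, hc, hca⟩
    have := pow_le_pow_left' hle k hb
    rw [← Submodule.map_pow] at this
    exact this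
  obtain ⟨e, he, f, hf, hef⟩ := exists_coprime_powers hIr hIr' hu hv huv n
  have hIpow : ∀ K : Submodule R B, ⊤ * K ≤ K → K ^ (n + 1) ≤ K := fun K hK => by
    rw [pow_succ]
    exact (mul_le_mul_left le_top _).trans hK
  have hIpowr : ∀ K : Submodule R B, K * ⊤ ≤ K → K ^ (n + 1) * ⊤ ≤ K ^ (n + 1) := fun K hK => by
    rw [pow_succ, mul_assoc]
    exact mul_le_mul_right hK _
  refine ⟨e, hIpow I hIl he, f, hIpow I' hIl' hf, hef, ?_⟩
  have hIJ : I ^ (n + 1) * I' ^ (n + 1) ≤ radicalSubmodule R B ^ (n + 1) := pow_mul_pow_le h1 hJ _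
  have hIJ' : I' ^ (n + 1) * I ^ (n + 1) ≤ radicalSubmodule R B ^ (n + 1) :=
    pow_mul_pow_le h2 hJ' _
  have hmem : ∀ {x y}, x ∈ I ^ (n + 1) → y ∈ I' ^ (n + 1) → ∀ b,
      x * b * y ∈ radicalSubmodule R B ^ (n + 1) := fun hx hy b =>
    hIJ (Submodule.mul_mem_mul (hIpowr I hIr (Submodule.mul_mem_mul hx Submodule.mem_top)) hy)
  have hmem' : ∀ {x y}, x ∈ I' ^ (n + 1) → y ∈ I ^ (n + 1) → ∀ b,
      x * b * y ∈ radicalSubmodule R B ^ (n + 1) := fun hx hy b =>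
    hIJ' (Submodule.mul_mem_mul (hIpowr I' hIr' (Submodule.mul_mem_mul hx Submodule.mem_top)) hy)
  have hcomm : ∀ b, e * b - b * e ∈ radicalSubmodule R B ^ (n + 1) := by
    intro b
    have : e * b - b * e = e * b * f - f * b * e := by
      rw [← eq_sub_iff_add_eq'] at hef
      rw [hef]; noncomm_ring
    rw [this]
    exact sub_mem (hmem he hf b) (hmem' hf he b)
  have hτpow : ∀ K : Submodule R B, K.map τ'.toLinearMap ≤ K → ∀ x ∈ K ^ (n + 1),
      τ' x ∈ K ^ (n + 1) := by
    intro K hK x hx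
    have := Submodule.mem_map_of_mem (f := (τ' : B →ₐ[R] B).toLinearMap) hx
    rw [Submodule.map_pow] at this
    exact pow_le_pow_left' hK _ this
  have hτe : e - τ' e ∈ radicalSubmodule R B ^ (n + 1) := by
    have h4 : τ' e + τ' f = 1 := by rw [← map_add, hef, map_one]
    have : e - τ' e = τ' f * 1 * e - τ' e * 1 * f := by
      rw [← eq_sub_iff_add_eq'] at hef h4
      rw [h4, hef]; noncomm_ring
    rw [this]
    exact sub_mem (hmem' (hτpow I' hτI' f hf) he 1) (hmem (hτpow I hτI e he) hf 1)
  obtain ⟨a, ha⟩ := hπ e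
  have hlift : ∀ w : A, π w ∈ radicalSubmodule R B ^ (n + 1) →
      ∃ c, w - z * c ∈ smulTopIdeal A (m ^ N₀) := by
    intro w hw
    obtain ⟨w', hw', hww'⟩ := hmapJ _ _ hw
    obtain ⟨c, hc⟩ := (hker (w - w')).1 (by rw [map_sub, hww', sub_self])
    refine ⟨c, hn1 ?_⟩
    rwa [← hc, sub_sub_cancel]
  have hzpow : z ^ (n + 1) ∈ smulTopIdeal A (m ^ N₀) :=
    hn1 (Submodule.pow_mem_pow (radicalSubmodule R A) hz _)
  -- a power of the order of the residue field is a positive integer in `m ^ N₀`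
  obtain ⟨q, hq0, hqm⟩ : ∃ q : ℕ, q ≠ 0 ∧ (q : R) ∈ m := by
    refine ⟨Nat.card (IsLocalRing.ResidueField R), Nat.card_pos.ne', ?_⟩
    rw [hm, ← IsLocalRing.residue_eq_zero_iff, map_natCast]
    have := Fintype.ofFinite (IsLocalRing.ResidueField R)
    rw [Nat.card_eq_fintype_card]
    exact Nat.cast_card_eq_zero _
  have hQ : ((q ^ N₀ : ℕ) : A) ∈ smulTopIdeal A (m ^ N₀) := by
    have h5 : ((q ^ N₀ : ℕ) : A) = ((q : R) ^ N₀) • (1 : A) := by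
      rw [Algebra.smul_def, mul_one]; simp
    rw [h5, mem_smulTopIdeal]
    exact Submodule.smul_mem_smul (Ideal.pow_mem_pow hqm N₀) Submodule.mem_top
  obtain ⟨k, hk0, hk⟩ := exists_pow_commutator_mem (smulTopIdeal A (m ^ N₀)) (z := z) (a := a)
    hnorm.2 hzpow hQ (pow_ne_zero _ hq0)
    (fun y => hlift _ (by rw [map_sub, map_mul, map_mul, ha]; exact hcomm _)) (by
      obtain ⟨c, hc⟩ := hlift (a - τ a) (by rw [map_sub, hττ', ha]; exact hτe)
      obtain ⟨d, hd⟩ := hnorm.2 c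
      refine ⟨d, ?_⟩
      have := Ideal.mul_mem_right z _ hc
      rwa [sub_mul, sub_mul, ← hτ, mul_assoc z, hd, ← mul_assoc, ← pow_two] at this)
  obtain ⟨r, hr⟩ := hN₀ _ hk
  refine ⟨r, ?_⟩
  have hr' : e ^ k - algebraMap R B r ∈ Ring.jacobson B := by
    have h6 := smul_top_le_radicalSubmodule R hr
    have : RingHomSurjective (π : A →+* B) := ⟨hπ⟩
    have h7 := Ring.le_comap_jacobson (π : A →+* B) h6
    rw [Ideal.mem_comap] at h7
    simpa [ha] using h7
  have hek : ∀ j : ℕ, e ^ (j + 1) - e ∈ Ring.jacobson B := by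
    intro j
    induction j with
    | zero => simp
    | succ j ih =>
      have h8 : e * f ∈ Ring.jacobson B :=
        h1 (Submodule.mul_mem_mul (hIpow I hIl he) (hIpow I' hIl' hf))
      have h9 : e ^ (j + 1 + 1) - e = (e ^ (j + 1) - e) * e - e * f := by
        rw [← eq_sub_iff_add_eq'] at hef
        rw [hef, pow_succ e (j + 1)]; noncomm_ring
      rw [h9]
      exact sub_mem (mul_mem_jacobson_right ih e) h8
  obtain ⟨j, rfl⟩ := Nat.exists_eq_succ_of_ne_zero hk0
  have := sub_mem hr' (hek j)
  rwa [sub_sub_sub_cancel_left, ← neg_sub, neg_sub] at this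

/-! ### Rings whose radical is generated by a regular normal element -/

section NormalGenerator

variable {R B : Type*} [CommRing R] [Ring B] [Algebra R B] {x : B} (σ : B ≃ₐ[R] B)

theorem mul_eq_mul_symm (hσ : ∀ b, x * b = σ b * x) (b : B) : b * x = x * σ.symm b := by
  rw [hσ, σ.apply_symm_apply]

theorem pow_mul_eq (hσ : ∀ b, x * b = σ b * x) (k : ℕ) (b : B) :
    x ^ k * b = (σ ^ k) b * x ^ k := by
  induction k generalizing b with
  | zero => simp
  | succ k ih =>
    rw [pow_succ, mul_assoc, hσ, ← mul_assoc, ih, mul_assoc, ← pow_succ, pow_succ σ]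
    rfl

theorem mul_pow_eq (hσ : ∀ b, x * b = σ b * x) (k : ℕ) (b : B) :
    b * x ^ k = x ^ k * (σ ^ k).symm b := by
  rw [pow_mul_eq σ hσ, (σ ^ k).apply_symm_apply]

theorem mem_jacobson_iff_left (hJ : Ring.jacobson B = Ideal.span {x}) {b : B} :
    b ∈ Ring.jacobson B ↔ ∃ c, b = c * x := by
  rw [hJ, Ideal.mem_span_singleton']
  exact exists_congr fun c => eq_comm

theorem mem_jacobson_iff_right (hJ : Ring.jacobson B = Ideal.span {x})
    (hσ : ∀ b, x * b = σ b * x) {b : B} : b ∈ Ring.jacobson B ↔ ∃ c, b = x * c := by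
  rw [mem_jacobson_iff_left hJ]
  constructor
  · rintro ⟨c, rfl⟩
    exact ⟨_, mul_eq_mul_symm σ hσ c⟩
  · rintro ⟨c, rfl⟩
    exact ⟨_, hσ c⟩

/-- The powers of the radical intersect in zero. -/
theorem exists_eq_pow_mul_of_ne_zero [IsNoetherianRing B] (hx : IsRegular x)
    (hJ : Ring.jacobson B = Ideal.span {x}) (hσ : ∀ b, x * b = σ b * x) {b : B} (hb : b ≠ 0) :
    ∃ (k : ℕ) (c : B), b = x ^ k * c ∧ c ∉ Ring.jacobson B := by
  let N : Ideal B :=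
    { carrier := {b | ∀ k : ℕ, ∃ c, b = x ^ k * c}
      add_mem' := fun {a a'} ha ha' k => by
        obtain ⟨c, hc⟩ := ha k
        obtain ⟨c', hc'⟩ := ha' k
        exact ⟨c + c', by rw [hc, hc', mul_add]⟩
      zero_mem' := fun k => ⟨0, by simp⟩
      smul_mem' := fun y a ha k => by
        obtain ⟨c, hc⟩ := ha k
        exact ⟨(σ ^ k).symm y * c, by
          rw [smul_eq_mul, hc, ← mul_assoc, mul_pow_eq σ hσ, mul_assoc]⟩ }
  have hN : N = ⊥ := by
    refine Submodule.FG.eq_bot_of_le_jacobson_smul (IsNoetherian.noetherian N) fun a ha => ?_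
    obtain ⟨a', ha'⟩ := ha 1
    rw [pow_one] at ha'
    rw [ha']
    refine Submodule.smul_mem_smul (hJ ▸ Ideal.mem_span_singleton_self x) fun k => ?_
    obtain ⟨c, hc⟩ := ha (k + 1)
    exact ⟨c, hx.left (by simp only; rw [← ha', hc, pow_succ', mul_assoc])⟩
  have hbN : ∃ k : ℕ, ¬ ∃ c, b = x ^ k * c := by
    by_contra! h
    have : b ∈ N := h
    rw [hN] at this
    exact hb this
  classical
  obtain ⟨k, hk⟩ : ∃ k, Nat.find hbN = k + 1 :=
    Nat.exists_eq_succ_of_ne_zero fun h0 => by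
      have := Nat.find_spec hbN
      rw [h0] at this
      exact this ⟨b, by simp⟩
  obtain ⟨c, hc⟩ := not_not.1 (Nat.find_min hbN (m := k) (by omega))
  refine ⟨k, c, hc, fun hcJ => ?_⟩
  obtain ⟨c', rfl⟩ := (mem_jacobson_iff_right σ hJ hσ).1 hcJ
  have := Nat.find_spec hbN
  rw [hk] at this
  exact this ⟨c', by rw [hc, pow_succ, mul_assoc]⟩

variable {n : ℕ} {S : Fin n → Type*} [∀ i, Ring (S i)]

/-- The two-sided ideal of the elements vanishing in the simple quotients indexed by `V`. -/
def vanishingSubmodule (R : Type*) {B : Type*} [CommRing R] [Ring B] [Algebra R B] {n : ℕ}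
    {S : Fin n → Type*} [∀ i, Ring (S i)] (ψ : B →+* ∀ i, S i) (V : Set (Fin n)) :
    Submodule R B where
  carrier := {b | ∀ i ∈ V, ψ b i = 0}
  add_mem' ha hb i hi := by rw [map_add, Pi.add_apply, ha i hi, hb i hi, add_zero]
  zero_mem' i _ := by rw [map_zero, Pi.zero_apply]
  smul_mem' r b hb i hi := by
    rw [Algebra.smul_def, map_mul, Pi.mul_apply, hb i hi, mul_zero]

theorem vanishingSubmodule_mul_le (ψ : B →+* ∀ i, S i) (V W : Set (Fin n)) :
    vanishingSubmodule R ψ V * vanishingSubmodule R ψ W ≤ vanishingSubmodule R ψ (V ∪ W) :=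
  Submodule.mul_le.2 fun a ha b hb i hi => by
    rw [map_mul, Pi.mul_apply]
    rcases hi with hi | hi
    · rw [ha i hi, zero_mul]
    · rw [hb i hi, mul_zero]

theorem vanishingSubmodule_empty (ψ : B →+* ∀ i, S i) : vanishingSubmodule R ψ ∅ = ⊤ :=
  eq_top_iff.2 fun _ _ _ hi => hi.elim

theorem vanishingSubmodule_univ (ψ : B →+* ∀ i, S i)
    (hker : ∀ b, ψ b = 0 ↔ b ∈ Ring.jacobson B) :
    vanishingSubmodule R ψ Set.univ = radicalSubmodule R B := by
  ext b
  rw [mem_radicalSubmodule, ← hker]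
  exact ⟨fun h => funext fun i => h i trivial, fun h i _ => congrFun h i⟩

/-- If the maximal two-sided ideals are stable under `ρ`, then `c B ρ(c) ⊆ J` only for
`c ∈ J`. -/
theorem exists_mul_mul_notMem_jacobson [∀ i, IsSimpleRing (S i)] (ψ : B →+* ∀ i, S i)
    (hψ : Function.Surjective ψ) (hker : ∀ b, ψ b = 0 ↔ b ∈ Ring.jacobson B) {c c' : B}
    (hc : c ∉ Ring.jacobson B) (hc' : ∀ i, ψ c' i = 0 → ψ c i = 0) :
    ∃ y, c * y * c' ∉ Ring.jacobson B := by
  by_contra! h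
  obtain ⟨i, hi⟩ : ∃ i, ψ c i ≠ 0 := by
    by_contra! h0
    exact hc ((hker c).1 (funext h0))
  let T : Ideal B :=
    { carrier := {w | ∀ y, c * y * w ∈ Ring.jacobson B}
      add_mem' := fun ha hb y => by rw [mul_add]; exact add_mem (ha y) (hb y)
      zero_mem' := fun y => by simp
      smul_mem' := fun a b hb y => by
        rw [smul_eq_mul, ← mul_assoc, mul_assoc c]; exact hb _ }
  have : T.IsTwoSided := ⟨fun {a} b ha y => by
    rw [← mul_assoc]
    exact mul_mem_jacobson_right (ha y) b⟩
  obtain ⟨w, hw, hw1⟩ := exists_mem_map_eq_one ((Pi.evalRingHom S i).comp ψ)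
    ((Function.surjective_eval i).comp hψ) T (b := c') h fun h0 => hi (hc' i h0)
  have h2 := congrFun ((hker _).2 (hw 1)) i
  have h3 : ψ w i = 1 := hw1
  rw [mul_one, map_mul, Pi.mul_apply, h3, mul_one] at h2
  exact hi h2

theorem map_pow_apply_eq_zero_iff (ψ : B →+* ∀ i, S i)
    (hσψ : ∀ i b, ψ (σ b) i = 0 ↔ ψ b i = 0) (k : ℕ) (i : Fin n) (b : B) :
    ψ ((σ ^ k) b) i = 0 ↔ ψ b i = 0 := by
  induction k generalizing b with
  | zero => rfl
  | succ k ih =>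
    rw [pow_succ', AlgEquiv.mul_apply, hσψ, ih]

theorem map_pow_symm_apply_eq_zero_iff (ψ : B →+* ∀ i, S i)
    (hσψ : ∀ i b, ψ (σ b) i = 0 ↔ ψ b i = 0) (k : ℕ) (i : Fin n) (b : B) :
    ψ ((σ ^ k).symm b) i = 0 ↔ ψ b i = 0 := by
  rw [← map_pow_apply_eq_zero_iff σ ψ hσψ k i ((σ ^ k).symm b), (σ ^ k).apply_symm_apply]

/-- An automorphism moves the generator of the radical by a unit. -/
theorem exists_unit_map_pow_eq (hx : IsRegular x) (hJ : Ring.jacobson B = Ideal.span {x})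
    (hσ : ∀ b, x * b = σ b * x) (τ' : B ≃ₐ[R] B) (k : ℕ) :
    ∃ w : Bˣ, τ' x ^ k = x ^ k * w := by
  have hxJ : x ∈ Ring.jacobson B := hJ ▸ Ideal.mem_span_singleton_self x
  have hmem : ∀ ρ : B ≃ₐ[R] B, ∃ w, ρ x = x * w := fun ρ => by
    have : RingHomSurjective (ρ : B →+* B) := ⟨ρ.surjective⟩
    exact (mem_jacobson_iff_right σ hJ hσ).1 (Ring.le_comap_jacobson (ρ : B →+* B) hxJ)
  obtain ⟨w₁, h₁⟩ := hmem τ'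
  obtain ⟨w₂, h₂⟩ := hmem τ'.symm
  have e₁ : w₁ * τ' w₂ = 1 := hx.left (by
    simp only
    rw [← mul_assoc, ← h₁, ← map_mul, ← h₂, τ'.apply_symm_apply, mul_one])
  have e₂ : τ' w₂ * w₁ = 1 := τ'.symm.injective (hx.left (by
    simp only
    rw [map_mul, τ'.symm_apply_apply, ← mul_assoc, ← h₂, ← map_mul, ← h₁, τ'.symm_apply_apply,
      map_one, mul_one]))
  induction k with
  | zero => exact ⟨1, by simp⟩
  | succ k ih =>
    obtain ⟨w, hw⟩ := ih
    refine ⟨Units.map (σ.symm : B →* B) w * ⟨w₁, τ' w₂, e₁, e₂⟩, ?_⟩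
    rw [pow_succ, hw, h₁, pow_succ, mul_assoc (x ^ k), ← mul_assoc (w : B), mul_eq_mul_symm σ hσ,
      mul_assoc (x ^ k), Units.val_mul, mul_assoc x]
    rfl

/-- Let `c` normalise `B`. An automorphism preserving `c` up to a unit preserves the ideals of
elements vanishing, respectively, where `c` vanishes and where it does not. -/
theorem map_vanishingSubmodule_le [∀ i, IsSimpleRing (S i)] (ψ : B →+* ∀ i, S i)
    (hψ : Function.Surjective ψ) (hker : ∀ b, ψ b = 0 ↔ b ∈ Ring.jacobson B) (τ' : B ≃ₐ[R] B)
    {c : B} {w : Bˣ} (hw : c = w * τ' c) (hinv : ∀ i, ψ c i ≠ 0 → ∃ l, l * ψ c i = 1) :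
    (vanishingSubmodule R ψ {i | ψ c i = 0}).map τ'.toLinearMap ≤
        vanishingSubmodule R ψ {i | ψ c i = 0} ∧
      (vanishingSubmodule R ψ {i | ψ c i ≠ 0}).map τ'.toLinearMap ≤
        vanishingSubmodule R ψ {i | ψ c i ≠ 0} := by
  have hτJ : ∀ b ∈ Ring.jacobson B, τ' b ∈ Ring.jacobson B := fun b hb => by
    have : RingHomSurjective (τ' : B →+* B) := ⟨τ'.surjective⟩
    exact Ring.le_comap_jacobson (τ' : B →+* B) hb
  choose! l hl using hinv
  constructor
  · rintro _ ⟨b, hb, rfl⟩ i hi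
    classical
    obtain ⟨g, hg⟩ := hψ (fun i => ψ b i * l i)
    have h1 : b - g * c ∈ Ring.jacobson B := by
      rw [← hker]
      funext j
      rw [map_sub, map_mul, hg, Pi.sub_apply, Pi.mul_apply, Pi.zero_apply]
      by_cases hj : ψ c j = 0
      · rw [hj, hb j hj, mul_zero, sub_zero]
      · rw [mul_assoc, hl j hj, mul_one, sub_self]
    have h2 := congrFun ((hker _).2 (hτJ _ h1)) i
    have h3 : τ' c = (↑w⁻¹ : B) * c := by rw [hw, Units.inv_mul_cancel_left, ← hw]
    have h4 : ψ c i = 0 := hi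
    rw [map_sub, map_mul, h3, map_sub, map_mul, map_mul, Pi.sub_apply, Pi.mul_apply, Pi.mul_apply,
      h4, mul_zero, mul_zero, sub_zero] at h2
    exact h2
  · rintro _ ⟨b, hb, rfl⟩ i hi
    have h1 : c * b ∈ Ring.jacobson B := by
      rw [← hker]
      funext j
      rw [map_mul, Pi.mul_apply, Pi.zero_apply]
      by_cases hj : ψ c j = 0
      · rw [hj, zero_mul]
      · rw [hb j hj, mul_zero]
    have h2 : c * τ' b ∈ Ring.jacobson B := by
      have := mul_mem_jacobson_left (hτJ _ h1) (w : B)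
      rwa [map_mul, ← mul_assoc, ← hw] at this
    have h3 := congrFun ((hker _).2 h2) i
    rw [map_mul, Pi.mul_apply, Pi.zero_apply] at h3
    have h4 : l i * (ψ c i * ψ (τ' b) i) = 0 := by rw [h3, mul_zero]
    rwa [← mul_assoc, hl i hi, one_mul] at h4

/-- A normal element generates a two-sided ideal, so each of its components in a product of simple
rings is either zero or invertible. -/
theorem exists_inverse_of_normal [∀ i, IsSimpleRing (S i)] (ψ : B →+* ∀ i, S i)
    (hψ : Function.Surjective ψ) (ρ : B ≃ₐ[R] B) {c : B} (hc : ∀ b, c * b = ρ b * c) (i : Fin n)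
    (hi : ψ c i ≠ 0) : (∃ l, l * ψ c i = 1) ∧ ∃ l, ψ c i * l = 1 := by
  have : (Ideal.span {c}).IsTwoSided := ⟨fun {a} b ha => by
    obtain ⟨a, rfl⟩ := Ideal.mem_span_singleton'.1 ha
    rw [mul_assoc, hc, ← mul_assoc]
    exact Ideal.mul_mem_left _ _ (Ideal.mem_span_singleton_self c)⟩
  obtain ⟨w, hw, hw1⟩ := exists_mem_map_eq_one ((Pi.evalRingHom S i).comp ψ)
    ((Function.surjective_eval i).comp hψ) (Ideal.span {c}) (Ideal.mem_span_singleton_self c) hi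
  obtain ⟨a, rfl⟩ := Ideal.mem_span_singleton'.1 hw
  have h1 : ψ a i * ψ c i = 1 := by rw [← hw1, map_mul]; rfl
  refine ⟨⟨_, h1⟩, ψ (ρ.symm a) i, ?_⟩
  rw [← Pi.mul_apply, ← map_mul, hc, ρ.apply_symm_apply, map_mul, Pi.mul_apply, h1]

end NormalGenerator

/-! ### The discrete valuation ring of invariant central elements -/

section InvariantCentre

variable {R A B : Type*} [CommRing R] [IsLocalRing R] [IsNoetherianRing R]
  [Finite (IsLocalRing.ResidueField R)] [Ring A] [Algebra R A] [Module.Finite R A]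
  [Ring B] [Algebra R B] [Module.Finite R B]

/-- A central element of `B = A / z A` invariant under conjugation by `z` is a power of the
generator `x` of the radical, up to a unit. Indeed write it as `x ^ k * c` with `c` outside the
radical; the set of simple quotients in which `c` vanishes is invariant under conjugation by `z`,
hence empty. -/
theorem exists_eq_pow_mul_unit
    (hcenter : ∀ a : A, (∀ b, a * b = b * a) → ∃ r, a = algebraMap R A r)
    {z : A} (hnorm : IsNormalElement z) (hz : z ∈ Ring.jacobson A)
    (τ : A ≃ₐ[R] A) (hτ : ∀ a, z * a = τ a * z) (π : A →ₐ[R] B) (hπ : Function.Surjective π)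
    (hker : ∀ a, π a = 0 ↔ ∃ c, a = z * c) (τ' : B ≃ₐ[R] B) (hττ' : ∀ a, π (τ a) = τ' (π a))
    {x : B} (σ : B ≃ₐ[R] B) (hx : IsRegular x) (hJ : Ring.jacobson B = Ideal.span {x})
    (hσ : ∀ b, x * b = σ b * x) {n : ℕ} {S : Fin n → Type*} [∀ i, Ring (S i)]
    [∀ i, IsSimpleRing (S i)] (ψ : B →+* ∀ i, S i) (hψ : Function.Surjective ψ)
    (hψker : ∀ b, ψ b = 0 ↔ b ∈ Ring.jacobson B) (hσψ : ∀ i b, ψ (σ b) i = 0 ↔ ψ b i = 0)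
    {d : B} (hd : ∀ b, d * b = b * d) (hτd : τ' d = d) (hd0 : d ≠ 0) :
    ∃ (k : ℕ) (u : Bˣ), d = x ^ k * u := by
  have : IsNoetherianRing B := isNoetherian_of_tower R inferInstance
  obtain ⟨k, c, hdc, hcJ⟩ := exists_eq_pow_mul_of_ne_zero σ hx hJ hσ hd0
  have hxk : IsRegular (x ^ k) := hx.pow k
  have hc : ∀ b, c * b = (σ ^ k).symm b * c := fun b => hxk.left (by
    simp only
    rw [← mul_assoc, ← hdc, hd, hdc, ← mul_assoc, mul_pow_eq σ hσ, mul_assoc])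
  have hinv := exists_inverse_of_normal ψ hψ (σ ^ k).symm hc
  obtain ⟨w, hw⟩ := exists_unit_map_pow_eq σ hx hJ hσ τ' k
  have hwc : c = w * τ' c := hxk.left (by
    simp only
    rw [← hdc, ← mul_assoc, ← hw, ← map_pow, ← map_mul, ← hdc, hτd])
  obtain ⟨hτI, hτI'⟩ := map_vanishingSubmodule_le ψ hψ hψker τ' hwc fun i hi => (hinv i hi).1
  set V : Set (Fin n) := {i | ψ c i = 0} with hV
  have hVc : {i | ψ c i ≠ 0} = Vᶜ := rfl
  rw [hVc] at hτI'
  have htop : ∀ W : Set (Fin n), ⊤ * vanishingSubmodule R ψ W ≤ vanishingSubmodule R ψ W := by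
    intro W
    rw [← vanishingSubmodule_empty (R := R) ψ]
    exact (vanishingSubmodule_mul_le ψ _ _).trans_eq (by rw [Set.empty_union])
  have htop' : ∀ W : Set (Fin n), vanishingSubmodule R ψ W * ⊤ ≤ vanishingSubmodule R ψ W := by
    intro W
    rw [← vanishingSubmodule_empty (R := R) ψ]
    exact (vanishingSubmodule_mul_le ψ _ _).trans_eq (by rw [Set.union_empty])
  have hcomm : ∀ W : Set (Fin n), vanishingSubmodule R ψ W * radicalSubmodule R B ≤
      radicalSubmodule R B * vanishingSubmodule R ψ W := by
    refine fun W => Submodule.mul_le.2 fun b hb j hj => ?_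
    obtain ⟨c', rfl⟩ := (mem_jacobson_iff_right σ hJ hσ).1 hj
    rw [← mul_assoc, mul_eq_mul_symm σ hσ, mul_assoc]
    refine Submodule.mul_mem_mul (hJ ▸ Ideal.mem_span_singleton_self x : x ∈ Ring.jacobson B)
      (htop' W (Submodule.mul_mem_mul (fun i hi => ?_) Submodule.mem_top))
    rw [← hσψ, σ.apply_symm_apply]
    exact hb i hi
  classical
  obtain ⟨u, hu⟩ := hψ (fun i => if i ∈ V then 0 else 1)
  have huV : u ∈ vanishingSubmodule R ψ V := fun i hi => by rw [hu]; exact if_pos hi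
  have hvV : 1 - u ∈ vanishingSubmodule R ψ Vᶜ := fun i hi => by
    rw [map_sub, hu, map_one, Pi.sub_apply, Pi.one_apply, if_neg hi, sub_self]
  obtain ⟨e, he, f, hf, hef, r, hr⟩ := exists_scalar_mod_jacobson hcenter hnorm hz τ hτ π hπ hker
    τ' hττ' (htop V) (htop' V) (htop Vᶜ) (htop' Vᶜ)
    ((vanishingSubmodule_mul_le ψ _ _).trans_eq
      (by rw [Set.union_compl_self, vanishingSubmodule_univ ψ hψker]))
    ((vanishingSubmodule_mul_le ψ _ _).trans_eq
      (by rw [Set.compl_union_self, vanishingSubmodule_univ ψ hψker]))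
    (hcomm V) (hcomm Vᶜ) hτI hτI' huV hvV (add_sub_cancel u 1)
  have hne : ∀ i, ψ c i ≠ 0 := by
    by_cases hrm : r ∈ IsLocalRing.maximalIdeal R
    · exfalso
      have heJ : e ∈ Ring.jacobson B := by
        have := add_mem hr (algebraMap_mem_jacobson R (B := B) hrm)
        rwa [sub_add_cancel] at this
      refine hcJ ((hψker c).1 (funext fun i => ?_))
      by_contra hi
      have h1 := congrArg (fun b => ψ b i) hef
      simp only [map_add, Pi.add_apply, map_one, Pi.one_apply] at h1
      rw [congrFun ((hψker e).2 heJ) i, hf i hi, Pi.zero_apply, add_zero] at h1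
      exact zero_ne_one h1
    · intro i hi
      have hru : IsUnit r := by simpa using hrm
      have h1 := congrFun ((hψker _).2 hr) i
      rw [map_sub, Pi.sub_apply, he i hi, zero_sub, Pi.zero_apply, neg_eq_zero] at h1
      have h2 : IsUnit (ψ (algebraMap R B r) i) :=
        hru.map ((Pi.evalRingHom S i).comp (ψ.comp (algebraMap R B)))
      rw [h1] at h2
      exact not_isUnit_zero h2
  choose l hl using fun i => (hinv i (hne i)).1
  choose l' hl' using fun i => (hinv i (hne i)).2
  obtain ⟨g, hg⟩ := hψ l
  obtain ⟨g', hg'⟩ := hψ l'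
  have hcu : IsUnit c := by
    refine isUnit_of_isUnit_mod_jacobson (c := g) (d := g') ?_ ?_
    · rw [← hψker]
      funext i
      rw [map_sub, map_mul, map_one, hg, Pi.sub_apply, Pi.mul_apply, hl, Pi.one_apply, sub_self,
        Pi.zero_apply]
    · rw [← hψker]
      funext i
      rw [map_sub, map_mul, map_one, hg', Pi.sub_apply, Pi.mul_apply, hl', Pi.one_apply, sub_self,
        Pi.zero_apply]
  obtain ⟨u, rfl⟩ := hcu
  exact ⟨k, u, hdc⟩

/-- If the invariant central elements of `B` are powers of the generator of the radical, up to
units, they form a discrete valuation ring. -/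
theorem isDiscreteValuationRing_of_invariant [Nontrivial B] {x : B} (hx : IsRegular x)
    (hJ : Ring.jacobson B = Ideal.span {x}) (τ' : B ≃ₐ[R] B) {D : Type*} [CommRing D] [Algebra R D]
    [Algebra D B] [IsScalarTower R D B] (hj : Function.Injective (algebraMap D B))
    (hjτ : ∀ d, τ' (algebraMap D B d) = algebraMap D B d)
    (hjmk : ∀ b : B, (∀ c, b * c = c * b) → τ' b = b → ∃ d, algebraMap D B d = b)
    (hform : ∀ d : D, d ≠ 0 → ∃ (k : ℕ) (u : Bˣ), algebraMap D B d = x ^ k * u) :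
    ∃ _ : IsDomain D, IsDiscreteValuationRing D ∧ Module.Finite D B := by
  let j := algebraMap D B
  have hjc : ∀ d b, j d * b = b * j d := fun d b => Algebra.commutes d b
  have hreg : ∀ d, d ≠ 0 → IsRegular (j d) := fun d hd => by
    obtain ⟨k, u, hk⟩ := hform d hd
    rw [hk]
    exact (hx.pow k).mul u.isRegular
  have hdom : IsDomain D := by
    have : NoZeroDivisors D := ⟨fun {a b} hab => by
      by_contra! hne
      have h1 : j a * j b = j a * 0 := by rw [← map_mul, hab, map_zero, mul_zero]
      exact (map_ne_zero_iff j hj).2 hne.2 ((hreg a hne.1).left h1)⟩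
    have : Nontrivial D := j.domain_nontrivial
    exact NoZeroDivisors.to_isDomain _
  have hfinD : IsNoetherian R D := by
    have : IsNoetherian R B := isNoetherian_of_isNoetherianRing_of_finite R B
    exact isNoetherian_of_injective (IsScalarTower.toAlgHom R D B).toLinearMap hj
  have hnoeth : IsNoetherianRing D := isNoetherian_of_tower R hfinD
  have hval : ValuationRing D := by
    have key : ∀ a b : D, a ≠ 0 → ∀ k l : ℕ, k ≤ l → ∀ u v : Bˣ,
        j a = x ^ k * u → j b = x ^ l * v → a ∣ b := by
      intro a b ha k l hkl u v hu hv
      obtain ⟨i, rfl⟩ := Nat.exists_eq_add_of_le hkl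
      set c : B := ↑u⁻¹ * x ^ i * v with hc
      have hac : j b = j a * c := by
        rw [hv, hu, hc, mul_assoc, ← mul_assoc (u : B), ← mul_assoc (u : B), Units.mul_inv, one_mul,
          pow_add, mul_assoc]
      obtain ⟨d, hd⟩ := hjmk c
        (fun y => (hreg a ha).left (by
          simp only
          rw [← mul_assoc, ← hac, hjc, hac, ← mul_assoc, ← hjc, mul_assoc]))
        ((hreg a ha).left (by
          simp only
          rw [← hac]
          conv_lhs => rw [← hjτ a]
          rw [← map_mul, ← hac, hjτ]))
      exact ⟨d, hj (by rw [map_mul, hd, hac])⟩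
    refine ValuationRing.iff_dvd_total.2 ⟨fun a b => ?_⟩
    rcases eq_or_ne a 0 with rfl | ha
    · exact Or.inr (dvd_zero b)
    rcases eq_or_ne b 0 with rfl | hb
    · exact Or.inl (dvd_zero a)
    obtain ⟨k, u, hu⟩ := hform a ha
    obtain ⟨l, v, hv⟩ := hform b hb
    rcases le_total k l with hkl | hkl
    · exact Or.inl (key a b ha k l hkl u v hu hv)
    · exact Or.inr (key b a hb l k hkl v u hv hu)
  refine ⟨hdom, { not_a_field' := fun hbot => ?_ }, Module.Finite.of_restrictScalars_finite R D B⟩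
  -- otherwise the maximal ideal of `R` annihilates `B`, so that the radical is nilpotent
  have hann : ∀ r ∈ IsLocalRing.maximalIdeal R, algebraMap R B r = 0 := by
    intro r hr
    have h1 := algebraMap_mem_jacobson R (B := B) hr
    have h2 : algebraMap R D r ∈
        IsLocalRing.maximalIdeal D := by
      rw [IsLocalRing.mem_maximalIdeal, mem_nonunits_iff]
      intro hu
      have h3 : IsUnit (algebraMap R B r) := by
        rw [IsScalarTower.algebraMap_apply R D B]
        exact hu.map j
      exact Ring.jacobson_lt_top B |>.ne (Ideal.eq_top_of_isUnit_mem _ h1 h3)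
    rw [hbot, Ideal.mem_bot] at h2
    rw [IsScalarTower.algebraMap_apply R D B, h2, map_zero]
  obtain ⟨c, hc⟩ := radicalSubmodule_pow_le_smul_top R (B := B) 1
  have hxc : x ^ c ∈ (IsLocalRing.maximalIdeal R ^ 1 • ⊤ : Submodule R B) :=
    hc (Submodule.pow_mem_pow (radicalSubmodule R B)
      (hJ ▸ Ideal.mem_span_singleton_self x : x ∈ Ring.jacobson B) c)
  have hzero : (IsLocalRing.maximalIdeal R ^ 1 • ⊤ : Submodule R B) ≤ ⊥ := by
    rw [pow_one, Submodule.smul_le]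
    intro r hr b _
    rw [Algebra.smul_def, hann r hr, zero_mul]
    exact Submodule.zero_mem _
  exact (hx.pow c).ne_zero ((Submodule.mem_bot R).1 (hzero hxc))

/-- The elements of the centre of `B` fixed by `τ'`. -/
def invariantCentre (τ' : B ≃ₐ[R] B) : Subalgebra R (Subalgebra.center R B) :=
  AlgHom.equalizer ((τ' : B →ₐ[R] B).comp (Subalgebra.val _)) (Subalgebra.val _)

/-- The inclusion of the invariant central elements makes `B` an algebra over them. -/
@[reducible] def invariantCentreAlgebra (τ' : B ≃ₐ[R] B) : Algebra (invariantCentre τ') B :=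
  RingHom.toAlgebra'
    ((Subalgebra.val (Subalgebra.center R B)).comp (Subalgebra.val (invariantCentre τ'))).toRingHom
    fun c b => (Subalgebra.mem_center_iff.1 c.1.2 b).symm

theorem exists_discreteValuationRing_of_invariant {R : Type*} {B : Type u} [CommRing R]
    [IsLocalRing R] [IsNoetherianRing R] [Finite (IsLocalRing.ResidueField R)] [Ring B]
    [Algebra R B] [Module.Finite R B] [Nontrivial B] {x : B} (hx : IsRegular x)
    (hJ : Ring.jacobson B = Ideal.span {x}) (τ' : B ≃ₐ[R] B)
    (h : ∀ d : B, (∀ b, d * b = b * d) → τ' d = d → d ≠ 0 → ∃ (k : ℕ) (u : Bˣ), d = x ^ k * u) :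
    ∃ (D : Type u) (_ : CommRing D) (_ : IsDomain D) (_ : Algebra D B),
      IsDiscreteValuationRing D ∧ Module.Finite D B ∧
      Function.Injective (algebraMap D B) ∧
      ∀ d : D, d ≠ 0 → ∃ (k : ℕ) (u : Bˣ), algebraMap D B d = x ^ k * u := by
  have hinj : Function.Injective (@algebraMap _ _ _ _ (invariantCentreAlgebra τ')) :=
    fun a b hab => Subtype.ext (Subtype.ext hab)
  have hform : ∀ d : invariantCentre τ', d ≠ 0 →
      ∃ (k : ℕ) (u : Bˣ), @algebraMap _ _ _ _ (invariantCentreAlgebra τ') d = x ^ k * u :=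
    fun d hd => h d.1 (fun b => (Subalgebra.mem_center_iff.1 d.1.2 b).symm) d.2
      fun h0 => hd (Subtype.ext (Subtype.ext h0))
  obtain ⟨h1, h2, h3⟩ := @isDiscreteValuationRing_of_invariant R B _ _ _ _ _ _ _ _ x hx hJ τ'
    (invariantCentre τ') _ _ (invariantCentreAlgebra τ')
    (@IsScalarTower.of_algebraMap_eq _ _ _ _ _ _ _ (invariantCentreAlgebra τ') _ fun _ => rfl)
    hinj (fun d => d.2)
    (fun b hb hb' => ⟨⟨⟨b, Subalgebra.mem_center_iff.2 fun c => (hb c).symm⟩, hb'⟩, rfl⟩) hform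
  exact ⟨invariantCentre τ', inferInstance, h1, invariantCentreAlgebra τ', h2, h3, hinj, hform⟩

end InvariantCentre

/-! ### A criterion for maximal orders -/

section Criterion

variable {D T : Type*} [CommRing D] [Ring T] [Algebra (FractionRing D) T]
  [Algebra D T] [IsScalarTower D (FractionRing D) T]

theorem isUnit_algebraMap_fractionRing [IsDomain D] {s : D} (hs : s ≠ 0) :
    IsUnit (algebraMap D (FractionRing D) s) :=
  ((map_ne_zero_iff _ (IsFractionRing.injective D (FractionRing D))).2 hs).isUnit

theorem smul_right_injective_of_fractionRing [IsDomain D] {M : Type*} [AddCommGroup M]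
    [Module (FractionRing D) M] [Module D M] [IsScalarTower D (FractionRing D) M] {s : D}
    (hs : s ≠ 0) {t : M} (h : s • t = 0) : t = 0 := by
  rw [← algebraMap_smul (FractionRing D) s t] at h
  exact (isUnit_algebraMap_fractionRing hs).smul_eq_zero.1 h

/-- The comparison map from the generic fibre of a subalgebra to the ambient algebra. -/
noncomputable def genericFibreMap (Λ : Subalgebra D T) :
    FractionRing D ⊗[D] Λ →ₐ[FractionRing D] T :=
  Algebra.TensorProduct.lift (Algebra.ofId (FractionRing D) T) Λ.val
    fun k a => Algebra.commutes k (a : T)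

theorem genericFibreMap_includeRight (Λ : Subalgebra D T) (a : Λ) :
    genericFibreMap Λ (Algebra.TensorProduct.includeRight (R := D) a) = a := by
  rw [genericFibreMap, Algebra.TensorProduct.includeRight_apply]
  refine (Algebra.TensorProduct.lift_tmul _ _ _ _ _).trans ?_
  rw [map_one, one_mul]
  rfl

theorem genericFibreMap_smul (Λ : Subalgebra D T) (s : D) (t : FractionRing D ⊗[D] Λ) :
    genericFibreMap Λ (s • t) = s • genericFibreMap Λ t := by
  rw [← algebraMap_smul (FractionRing D) s t, map_smul, algebraMap_smul]

theorem genericFibreMap_bijective [IsDomain D] (Λ : Subalgebra D T)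
    (hfrac : ∀ t : T, ∃ s : D, s ≠ 0 ∧ s • t ∈ Λ) : Function.Bijective (genericFibreMap Λ) := by
  constructor
  · rw [injective_iff_map_eq_zero]
    intro t ht
    obtain ⟨s, a, hs, hsa⟩ := exists_smul_eq_includeRight t
    have h1 := genericFibreMap_smul Λ s t
    rw [ht, smul_zero, hsa, genericFibreMap_includeRight] at h1
    rw [Subtype.ext (a2 := (0 : Λ)) h1, map_zero] at hsa
    exact smul_right_injective_of_fractionRing hs hsa
  · intro t
    obtain ⟨s, hs, ha⟩ := hfrac t
    refine ⟨(algebraMap D (FractionRing D) s)⁻¹ •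
      Algebra.TensorProduct.includeRight (R := D) (⟨s • t, ha⟩ : Λ), ?_⟩
    rw [map_smul, genericFibreMap_includeRight]
    change (algebraMap D (FractionRing D) s)⁻¹ • (s • t) = t
    rw [← algebraMap_smul (FractionRing D) s t, smul_smul,
      inv_mul_cancel₀ (isUnit_algebraMap_fractionRing hs).ne_zero, one_smul]

theorem isMaximalOrder_of_subalgebra [IsDomain D] [IsSimpleRing T] [IsArtinianRing T]
    (Λ : Subalgebra D T) (hfin : Module.Finite D Λ) (hfrac : ∀ t : T, ∃ s : D, s ≠ 0 ∧ s • t ∈ Λ)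
    (hmax : ∀ Λ' : Subalgebra D T, Λ ≤ Λ' → Module.Finite D Λ' → Λ' ≤ Λ) :
    IsMaximalOrder D Λ := by
  have hbij := genericFibreMap_bijective Λ hfrac
  let e : FractionRing D ⊗[D] Λ ≃+* T := RingEquiv.ofBijective (genericFibreMap Λ) hbij
  refine ⟨⟨hfin, ⟨fun r hr a b hab => ?_⟩, IsSimpleRing.of_ringEquiv e.symm inferInstance,
    e.symm.surjective.isArtinianRing⟩, fun B hle hB => le_antisymm (fun b hb => ?_) hle⟩
  · refine Subtype.ext (sub_eq_zero.1
      (smul_right_injective_of_fractionRing (s := r) hr.ne_zero ?_))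
    have hab' : r • (a : T) = r • (b : T) := congrArg Subtype.val hab
    rw [smul_sub, hab', sub_self]
  · let f : FractionRing D ⊗[D] Λ →ₐ[D] T := (genericFibreMap Λ).restrictScalars D
    have h1 : B.map f ≤ Λ := by
      refine hmax _ (fun a ha => ?_) ?_
      · exact ⟨_, hle ⟨⟨a, ha⟩, rfl⟩, genericFibreMap_includeRight Λ _⟩
      · exact Module.Finite.of_surjective
          (f.toLinearMap.submoduleMap (Subalgebra.toSubmodule B))
          (f.toLinearMap.submoduleMap_surjective (Subalgebra.toSubmodule B))
    refine ⟨⟨f b, h1 ⟨b, hb, rfl⟩⟩, hbij.1 ?_⟩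
    exact genericFibreMap_includeRight Λ _

end Criterion

/-! ### Semisimplicity and maximality -/

/-- The radical of an artinian ring is nilpotent, and its last nonzero power squares to zero. -/
theorem jacobson_eq_bot_of_semiprime {Q : Type*} [Ring Q] [IsArtinianRing Q]
    (h : ∀ t : Q, (∀ s, t * s * t = 0) → t = 0) : Ring.jacobson Q = ⊥ := by
  have hnil : IsNilpotent (Ring.jacobson Q) := IsSemiprimaryRing.isNilpotent
  classical
  have hspec := Nat.find_spec hnil
  have hmin := fun m => Nat.find_min hnil (m := m)
  set n := Nat.find hnil with hn
  rcases n with _ | _ | n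
  · rw [Submodule.pow_zero] at hspec
    have h1 : (1 : Q) ∈ (1 : Ideal Q) := by rw [Ideal.one_eq_top]; exact Submodule.mem_top
    rw [hspec] at h1
    have h0 : (1 : Q) = 0 := h1
    rw [eq_bot_iff]
    intro a _
    rw [Submodule.mem_bot, ← mul_one a, h0, mul_zero]
  · rwa [zero_add, Submodule.pow_one] at hspec
  · exfalso
    refine hmin (n + 1) (by omega) ?_
    rw [Submodule.zero_eq_bot, eq_bot_iff]
    intro a ha
    refine h a fun s => ?_
    have h1 : a * s * a ∈ Ring.jacobson Q ^ (n + 1) * Ring.jacobson Q ^ 1 := by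
      rw [mul_assoc]
      refine Ideal.mul_mem_mul ha (Ideal.mul_mem_left _ _ ?_)
      exact Ideal.pow_le_pow_right (by omega) ha
    rw [← Ideal.IsTwoSided.pow_add, hspec] at h1
    exact h1

section Order

variable {R D B : Type*} [CommRing R] [CommRing D] [IsDomain D] [Ring B] [Algebra R B] [Algebra D B]
  {x : B} (σ : B ≃ₐ[R] B)

theorem isTorsionFree_of_eq_pow_mul (hx : IsRegular x)
    (hform : ∀ d : D, d ≠ 0 → ∃ (k : ℕ) (u : Bˣ), algebraMap D B d = x ^ k * u) :
    Module.IsTorsionFree D B := by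
  refine ⟨fun d hd a b hab => ?_⟩
  obtain ⟨k, u, hk⟩ := hform d hd.ne_zero
  simp only [Algebra.smul_def, hk] at hab
  exact ((hx.pow k).mul u.isRegular).left hab

theorem exists_smul_mem_range_of_finite {T : Type*} [Ring T] [Algebra D T] (ι : B →ₐ[D] T)
    (hfrac : ∀ t : T, ∃ (s : D) (a : B), s ≠ 0 ∧ s • t = ι a) (N : Submodule D T) (hN : N.FG) :
    ∃ s : D, s ≠ 0 ∧ ∀ t ∈ N, ∃ a, s • t = ι a := by
  classical
  obtain ⟨X, rfl⟩ := hN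
  choose s a hs ha using hfrac
  refine ⟨∏ t ∈ X, s t, Finset.prod_ne_zero_iff.2 fun t _ => hs t, fun t ht => ?_⟩
  induction ht using Submodule.span_induction with
  | mem t ht =>
    refine ⟨(∏ t' ∈ X.erase t, s t') • a t, ?_⟩
    rw [map_smul, ← ha, smul_smul, Finset.prod_erase_mul _ _ ht]
  | zero => exact ⟨0, by simp⟩
  | add y z _ _ hy hz =>
    obtain ⟨b, hb⟩ := hy
    obtain ⟨c, hc⟩ := hz
    exact ⟨b + c, by rw [smul_add, hb, hc, map_add]⟩
  | smul r y _ hy =>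
    obtain ⟨b, hb⟩ := hy
    exact ⟨r • b, by rw [smul_comm, hb, map_smul]⟩

variable {n : ℕ} {S : Fin n → Type*} [∀ i, Ring (S i)] [∀ i, IsSimpleRing (S i)]

/-- The generic fibre is semiprime: write a nonzero element of `B` as `x ^ k * c` with `c` outside
the radical; a product `c * y * σᵏ(c)` is then outside the radical for some `y`. -/
theorem isSemisimpleRing_genericFibre [IsNoetherianRing B] [Module.Finite D B] (hx : IsRegular x)
    (hJ : Ring.jacobson B = Ideal.span {x}) (hσ : ∀ b, x * b = σ b * x) (ψ : B →+* ∀ i, S i)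
    (hψ : Function.Surjective ψ) (hψker : ∀ b, ψ b = 0 ↔ b ∈ Ring.jacobson B)
    (hσψ : ∀ i b, ψ (σ b) i = 0 ↔ ψ b i = 0)
    (hform : ∀ d : D, d ≠ 0 → ∃ (k : ℕ) (u : Bˣ), algebraMap D B d = x ^ k * u) :
    IsSemisimpleRing (FractionRing D ⊗[D] B) := by
  have := isTorsionFree_of_eq_pow_mul hx hform
  have : IsArtinianRing (FractionRing D ⊗[D] B) := IsArtinianRing.of_finite (FractionRing D) _
  have hι := includeRight_injective_of_torsionFree (R := D) (A := B)
  rw [IsArtinianRing.isSemisimpleRing_iff_jacobson]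
  refine jacobson_eq_bot_of_semiprime fun t ht => ?_
  obtain ⟨s, b, hs, hsb⟩ := exists_smul_eq_includeRight t
  suffices hb : b = 0 by
    rw [hb, map_zero] at hsb
    exact smul_right_injective_of_fractionRing hs hsb
  by_contra hb0
  have hbyb : ∀ y, b * y * b = 0 := by
    intro y
    refine hι ?_
    rw [map_mul, map_mul, ← hsb, smul_mul_assoc, mul_smul_comm, smul_mul_assoc, ht, smul_zero,
      smul_zero, map_zero]
  obtain ⟨k, c, rfl, hc⟩ := exists_eq_pow_mul_of_ne_zero σ hx hJ hσ hb0
  obtain ⟨y, hy⟩ := exists_mul_mul_notMem_jacobson ψ hψ hψker (c' := (σ ^ k) c) hc fun i =>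
    (map_pow_apply_eq_zero_iff σ ψ hσψ k i c).1
  refine hy ?_
  have h1 : c * y * (σ ^ k) c = 0 := by
    refine (hx.pow k).left ((hx.pow k).right ?_)
    simp only
    rw [mul_zero, zero_mul, ← hbyb y, mul_assoc, mul_assoc (c * y), ← pow_mul_eq σ hσ]
    simp only [mul_assoc]
  rw [h1]
  exact Submodule.zero_mem _

/-- No algebra `B'` finite over `D` lies strictly between `B` and its generic fibre: otherwise take
`k` minimal with `B' x ^ k ⊆ B`; then `k > 0`, and `W = B' x ^ k` is not contained in the radical,
although `W σ⁻ᵏ(W)` is. -/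
theorem le_range_of_finite (hx : IsRegular x)
    (hJ : Ring.jacobson B = Ideal.span {x}) (hσ : ∀ b, x * b = σ b * x) (ψ : B →+* ∀ i, S i)
    (hψ : Function.Surjective ψ) (hψker : ∀ b, ψ b = 0 ↔ b ∈ Ring.jacobson B)
    (hσψ : ∀ i b, ψ (σ b) i = 0 ↔ ψ b i = 0)
    (hform : ∀ d : D, d ≠ 0 → ∃ (k : ℕ) (u : Bˣ), algebraMap D B d = x ^ k * u)
    (B' : Subalgebra D (FractionRing D ⊗[D] B))
    (hle : (Algebra.TensorProduct.includeRight : B →ₐ[D] FractionRing D ⊗[D] B).range ≤ B')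
    (hfin : Module.Finite D B') :
    B' ≤ (Algebra.TensorProduct.includeRight : B →ₐ[D] FractionRing D ⊗[D] B).range := by
  have := isTorsionFree_of_eq_pow_mul hx hform
  set ι := (Algebra.TensorProduct.includeRight : B →ₐ[D] FractionRing D ⊗[D] B) with hιdef
  have hι : Function.Injective ι := includeRight_injective_of_torsionFree
  have hιx : ∀ t, t * ι x = 0 → t = 0 := by
    intro t ht
    obtain ⟨s, b, hs, hsb⟩ := exists_smul_eq_includeRight t
    refine smul_right_injective_of_fractionRing hs ?_
    have h1 : b = 0 := hx.right (hι (by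
      simp only
      rw [map_mul, ← hsb, smul_mul_assoc, ht, smul_zero, zero_mul, map_zero]))
    rw [hsb, h1, map_zero]
  have hex : ∃ k : ℕ, ∀ t ∈ B', ∃ b, t * ι (x ^ k) = ι b := by
    obtain ⟨s, hs, h⟩ := exists_smul_mem_range_of_finite ι exists_smul_eq_includeRight
      (Subalgebra.toSubmodule B') (Module.Finite.iff_fg.1 hfin)
    obtain ⟨k, u, hk⟩ := hform s hs
    refine ⟨k, fun t ht => ?_⟩
    obtain ⟨b, hb⟩ := h t ht
    refine ⟨b * ↑u⁻¹, ?_⟩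
    rw [map_mul, ← hb, Algebra.smul_def, Algebra.commutes, ← ι.commutes, hk, map_mul, mul_assoc,
      mul_assoc, ← map_mul ι (u : B), Units.mul_inv, map_one, mul_one]
  classical
  have hspec := Nat.find_spec hex
  have hmin := fun m => Nat.find_min hex (m := m)
  set k := Nat.find hex with hk
  rcases k with _ | k
  · intro t ht
    obtain ⟨b, hb⟩ := hspec t ht
    rw [pow_zero, map_one, mul_one] at hb
    exact ⟨b, hb.symm⟩
  exfalso
  obtain ⟨t, ht, c, htc, hc⟩ : ∃ t ∈ B', ∃ c, t * ι (x ^ (k + 1)) = ι c ∧ c ∉ Ring.jacobson B := by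
    by_contra! h
    refine hmin k (by omega) fun t ht => ?_
    obtain ⟨c, hc⟩ := hspec t ht
    obtain ⟨c', rfl⟩ := (mem_jacobson_iff_left hJ).1 (h t ht c hc)
    refine ⟨c', sub_eq_zero.1 (hιx _ ?_)⟩
    rw [sub_mul, mul_assoc, ← map_mul, ← pow_succ, hc, map_mul, sub_self]
  obtain ⟨y, hy⟩ := exists_mul_mul_notMem_jacobson ψ hψ hψker (c' := (σ ^ (k + 1)).symm c) hc
    fun i => (map_pow_symm_apply_eq_zero_iff σ ψ hσψ (k + 1) i c).1
  obtain ⟨c₂, hc₂⟩ := hspec (t * ι ((σ ^ (k + 1)) y) * t)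
    (B'.mul_mem (B'.mul_mem ht (hle ⟨_, rfl⟩)) ht)
  refine hy ?_
  have h1 : c * y * (σ ^ (k + 1)).symm c = c₂ * x ^ (k + 1) := by
    refine hι ?_
    calc ι (c * y * (σ ^ (k + 1)).symm c)
        = t * ι (x ^ (k + 1) * (σ ^ (k + 1)).symm ((σ ^ (k + 1)) y * c)) := by
          rw [map_mul (σ ^ (k + 1)).symm, (σ ^ (k + 1)).symm_apply_apply, map_mul ι (x ^ (k + 1)),
            ← mul_assoc t, htc, ← map_mul, mul_assoc]
      _ = t * ι ((σ ^ (k + 1)) y) * (t * ι (x ^ (k + 1))) * ι (x ^ (k + 1)) := by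
          rw [← mul_pow_eq σ hσ, htc, map_mul, map_mul]
          simp only [mul_assoc]
      _ = ι (c₂ * x ^ (k + 1)) := by
          rw [map_mul ι c₂, ← hc₂]
          simp only [mul_assoc]
  rw [h1, pow_succ, ← mul_assoc]
  exact (mem_jacobson_iff_left hJ).2 ⟨_, rfl⟩

end Order

/-! ### Decomposition into maximal orders over a discrete valuation ring -/

/-- An algebra over a discrete valuation ring with semisimple generic fibre, which contains every
finite algebra between itself and its generic fibre, is a product of maximal orders. -/
theorem isProductOfMaximalOrders_of_isSemisimpleRing {D B : Type u} [CommRing D] [IsDomain D]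
    [IsDiscreteValuationRing D] [Ring B] [Algebra D B] [Module.Finite D B]
    [Module.IsTorsionFree D B] [IsSemisimpleRing (FractionRing D ⊗[D] B)]
    (hmax : ∀ B' : Subalgebra D (FractionRing D ⊗[D] B),
      (Algebra.TensorProduct.includeRight : B →ₐ[D] FractionRing D ⊗[D] B).range ≤ B' →
      Module.Finite D B' →
      B' ≤ (Algebra.TensorProduct.includeRight : B →ₐ[D] FractionRing D ⊗[D] B).range) :
    IsProductOfMaximalOrders B := by
  set ι := (Algebra.TensorProduct.includeRight : B →ₐ[D] FractionRing D ⊗[D] B) with hιdef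
  have hι : Function.Injective ι := includeRight_injective_of_torsionFree
  obtain ⟨n, E, d, _, _, hd, ⟨e⟩⟩ := IsSemisimpleRing.exists_algEquiv_pi_matrix_divisionRing
    (FractionRing D) (FractionRing D ⊗[D] B)
  let T : Fin n → Type u := fun i => Matrix (Fin (d i)) (Fin (d i)) (E i)
  let _ : ∀ i, Algebra D (T i) := fun i => Algebra.compHom (T i) (algebraMap D (FractionRing D))
  have : ∀ i, IsScalarTower D (FractionRing D) (T i) := fun i =>
    IsScalarTower.of_algebraMap_eq fun _ => rfl
  have hT : ∀ i, IsSimpleRing (T i) := fun i => inferInstance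
  have hT' : ∀ i, IsArtinianRing (T i) := fun i => inferInstance
  let e' : FractionRing D ⊗[D] B ≃ₐ[FractionRing D] ∀ i, T i := e
  have hesmul : ∀ (s : D) t i, e' (s • t) i = s • e' t i := fun s t i => by
    rw [← algebraMap_smul (FractionRing D) s t, map_smul, Pi.smul_apply, algebraMap_smul]
  let p : ∀ i, FractionRing D ⊗[D] B →ₐ[D] T i := fun i =>
    AlgHom.mk' (R := D) ((Pi.evalRingHom T i).comp (e' : FractionRing D ⊗[D] B →+* ∀ i, T i))
      fun s t => hesmul s t i
  have hp : ∀ i t, p i t = e' t i := fun _ _ => rfl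
  let Λ : ∀ i, Subalgebra D (T i) := fun i => ((p i).comp ι).range
  have hΛfin : ∀ i, Module.Finite D (Λ i) := fun i =>
    Module.Finite.of_surjective ((p i).comp ι).rangeRestrict.toLinearMap
      ((p i).comp ι).rangeRestrict_surjective
  have hsingle : ∀ i (t : T i), ∃ q, ∀ j, e' q j = (Pi.single i t : ∀ i, T i) j := fun i t =>
    ⟨e'.symm (Pi.single i t), fun j => by rw [e'.apply_symm_apply]⟩
  have hfrac : ∀ i (t : T i), ∃ s : D, s ≠ 0 ∧ s • t ∈ Λ i := by
    intro i t
    obtain ⟨q, hq⟩ := hsingle i t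
    obtain ⟨s, b, hs, hsb⟩ := exists_smul_eq_includeRight q
    refine ⟨s, hs, b, ?_⟩
    change p i (ι b) = s • t
    rw [hιdef, ← hsb, hp, hesmul, hq, Pi.single_eq_same]
  -- maximality of `B` gives maximality of all the factors at once
  have key : ∀ Λ' : ∀ i, Subalgebra D (T i), (∀ i, Λ i ≤ Λ' i) → (∀ i, Module.Finite D (Λ' i)) →
      ∀ q, (∀ i, e' q i ∈ Λ' i) → ∃ b, ι b = q := by
    intro Λ' hle hfin q hq
    let B' : Subalgebra D (FractionRing D ⊗[D] B) := ⨅ i, (Λ' i).comap (p i)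
    have hB' : ∀ t, t ∈ B' ↔ ∀ i, p i t ∈ Λ' i := fun t => by
      simp [B', Algebra.mem_iInf]
    have hB'fin : Module.Finite D B' := by
      let f : B' →ₗ[D] ∀ i, Λ' i := LinearMap.pi fun i =>
        ((p i).toLinearMap.comp (Subalgebra.toSubmodule B').subtype).codRestrict
          (Subalgebra.toSubmodule (Λ' i)) fun t => (hB' t).1 t.2 i
      refine Module.Finite.of_injective f fun a b hab => Subtype.ext (e'.injective (funext fun i => ?_))
      exact congrArg Subtype.val (congrFun hab i)
    exact hmax B' (by
      rintro _ ⟨b, rfl⟩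
      exact (hB' _).2 fun i => hle i ⟨b, rfl⟩) hB'fin ((hB' q).2 hq)
  refine ⟨n, fun _ => D, fun i => Λ i, fun _ => inferInstance, fun _ => inferInstance,
    fun _ => inferInstance, fun i => inferInstance, fun i => inferInstance, fun i => ?_, ?_⟩
  · refine isMaximalOrder_of_subalgebra (Λ i) (hΛfin i) (hfrac i) fun Λ' hle hfin t ht => ?_
    classical
    obtain ⟨q, hq⟩ := hsingle i t
    obtain ⟨b, hb⟩ := key (Function.update Λ i Λ')
      (fun j => by
        rcases eq_or_ne j i with rfl | hj
        · rwa [Function.update_self]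
        · rw [Function.update_of_ne hj])
      (fun j => by
        rcases eq_or_ne j i with rfl | hj
        · rwa [Function.update_self]
        · rw [Function.update_of_ne hj]; exact hΛfin j) q (fun j => by
        rw [hq]
        rcases eq_or_ne j i with rfl | hj
        · rwa [Function.update_self, Pi.single_eq_same]
        · rw [Pi.single_eq_of_ne hj]; exact Subalgebra.zero_mem _)
    refine ⟨b, ?_⟩
    change p i (ι b) = t
    rw [hb, hp, hq, Pi.single_eq_same]
  · let f : B →+* ∀ i, Λ i := RingHom.pi fun i => (((p i).comp ι).rangeRestrict : B →+* Λ i)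
    have hf : ∀ b i, (f b i : T i) = e' (ι b) i := fun _ _ => rfl
    refine ⟨RingEquiv.ofBijective f ⟨fun a b hab => ?_, fun l => ?_⟩⟩
    · refine hι (e'.injective (funext fun i => ?_))
      rw [← hf, ← hf, hab]
    · obtain ⟨b, hb⟩ := key Λ (fun i => le_rfl) hΛfin (e'.symm fun i => l i) fun i => by
        rw [e'.apply_symm_apply]; exact (l i).2
      refine ⟨b, funext fun i => Subtype.ext ?_⟩
      rw [hf, hb, e'.apply_symm_apply]

/-- If `B = A / z A` is homogeneous, with `z` normal in the radical of `A` and `A` of centre `R`,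
then `B` is a product of maximal orders over a discrete valuation ring, namely the ring of central
elements of `B` invariant under conjugation by `z`. -/
theorem isProductOfMaximalOrders_of_homogeneous {R A : Type*} {B : Type u} [CommRing R]
    [IsLocalRing R] [IsNoetherianRing R] [Finite (IsLocalRing.ResidueField R)] [Ring A]
    [Algebra R A] [Module.Finite R A] [Ring B] [Algebra R B] [Nontrivial B]
    (hcenter : ∀ a : A, (∀ b, a * b = b * a) → ∃ r, a = algebraMap R A r)
    {z : A} (hnorm : IsNormalElement z) (hz : z ∈ Ring.jacobson A)
    (τ : A ≃ₐ[R] A) (hτ : ∀ a, z * a = τ a * z) (π : A →ₐ[R] B) (hπ : Function.Surjective π)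
    (hker : ∀ a, π a = 0 ↔ ∃ c, a = z * c) (τ' : B ≃ₐ[R] B) (hττ' : ∀ a, π (τ a) = τ' (π a))
    (H : IsHomogeneousRing B) : IsProductOfMaximalOrders B := by
  have : Module.Finite R B := Module.Finite.of_surjective π.toLinearMap hπ
  have : IsNoetherianRing B := isNoetherian_of_tower R inferInstance
  have := finite_quotient_jacobson R B
  have : IsArtinianRing (B ⧸ Ring.jacobson B) := inferInstance
  obtain ⟨n, S, _, ψ, hS, -, hψ, hψker⟩ := exists_radical_quotient_decomposition B
  obtain ⟨x, σ, hx, hJ, hσ⟩ := exists_regular_normal_generator (R := R) H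
  have hσψ' : ∀ i b, ψ b i = 0 → ψ (σ b) i = 0 := fun i b hb =>
    conj_mem_ker_of_homogeneous H hJ σ hσ ψ hψ hψker i hb
  have hσψ : ∀ i b, ψ (σ b) i = 0 ↔ ψ b i = 0 := fun i b =>
    ⟨mem_ker_of_map_mem_ker σ ψ hψ i (hσψ' i), hσψ' i b⟩
  obtain ⟨D, _, _, _, _, _, -, hform⟩ := exists_discreteValuationRing_of_invariant hx hJ τ'
    fun d hd hτd hd0 => exists_eq_pow_mul_unit hcenter hnorm hz τ hτ π hπ hker τ' hττ' σ hx hJ hσ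
      ψ hψ hψker hσψ hd hτd hd0
  have := isTorsionFree_of_eq_pow_mul hx hform
  have := isSemisimpleRing_genericFibre σ hx hJ hσ ψ hψ hψker hσψ hform
  exact isProductOfMaximalOrders_of_isSemisimpleRing
    (le_range_of_finite σ hx hJ hσ ψ hψ hψker hσψ hform)

/-! ### Multipliers of ideals in a maximal order -/

section MaximalOrder

open scoped Pointwise

variable {D L : Type*} [CommRing D] [Ring L] [Algebra D L]

theorem mem_range_of_smul_mem [IsDomain D] [IsNoetherianRing D] (hL : IsMaximalOrder D L)
    (X : Subalgebra D (FractionRing D ⊗[D] L))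
    (hX : (Algebra.TensorProduct.includeRight : L →ₐ[D] FractionRing D ⊗[D] L).range ≤ X)
    {c : D} (hc : c ≠ 0)
    (h : ∀ q ∈ X, c • q ∈
      (Algebra.TensorProduct.includeRight : L →ₐ[D] FractionRing D ⊗[D] L).range)
    {q : FractionRing D ⊗[D] L} (hq : q ∈ X) :
    q ∈ (Algebra.TensorProduct.includeRight : L →ₐ[D] FractionRing D ⊗[D] L).range := by
  set ι := (Algebra.TensorProduct.includeRight : L →ₐ[D] FractionRing D ⊗[D] L) with hι
  have := hL.finite
  have hfin : Module.Finite D X := by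
    let f : X →ₗ[D] LinearMap.range ι.toLinearMap :=
      ((LinearMap.lsmul D _ c).comp (Subalgebra.toSubmodule X).subtype).codRestrict _
        fun q => h q q.2
    refine Module.Finite.of_injective f fun a b hab => Subtype.ext (sub_eq_zero.1 ?_)
    refine smul_right_injective_of_fractionRing hc ?_
    rw [smul_sub, sub_eq_zero]
    exact congrArg Subtype.val hab
  rw [← hL.maximal X hX hfin]
  exact hq

/-- The left multiplier ring of a full left ideal of a maximal order is the order itself. -/
theorem exists_smul_eq_of_mul_left_mem [IsDomain D] [IsNoetherianRing D] (hL : IsMaximalOrder D L)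
    {I : Submodule D L} (hI : ⊤ * I ≤ I) {c : D} (hc : c ≠ 0) (hcI : algebraMap D L c ∈ I)
    {s : D} (hs : s ≠ 0) {b : L} (hb : ∀ a ∈ I, ∃ a' ∈ I, b * a = s • a') : ∃ b', b = s • b' := by
  have := hL.torsionFree
  set ι := (Algebra.TensorProduct.includeRight : L →ₐ[D] FractionRing D ⊗[D] L) with hι
  have hinj : Function.Injective ι := includeRight_injective_of_torsionFree
  let X : Subalgebra D (FractionRing D ⊗[D] L) :=
    { carrier := {q | ∀ a ∈ I, ∃ a' ∈ I, q * ι a = ι a'}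
      mul_mem' := fun {p q} hp hq a ha => by
        obtain ⟨a', ha', h1⟩ := hq a ha
        obtain ⟨a'', ha'', h2⟩ := hp a' ha'
        exact ⟨a'', ha'', by rw [mul_assoc, h1, h2]⟩
      add_mem' := fun {p q} hp hq a ha => by
        obtain ⟨a', ha', h1⟩ := hp a ha
        obtain ⟨a'', ha'', h2⟩ := hq a ha
        exact ⟨a' + a'', add_mem ha' ha'', by rw [add_mul, h1, h2, map_add]⟩
      algebraMap_mem' := fun r a ha => ⟨r • a, I.smul_mem r ha, by
        rw [← Algebra.smul_def, map_smul]⟩ }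
  have hmem : (algebraMap D (FractionRing D) s)⁻¹ • ι b ∈ X := by
    intro a ha
    obtain ⟨a', ha', h1⟩ := hb a ha
    refine ⟨a', ha', ?_⟩
    rw [smul_mul_assoc, ← map_mul, h1, map_smul, ← algebraMap_smul (FractionRing D) s, smul_smul,
      inv_mul_cancel₀ (isUnit_algebraMap_fractionRing hs).ne_zero, one_smul]
  obtain ⟨b', hb'⟩ := mem_range_of_smul_mem hL X (by
      rintro _ ⟨l, rfl⟩ a ha
      exact ⟨l * a, hI (Submodule.mul_mem_mul Submodule.mem_top ha), (map_mul ι l a).symm⟩) hc (by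
      intro q hq
      obtain ⟨a', -, h1⟩ := hq _ hcI
      refine ⟨a', ?_⟩
      rw [AlgHom.commutes, ← Algebra.commutes, ← Algebra.smul_def] at h1
      exact h1.symm) hmem
  refine ⟨b', hinj ?_⟩
  have h2 : ι b' = (algebraMap D (FractionRing D) s)⁻¹ • ι b := hb'
  rw [map_smul, h2, ← algebraMap_smul (FractionRing D) s, smul_smul,
    mul_inv_cancel₀ (isUnit_algebraMap_fractionRing hs).ne_zero, one_smul]

/-- The right multiplier ring of a full right ideal of a maximal order is the order itself. -/
theorem exists_smul_eq_of_mul_right_mem [IsDomain D] [IsNoetherianRing D] (hL : IsMaximalOrder D L)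
    {I : Submodule D L} (hI : I * ⊤ ≤ I) {c : D} (hc : c ≠ 0) (hcI : algebraMap D L c ∈ I)
    {s : D} (hs : s ≠ 0) {b : L} (hb : ∀ a ∈ I, ∃ a' ∈ I, a * b = s • a') : ∃ b', b = s • b' := by
  have := hL.torsionFree
  set ι := (Algebra.TensorProduct.includeRight : L →ₐ[D] FractionRing D ⊗[D] L) with hι
  have hinj : Function.Injective ι := includeRight_injective_of_torsionFree
  let X : Subalgebra D (FractionRing D ⊗[D] L) :=
    { carrier := {q | ∀ a ∈ I, ∃ a' ∈ I, ι a * q = ι a'}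
      mul_mem' := fun {p q} hp hq a ha => by
        obtain ⟨a', ha', h1⟩ := hp a ha
        obtain ⟨a'', ha'', h2⟩ := hq a' ha'
        exact ⟨a'', ha'', by rw [← mul_assoc, h1, h2]⟩
      add_mem' := fun {p q} hp hq a ha => by
        obtain ⟨a', ha', h1⟩ := hp a ha
        obtain ⟨a'', ha'', h2⟩ := hq a ha
        exact ⟨a' + a'', add_mem ha' ha'', by rw [mul_add, h1, h2, map_add]⟩
      algebraMap_mem' := fun r a ha => ⟨r • a, I.smul_mem r ha, by
        rw [← Algebra.commutes, ← Algebra.smul_def, map_smul]⟩ }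
  have hmem : (algebraMap D (FractionRing D) s)⁻¹ • ι b ∈ X := by
    intro a ha
    obtain ⟨a', ha', h1⟩ := hb a ha
    refine ⟨a', ha', ?_⟩
    rw [mul_smul_comm, ← map_mul, h1, map_smul, ← algebraMap_smul (FractionRing D) s, smul_smul,
      inv_mul_cancel₀ (isUnit_algebraMap_fractionRing hs).ne_zero, one_smul]
  obtain ⟨b', hb'⟩ := mem_range_of_smul_mem hL X (by
      rintro _ ⟨l, rfl⟩ a ha
      exact ⟨a * l, hI (Submodule.mul_mem_mul ha Submodule.mem_top), (map_mul ι a l).symm⟩) hc (by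
      intro q hq
      obtain ⟨a', -, h1⟩ := hq _ hcI
      refine ⟨a', ?_⟩
      rw [AlgHom.commutes, ← Algebra.smul_def] at h1
      exact h1.symm) hmem
  refine ⟨b', hinj ?_⟩
  have h2 : ι b' = (algebraMap D (FractionRing D) s)⁻¹ • ι b := hb'
  rw [map_smul, h2, ← algebraMap_smul (FractionRing D) s, smul_smul,
    mul_inv_cancel₀ (isUnit_algebraMap_fractionRing hs).ne_zero, one_smul]

/-! ### Invertibility of the maximal two-sided ideals -/

theorem smul_le_smul_iff_of_torsionFree [IsDomain D] [Module.IsTorsionFree D L] {ϖ : D} (hϖ : ϖ ≠ 0)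
    {X Y : Submodule D L} : ϖ • X ≤ ϖ • Y ↔ X ≤ Y := by
  constructor
  · intro h a ha
    obtain ⟨b, hb, hab⟩ := (Submodule.mem_smul_pointwise_iff_exists _ _ _).1
      (h (Submodule.smul_mem_pointwise_smul a ϖ X ha))
    rwa [← sub_eq_zero.1 (smul_eq_zero_of_torsionFree hϖ
      (show ϖ • (b - a) = 0 by rw [smul_sub, hab, sub_self]))]
  · exact fun h => Submodule.map_mono h

theorem top_mul_top : (⊤ : Submodule D L) * ⊤ = ⊤ :=
  eq_top_iff.2 fun a _ => by
    rw [← one_mul a]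
    exact Submodule.mul_mem_mul Submodule.mem_top Submodule.mem_top

theorem le_top_mul (X : Submodule D L) : X ≤ ⊤ * X := fun a ha => by
  rw [← one_mul a]
  exact Submodule.mul_mem_mul Submodule.mem_top ha

theorem le_mul_top (X : Submodule D L) : X ≤ X * ⊤ := fun a ha => by
  rw [← mul_one a]
  exact Submodule.mul_mem_mul ha Submodule.mem_top

variable {n : ℕ} {S : Fin n → Type*} [∀ i, Ring (S i)] (ψ : L →+* ∀ i, S i)

theorem top_mul_vanishingSubmodule (V : Set (Fin n)) :
    ⊤ * vanishingSubmodule D ψ V = vanishingSubmodule D ψ V :=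
  le_antisymm (by
    rw [← vanishingSubmodule_empty (R := D) ψ]
    exact (vanishingSubmodule_mul_le ψ _ _).trans_eq (by rw [Set.empty_union])) (le_top_mul _)

theorem vanishingSubmodule_mul_top (V : Set (Fin n)) :
    vanishingSubmodule D ψ V * ⊤ = vanishingSubmodule D ψ V :=
  le_antisymm (by
    rw [← vanishingSubmodule_empty (R := D) ψ]
    exact (vanishingSubmodule_mul_le ψ _ _).trans_eq (by rw [Set.union_empty])) (le_mul_top _)

/-- The product of the maximal two-sided ideals with indices in the list `l`. The empty product is
the unit ideal. -/
def idealWord (D : Type*) {L : Type*} [CommRing D] [Ring L] [Algebra D L] {n : ℕ}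
    {S : Fin n → Type*} [∀ i, Ring (S i)] (ψ : L →+* ∀ i, S i) : List (Fin n) → Submodule D L
  | [] => ⊤
  | i :: l => vanishingSubmodule D ψ {i} * idealWord D ψ l

theorem top_mul_idealWord (l : List (Fin n)) : ⊤ * idealWord D ψ l = idealWord D ψ l := by
  cases l with
  | nil => exact top_mul_top
  | cons i l => rw [idealWord, ← mul_assoc, top_mul_vanishingSubmodule]

theorem idealWord_append (l l' : List (Fin n)) :
    idealWord D ψ (l ++ l') = idealWord D ψ l * idealWord D ψ l' := by
  induction l with
  | nil => exact (top_mul_idealWord ψ l').symm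
  | cons i l ih => rw [List.cons_append, idealWord, ih, idealWord, mul_assoc]

theorem idealWord_mul_top (l : List (Fin n)) : idealWord D ψ l * ⊤ = idealWord D ψ l := by
  induction l with
  | nil => exact top_mul_top
  | cons i l ih => rw [idealWord, mul_assoc, ih]

theorem idealWord_le (l : List (Fin n)) :
    idealWord D ψ l ≤ vanishingSubmodule D ψ {i | i ∈ l} := by
  induction l with
  | nil => simp [idealWord, vanishingSubmodule_empty]
  | cons i l ih =>
    refine (mul_le_mul_right ih _).trans ((vanishingSubmodule_mul_le ψ _ _).trans_eq ?_)
    congr 1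
    ext j
    simp

theorem algebraMap_pow_mem_idealWord {ϖ : D}
    (hϖ : algebraMap D L ϖ ∈ vanishingSubmodule D ψ Set.univ) (l : List (Fin n)) :
    algebraMap D L (ϖ ^ l.length) ∈ idealWord D ψ l := by
  induction l with
  | nil => exact Submodule.mem_top
  | cons i l ih =>
    rw [List.length_cons, pow_succ', map_mul]
    exact Submodule.mul_mem_mul (fun j _ => hϖ j trivial) ih

theorem exists_mem_idealWord_map_eq_one (hψ : Function.Surjective ψ) {i : Fin n}
    {l : List (Fin n)} (hi : i ∉ l) : ∃ a ∈ idealWord D ψ l, ψ a i = 1 := by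
  classical
  induction l with
  | nil => exact ⟨1, Submodule.mem_top, by rw [map_one]; rfl⟩
  | cons j l ih =>
    rw [List.mem_cons, not_or] at hi
    obtain ⟨a, ha, ha1⟩ := ih hi.2
    obtain ⟨b, hb⟩ := hψ (Pi.single i 1)
    refine ⟨b * a, Submodule.mul_mem_mul (fun k hk => ?_) ha, ?_⟩
    · rw [Set.mem_singleton_iff] at hk
      rw [hb, hk, Pi.single_eq_of_ne' hi.1]
    · rw [map_mul, Pi.mul_apply, ha1, hb, Pi.single_eq_same, mul_one]

theorem exists_idealWord_le_smul_top [IsLocalRing D] [IsNoetherianRing D] [Module.Finite D L]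
    [Finite (IsLocalRing.ResidueField D)] (hψker : ∀ b, ψ b = 0 ↔ b ∈ Ring.jacobson L) {ϖ : D}
    (hϖ : IsLocalRing.maximalIdeal D = Ideal.span {ϖ}) :
    ∃ l : List (Fin n), idealWord D ψ l ≤ ϖ • (⊤ : Submodule D L) := by
  obtain ⟨c, hc⟩ := radicalSubmodule_pow_le_smul_top D (B := L) 1
  have key : ∀ c : ℕ, c ≠ 0 → ∃ l : List (Fin n), idealWord D ψ l ≤ radicalSubmodule D L ^ c := by
    intro c hc0
    induction c with
    | zero => exact absurd rfl hc0
    | succ c ih =>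
      have h1 : idealWord D ψ (List.finRange n) ≤ radicalSubmodule D L := by
        rw [← vanishingSubmodule_univ ψ hψker]
        refine (idealWord_le ψ _).trans_eq ?_
        congr 1
        ext i
        simp [List.mem_finRange]
      rcases Nat.eq_zero_or_pos c with rfl | hpos
      · exact ⟨_, by rwa [zero_add, pow_one]⟩
      obtain ⟨l, hl⟩ := ih hpos.ne'
      refine ⟨l ++ List.finRange n, ?_⟩
      rw [idealWord_append, pow_succ]
      exact (mul_le_mul_left hl _).trans (mul_le_mul_right h1 _)
  obtain ⟨l, hl⟩ := key (c + 1) (Nat.succ_ne_zero c)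
  refine ⟨l, hl.trans ?_⟩
  rw [pow_one, hϖ, Submodule.ideal_span_singleton_smul] at hc
  rw [pow_succ]
  refine (mul_le_mul_left hc _).trans ?_
  rw [smul_mul_assoc]
  exact Submodule.map_mono le_top

variable [∀ i, IsSimpleRing (S i)]

theorem one_mem_of_vanishingSubmodule_lt (hψ : Function.Surjective ψ) {i : Fin n}
    {I : Submodule D L} (hIl : ⊤ * I ≤ I) (hIr : I * ⊤ ≤ I)
    (hle : vanishingSubmodule D ψ {i} ≤ I) {a : L} (ha : a ∈ I) (hai : ψ a i ≠ 0) :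
    (1 : L) ∈ I := by
  let T : Ideal L := { I with
    smul_mem' := fun b c hc => hIl (Submodule.mul_mem_mul Submodule.mem_top hc) }
  have : T.IsTwoSided := ⟨fun b hc => hIr (Submodule.mul_mem_mul hc Submodule.mem_top)⟩
  obtain ⟨w, hw, hw1⟩ := exists_mem_map_eq_one ((Pi.evalRingHom S i).comp ψ)
    ((Function.surjective_eval i).comp hψ) T (b := a) ha hai
  have h1 : 1 - w ∈ I := hle fun j hj => by
    rw [Set.mem_singleton_iff] at hj
    subst hj
    have : ψ w j = 1 := hw1
    rw [map_sub, map_one, Pi.sub_apply, Pi.one_apply, this, sub_self]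
  have := add_mem h1 (show w ∈ I from hw)
  rwa [sub_add_cancel] at this

/-- The maximal two-sided ideals `M` of a maximal order over a discrete valuation ring with
uniformiser `ϖ` are invertible: `M E = E M = (ϖ)` for a two-sided ideal `E`. In a shortest product
of maximal ideals contained in `(ϖ)` all of them occur, so it has the form `P' M P''`, and one takes
`E = P'' P' + (ϖ)`. -/
theorem exists_mul_eq_smul_top [IsDomain D] [IsLocalRing D] [IsNoetherianRing D]
    [Finite (IsLocalRing.ResidueField D)] (hL : IsMaximalOrder D L) (hψ : Function.Surjective ψ)
    (hψker : ∀ b, ψ b = 0 ↔ b ∈ Ring.jacobson L) {ϖ : D} (hϖ0 : ϖ ≠ 0)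
    (hϖ : IsLocalRing.maximalIdeal D = Ideal.span {ϖ}) (i : Fin n) :
    ∃ E : Submodule D L, ⊤ * E = E ∧ E * ⊤ = E ∧
      vanishingSubmodule D ψ {i} * E = ϖ • (⊤ : Submodule D L) ∧
      E * vanishingSubmodule D ψ {i} = ϖ • (⊤ : Submodule D L) := by
  have := hL.finite
  have := hL.torsionFree
  have hϖJ : algebraMap D L ϖ ∈ vanishingSubmodule D ψ Set.univ := by
    rw [vanishingSubmodule_univ ψ hψker]
    exact algebraMap_mem_jacobson D (hϖ ▸ Ideal.mem_span_singleton_self ϖ)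
  have hPle : ∀ V : Set (Fin n), ϖ • (⊤ : Submodule D L) ≤ vanishingSubmodule D ψ V := by
    rintro V b hb j hj
    obtain ⟨c, -, rfl⟩ := (Submodule.mem_smul_pointwise_iff_exists _ _ _).1 hb
    rw [Algebra.smul_def, map_mul, Pi.mul_apply, hϖJ j trivial, zero_mul]
  set M := vanishingSubmodule D ψ {i} with hM
  classical
  have hex : ∃ N : ℕ, ∃ l : List (Fin n), l.length = N ∧
      idealWord D ψ l ≤ ϖ • (⊤ : Submodule D L) := by
    obtain ⟨l, hl⟩ := exists_idealWord_le_smul_top ψ hψker hϖ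
    exact ⟨_, l, rfl, hl⟩
  obtain ⟨l, hlen, hl⟩ := Nat.find_spec hex
  have hmin := fun N => Nat.find_min hex (m := N)
  have hil : i ∈ l := by
    by_contra hi
    obtain ⟨a, ha, ha1⟩ := exists_mem_idealWord_map_eq_one (D := D) ψ hψ hi
    have := hPle {i} (hl ha) i rfl
    rw [ha1] at this
    exact one_ne_zero this
  obtain ⟨l₁, l₂, rfl⟩ := List.append_of_mem hil
  set P₁ := idealWord D ψ l₁ with hP₁
  set P₂ := idealWord D ψ l₂ with hP₂
  have hword : P₁ * (M * P₂) ≤ ϖ • (⊤ : Submodule D L) := by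
    rw [idealWord_append] at hl
    exact hl
  have hnot : ¬ P₂ * P₁ ≤ ϖ • (⊤ : Submodule D L) := fun h =>
    hmin (l₁.length + l₂.length) (by
      rw [← hlen, List.length_append, List.length_cons]; omega)
      ⟨l₂ ++ l₁, by rw [List.length_append, add_comm], by rwa [idealWord_append]⟩
  have hMtop : ⊤ * M = M := top_mul_vanishingSubmodule ψ _
  have hMtop' : M * ⊤ = M := vanishingSubmodule_mul_top ψ _
  have hP₁top : ⊤ * P₁ = P₁ := top_mul_idealWord ψ l₁
  have hP₁top' : P₁ * ⊤ = P₁ := idealWord_mul_top ψ l₁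
  have hP₂top : ⊤ * P₂ = P₂ := top_mul_idealWord ψ l₂
  have hP₂top' : P₂ * ⊤ = P₂ := idealWord_mul_top ψ l₂
  have h1 : M * (P₂ * P₁) ≤ ϖ • (⊤ : Submodule D L) := by
    intro b hb
    obtain ⟨b', rfl⟩ := exists_smul_eq_of_mul_right_mem hL hP₁top'.le (pow_ne_zero _ hϖ0)
      (algebraMap_pow_mem_idealWord ψ hϖJ l₁) hϖ0 (b := b) fun a ha => by
        have h3 : a * b ∈ ϖ • P₁ := by
          have h4 := Submodule.mul_mem_mul ha hb
          have h5 : P₁ * (M * (P₂ * P₁)) ≤ ϖ • P₁ := by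
            calc P₁ * (M * (P₂ * P₁)) = P₁ * (M * P₂) * P₁ := by simp only [mul_assoc]
              _ ≤ ϖ • (⊤ : Submodule D L) * P₁ := mul_le_mul_left hword _
              _ = ϖ • P₁ := by rw [smul_mul_assoc, hP₁top]
          exact h5 h4
        obtain ⟨c, hc, hc'⟩ := (Submodule.mem_smul_pointwise_iff_exists _ _ _).1 h3
        exact ⟨c, hc, hc'.symm⟩
    exact Submodule.smul_mem_pointwise_smul _ _ _ Submodule.mem_top
  have h2 : P₂ * P₁ * M ≤ ϖ • (⊤ : Submodule D L) := by
    intro b hb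
    obtain ⟨b', rfl⟩ := exists_smul_eq_of_mul_left_mem hL hP₂top.le (pow_ne_zero _ hϖ0)
      (algebraMap_pow_mem_idealWord ψ hϖJ l₂) hϖ0 (b := b) fun a ha => by
        have h3 : b * a ∈ ϖ • P₂ := by
          have h4 := Submodule.mul_mem_mul hb ha
          have h5 : P₂ * P₁ * M * P₂ ≤ ϖ • P₂ := by
            calc P₂ * P₁ * M * P₂ = P₂ * (P₁ * (M * P₂)) := by simp only [mul_assoc]
              _ ≤ P₂ * ϖ • (⊤ : Submodule D L) := mul_le_mul_right hword _
              _ = ϖ • P₂ := by rw [mul_smul_comm, hP₂top']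
          exact h5 h4
        obtain ⟨c, hc, hc'⟩ := (Submodule.mem_smul_pointwise_iff_exists _ _ _).1 h3
        exact ⟨c, hc, hc'.symm⟩
    exact Submodule.smul_mem_pointwise_smul _ _ _ Submodule.mem_top
  set E := P₂ * P₁ ⊔ ϖ • (⊤ : Submodule D L) with hE
  have hPE : ϖ • (⊤ : Submodule D L) ≤ E := le_sup_right
  have hEtop : ⊤ * E = E := by
    rw [hE, Submodule.mul_sup, ← mul_assoc, hP₂top, mul_smul_comm, top_mul_top]
  have hEtop' : E * ⊤ = E := by
    rw [hE, Submodule.sup_mul, mul_assoc, hP₁top', smul_mul_assoc, top_mul_top]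
  have hME : M * E ≤ ϖ • (⊤ : Submodule D L) := by
    rw [hE, Submodule.mul_sup, mul_smul_comm, hMtop']
    exact sup_le h1 (Submodule.map_mono le_top)
  have hEM : E * M ≤ ϖ • (⊤ : Submodule D L) := by
    rw [hE, Submodule.sup_mul, smul_mul_assoc, hMtop]
    exact sup_le h2 (Submodule.map_mono le_top)
  -- both products equal `ϖ F` for a two-sided ideal `F ⊇ M`; if `F = M` then `E ⊆ (ϖ)`
  have key : ∀ X : Submodule D L, ⊤ * X = X → X * ⊤ = X → ϖ • M ≤ X →
      X ≤ ϖ • (⊤ : Submodule D L) → (X ≤ ϖ • M → E ≤ ϖ • (⊤ : Submodule D L)) →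
      X = ϖ • (⊤ : Submodule D L) := by
    intro X hXl hXr hMX hXP himp
    refine le_antisymm hXP ?_
    let F : Submodule D L := X.comap (LinearMap.lsmul D L ϖ)
    have hF : ∀ a, a ∈ F ↔ ϖ • a ∈ X := fun a => Iff.rfl
    have h1F : (1 : L) ∈ F := by
      by_contra hone
      refine hnot (le_trans le_sup_left (himp fun b hb => ?_))
      obtain ⟨c, -, rfl⟩ := (Submodule.mem_smul_pointwise_iff_exists _ _ _).1 (hXP hb)
      refine Submodule.smul_mem_pointwise_smul _ _ _ fun j hj => ?_
      rw [Set.mem_singleton_iff] at hj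
      subst hj
      by_contra hne
      refine hone (one_mem_of_vanishingSubmodule_lt ψ hψ (i := j) (I := F) ?_ ?_ ?_ hb hne)
      · refine Submodule.mul_le.2 fun y _ c hc => ?_
        rw [hF, ← mul_smul_comm, ← hXl]
        exact Submodule.mul_mem_mul Submodule.mem_top hc
      · refine Submodule.mul_le.2 fun c hc y _ => ?_
        rw [hF, ← smul_mul_assoc, ← hXr]
        exact Submodule.mul_mem_mul hc Submodule.mem_top
      · exact fun c hc => hMX (Submodule.smul_mem_pointwise_smul _ _ _ hc)
    intro b hb
    obtain ⟨c, -, rfl⟩ := (Submodule.mem_smul_pointwise_iff_exists _ _ _).1 hb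
    rw [← hXr, show ϖ • c = ϖ • (1 : L) * c by rw [smul_mul_assoc, one_mul]]
    exact Submodule.mul_mem_mul h1F Submodule.mem_top
  have hϖM : algebraMap D L (ϖ ^ 1) ∈ M := by
    rw [pow_one]
    exact fun j _ => hϖJ j trivial
  refine ⟨E, hEtop, hEtop', key _ ?_ ?_ ?_ hME fun h b hb => ?_, key _ ?_ ?_ ?_ hEM fun h b hb => ?_⟩
  · rw [← mul_assoc, hMtop]
  · rw [mul_assoc, hEtop']
  · calc ϖ • M = M * ϖ • (⊤ : Submodule D L) := by rw [mul_smul_comm, hMtop']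
      _ ≤ M * E := mul_le_mul_right hPE _
  · obtain ⟨b', rfl⟩ := exists_smul_eq_of_mul_right_mem hL hMtop'.le (pow_ne_zero 1 hϖ0) hϖM hϖ0
      (b := b) fun a ha => by
        obtain ⟨c, hc, hc'⟩ := (Submodule.mem_smul_pointwise_iff_exists _ _ _).1
          (h (Submodule.mul_mem_mul ha hb))
        exact ⟨c, hc, hc'.symm⟩
    exact Submodule.smul_mem_pointwise_smul _ _ _ Submodule.mem_top
  · rw [← mul_assoc, hEtop]
  · rw [mul_assoc, hMtop']
  · calc ϖ • M = ϖ • (⊤ : Submodule D L) * M := by rw [smul_mul_assoc, hMtop]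
      _ ≤ E * M := mul_le_mul_left hPE _
  · obtain ⟨b', rfl⟩ := exists_smul_eq_of_mul_left_mem hL hMtop.le (pow_ne_zero 1 hϖ0) hϖM hϖ0
      (b := b) fun a ha => by
        obtain ⟨c, hc, hc'⟩ := (Submodule.mem_smul_pointwise_iff_exists _ _ _).1
          (h (Submodule.mul_mem_mul hb ha))
        exact ⟨c, hc, hc'.symm⟩
    exact Submodule.smul_mem_pointwise_smul _ _ _ Submodule.mem_top

end MaximalOrder

/-! ### Left ideals of a maximal order over a discrete valuation ring -/

section InvertibleIdeal

open scoped Pointwise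

variable {D L : Type*} [CommRing D] [IsDomain D] [Ring L] [Algebra D L] [Module.IsTorsionFree D L]
  {M E : Submodule D L} {ϖ : D}

theorem le_of_mul_le_mul_of_invertible (hϖ0 : ϖ ≠ 0) (hEM : E * M = ϖ • (⊤ : Submodule D L))
    {X Y : Submodule D L} (hY : ⊤ * Y ≤ Y) (h : M * X ≤ M * Y) : X ≤ Y := by
  refine (smul_le_smul_iff_of_torsionFree hϖ0).1 ?_
  calc ϖ • X ≤ ϖ • (⊤ * X) := Submodule.map_mono (le_top_mul X)
    _ = E * (M * X) := by rw [← mul_assoc, hEM, smul_mul_assoc]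
    _ ≤ E * (M * Y) := mul_le_mul_right h _
    _ = ϖ • (⊤ * Y) := by rw [← mul_assoc, hEM, smul_mul_assoc]
    _ ≤ ϖ • Y := Submodule.map_mono hY

/-- A left ideal contained in an invertible two-sided ideal `M` is `M` times a left ideal: `ϖ⁻¹ E` is
the inverse of `M`. -/
theorem exists_mul_eq_of_le_of_invertible (hϖ0 : ϖ ≠ 0) (hME : M * E = ϖ • (⊤ : Submodule D L))
    (hEM : E * M = ϖ • (⊤ : Submodule D L)) (hE : ⊤ * E = E)
    {X : Submodule D L} (hX : ⊤ * X ≤ X) (hXM : X ≤ M) :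
    ∃ X' : Submodule D L, ⊤ * X' ≤ X' ∧ M * X' = X := by
  have hEX : E * X ≤ ϖ • (⊤ : Submodule D L) := hEM ▸ mul_le_mul_right hXM E
  let X' : Submodule D L := (E * X).comap (LinearMap.lsmul D L ϖ)
  have hX' : ϖ • X' = E * X := by
    ext b
    rw [Submodule.mem_smul_pointwise_iff_exists]
    constructor
    · rintro ⟨a, ha, rfl⟩
      exact ha
    · intro hb
      obtain ⟨a, -, rfl⟩ := (Submodule.mem_smul_pointwise_iff_exists _ _ _).1 (hEX hb)
      exact ⟨a, hb, rfl⟩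
  refine ⟨X', (smul_le_smul_iff_of_torsionFree hϖ0).1 ?_, ?_⟩
  · rw [← mul_smul_comm, hX', ← mul_assoc, hE]
  · have h : ϖ • (M * X') = ϖ • (⊤ * X) := by
      rw [← mul_smul_comm, hX', ← mul_assoc, hME, smul_mul_assoc]
    rw [le_antisymm hX (le_top_mul X)] at h
    exact le_antisymm ((smul_le_smul_iff_of_torsionFree hϖ0).1 h.le)
      ((smul_le_smul_iff_of_torsionFree hϖ0).1 h.ge)

end InvertibleIdeal

/-- A left ideal as a submodule over the base ring. -/
def idealSubmodule (D : Type*) {L : Type*} [CommRing D] [Ring L] [Algebra D L] (N : Ideal L) :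
    Submodule D L :=
  N.restrictScalars D

theorem mem_idealSubmodule {D L : Type*} [CommRing D] [Ring L] [Algebra D L] {N : Ideal L} {b : L} :
    b ∈ idealSubmodule D N ↔ b ∈ N := Iff.rfl

theorem top_mul_idealSubmodule_le {D L : Type*} [CommRing D] [Ring L] [Algebra D L] (N : Ideal L) :
    ⊤ * idealSubmodule D N ≤ idealSubmodule D N :=
  Submodule.mul_le.2 fun b _ _ ha => N.mul_mem_left b ha

theorem exists_vanishingSubmodule_le_of_isMaximal (D : Type*) {L : Type*} [CommRing D] [Ring L]
    [Algebra D L] {n : ℕ} {S : Fin n → Type*} [∀ i, Ring (S i)] (ψ : L →+* ∀ i, S i)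
    (hψ : Function.Surjective ψ) (hψker : ∀ b, ψ b = 0 ↔ b ∈ Ring.jacobson L) (N : Ideal L)
    [N.IsMaximal] : ∃ i, vanishingSubmodule D ψ {i} ≤ idealSubmodule D N := by
  classical
  choose u hu using fun i : Fin n => hψ (Pi.single i 1)
  have hJ := Ring.jacobson_le_of_isMaximal N
  obtain ⟨i, hi⟩ : ∃ i, u i ∉ N := by
    by_contra! h
    refine (Ideal.ne_top_iff_one N).1 (Ideal.IsMaximal.ne_top ‹_›) ?_
    have h1 : (1 : L) - ∑ i, u i ∈ Ring.jacobson L := by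
      rw [← hψker, map_sub, map_one, map_sum]
      simp only [hu]
      rw [sub_eq_zero]
      exact (Finset.univ_sum_single (1 : ∀ i, S i)).symm
    have := N.add_mem (hJ h1) (sum_mem (t := Finset.univ) fun i _ => h i)
    rwa [sub_add_cancel] at this
  obtain ⟨c, a, ha, hca⟩ := Ideal.IsMaximal.exists_inv ‹_› hi
  refine ⟨i, fun b hb => ?_⟩
  rw [mem_idealSubmodule, show b = b * c * u i + b * a by rw [mul_assoc, ← mul_add, hca, mul_one]]
  refine N.add_mem (hJ ?_) (N.mul_mem_left b ha)
  rw [← hψker, map_mul, map_mul, hu]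
  funext j
  rcases eq_or_ne j i with rfl | hj
  · simp [hb j rfl]
  · simp [hj]

section MaximalIdeal

open scoped Pointwise

variable {D L : Type*} [CommRing D] [IsDomain D] [IsLocalRing D] [IsNoetherianRing D]
  [Finite (IsLocalRing.ResidueField D)] [Ring L] [Algebra D L]
  {n : ℕ} {S : Fin n → Type*} [∀ i, Ring (S i)] [∀ i, IsSimpleRing (S i)]
  {ψ : L →+* ∀ i, S i} {ϖ : D}

theorem inf_vanishingSubmodule_le_mul (hL : IsMaximalOrder D L) (hψ : Function.Surjective ψ)
    (hψker : ∀ b, ψ b = 0 ↔ b ∈ Ring.jacobson L) (hϖ0 : ϖ ≠ 0)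
    (hϖ : IsLocalRing.maximalIdeal D = Ideal.span {ϖ}) {i j : Fin n} (hij : i ≠ j) :
    vanishingSubmodule D ψ {i} ⊓ vanishingSubmodule D ψ {j} ≤
      vanishingSubmodule D ψ {j} * vanishingSubmodule D ψ {i} := by
  classical
  have := hL.torsionFree
  obtain ⟨E, hE, -, hME, hEM⟩ := exists_mul_eq_smul_top ψ hL hψ hψker hϖ0 hϖ j
  obtain ⟨X', -, hX'⟩ := exists_mul_eq_of_le_of_invertible hϖ0 hME hEM hE
    (X := vanishingSubmodule D ψ {i} ⊓ vanishingSubmodule D ψ {j})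
    (le_inf ((mul_le_mul_right inf_le_left _).trans (top_mul_vanishingSubmodule ψ _).le)
      ((mul_le_mul_right inf_le_right _).trans (top_mul_vanishingSubmodule ψ _).le)) inf_le_right
  refine hX'.ge.trans (mul_le_mul_right (fun a ha => ?_) _)
  obtain ⟨g, hg⟩ := hψ (Pi.single i 1)
  have hgM : g ∈ vanishingSubmodule D ψ {j} := fun k hk => by
    rw [Set.mem_singleton_iff] at hk
    rw [hg, hk, Pi.single_eq_of_ne' hij]
  have h1 := (hX'.le (Submodule.mul_mem_mul hgM ha)).1 i rfl
  rw [map_mul, Pi.mul_apply, hg, Pi.single_eq_same, one_mul] at h1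
  intro k hk
  rw [Set.mem_singleton_iff] at hk
  rw [hk, h1]

theorem exists_generator_mod_of_ne (hL : IsMaximalOrder D L) (hψ : Function.Surjective ψ)
    (hψker : ∀ b, ψ b = 0 ↔ b ∈ Ring.jacobson L) (hϖ0 : ϖ ≠ 0)
    (hϖ : IsLocalRing.maximalIdeal D = Ideal.span {ϖ}) {N : Ideal L} {i j : Fin n} (hij : i ≠ j)
    (hiN : vanishingSubmodule D ψ {i} ≤ idealSubmodule D N) :
    ∃ y ∈ N, idealSubmodule D N ≤
      idealSubmodule D (Ideal.span {y}) ⊔ vanishingSubmodule D ψ {j} * idealSubmodule D N := by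
  classical
  obtain ⟨v, hv⟩ := hψ (Pi.single j 1)
  obtain ⟨g, hg⟩ := hψ (Pi.single i 1)
  have hgM : g ∈ vanishingSubmodule D ψ {j} := fun k hk => by
    rw [Set.mem_singleton_iff] at hk
    rw [hg, hk, Pi.single_eq_of_ne' hij]
  have hvN : v ∈ N := hiN fun k hk => by
    rw [Set.mem_singleton_iff] at hk
    rw [hv, hk, Pi.single_eq_of_ne hij]
  refine ⟨v, hvN, fun a ha => ?_⟩
  rw [← add_sub_cancel (a * v) a]
  refine Submodule.add_mem_sup (Ideal.mem_span_singleton'.2 ⟨a, rfl⟩) ?_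
  set b := a - a * v with hb
  have hbN : b ∈ N := N.sub_mem ha (N.mul_mem_left a hvN)
  have hbj : ψ b j = 0 := by
    rw [hb, map_sub, map_mul, hv, Pi.sub_apply, Pi.mul_apply, Pi.single_eq_same, mul_one, sub_self]
  rw [show b = g * b + (b - g * b) by abel]
  refine add_mem (Submodule.mul_mem_mul hgM hbN) (mul_le_mul_right hiN _
    (inf_vanishingSubmodule_le_mul hL hψ hψker hϖ0 hϖ hij ⟨fun k hk => ?_, fun k hk => ?_⟩))
  · rw [Set.mem_singleton_iff] at hk
    rw [hk, map_sub, map_mul, hg, Pi.sub_apply, Pi.mul_apply, Pi.single_eq_same, one_mul, sub_self]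
  · rw [Set.mem_singleton_iff] at hk
    rw [hk, map_sub, map_mul, hg, Pi.sub_apply, Pi.mul_apply, hbj, mul_zero, sub_zero]

/-- For a maximal left ideal `N` above the two-sided ideal `M`, the module `M / M N` is simple
because `M` is invertible, and with an idempotent `e` generating `N / M` one finds `w ∈ M` such that
`e + (1 - e) w` generates `N` modulo `M N`. -/
theorem exists_generator_mod_self [∀ i, IsSemisimpleRing (S i)] (hL : IsMaximalOrder D L)
    (hψ : Function.Surjective ψ)
    (hψker : ∀ b, ψ b = 0 ↔ b ∈ Ring.jacobson L) (hϖ0 : ϖ ≠ 0)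
    (hϖ : IsLocalRing.maximalIdeal D = Ideal.span {ϖ}) {N : Ideal L} [hN : N.IsMaximal] {i : Fin n}
    (hiN : vanishingSubmodule D ψ {i} ≤ idealSubmodule D N) :
    ∃ y ∈ N, idealSubmodule D N ≤
      idealSubmodule D (Ideal.span {y}) ⊔ vanishingSubmodule D ψ {i} * idealSubmodule D N := by
  have := hL.torsionFree
  obtain ⟨E, hE, -, hME, hEM⟩ := exists_mul_eq_smul_top ψ hL hψ hψker hϖ0 hϖ i
  set M := vanishingSubmodule D ψ {i} with hM
  set N' := idealSubmodule D N with hN'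
  have hMl : ⊤ * M = M := top_mul_vanishingSubmodule ψ _
  have hMr : M * ⊤ = M := vanishingSubmodule_mul_top ψ _
  have hmemM : ∀ a, ψ a i = 0 → a ∈ M := fun a ha k hk => by
    rw [Set.mem_singleton_iff] at hk
    rw [hk, ha]
  have hN1 : (1 : L) ∉ N := (Ideal.ne_top_iff_one N).1 hN.ne_top
  have hMN : M * N' ≤ M := (mul_le_mul_right le_top _).trans hMr.le
  have hnot : ¬ M ≤ M * N' := fun h => hN1 <|
    le_of_mul_le_mul_of_invertible hϖ0 hEM (X := ⊤) (top_mul_idealSubmodule_le N)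
      (hMr.le.trans h) Submodule.mem_top
  let f : L →+* S i := (Pi.evalRingHom S i).comp ψ
  have hf : Function.Surjective f := (Function.surjective_eval i).comp hψ
  obtain ⟨e, he, heN⟩ := IsSemisimpleRing.ideal_eq_span_idempotent (N.map f)
  obtain ⟨e₀, he₀, hfe⟩ := (Ideal.mem_map_iff_of_surjective f hf).1
    (heN ▸ Ideal.mem_span_singleton_self e)
  have hfa : ∀ a, f a = ψ a i := fun a => rfl
  have hmod : ∀ a ∈ N, a - a * e₀ ∈ M := by
    intro a ha
    obtain ⟨c, hc⟩ := Ideal.mem_span_singleton'.1 (heN ▸ Ideal.mem_map_of_mem f ha)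
    refine hmemM _ ?_
    rw [← hfa, map_sub, map_mul, hfe, ← hc, mul_assoc, he.eq, sub_self]
  have hide : e₀ - e₀ * e₀ ∈ M := hmod _ he₀
  obtain ⟨w, hwM, hw⟩ : ∃ w ∈ M, (1 - e₀) * w ∉ M * N' := by
    by_contra! h
    let K : Submodule D L :=
      { carrier := {a | ∀ w ∈ M, a * w ∈ M * N'}
        add_mem' := fun {a b} ha hb w hw => by
          rw [add_mul]
          exact add_mem (ha w hw) (hb w hw)
        zero_mem' := fun w _ => by
          rw [zero_mul]
          exact zero_mem _
        smul_mem' := fun r a ha w hw => by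
          rw [smul_mul_assoc]
          exact Submodule.smul_mem _ r (ha w hw) }
    have h1 : (1 : L) ∈ K := by
      refine one_mem_of_vanishingSubmodule_lt ψ hψ (i := i) (a := 1 - e₀) ?_ ?_ ?_ h ?_
      · refine Submodule.mul_le.2 fun b _ a ha w hw => ?_
        rw [mul_assoc, ← hMl, mul_assoc]
        exact Submodule.mul_mem_mul Submodule.mem_top (ha w hw)
      · refine Submodule.mul_le.2 fun a ha b _ w hw => ?_
        rw [mul_assoc]
        exact ha _ (hMl.le (Submodule.mul_mem_mul Submodule.mem_top hw))
      · exact fun a ha w hw => Submodule.mul_mem_mul ha (hiN hw)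
      · intro h0
        have := N.add_mem (hiN (hmemM _ h0)) he₀
        rw [sub_add_cancel] at this
        exact hN1 this
    exact hnot fun w hw => by simpa using h1 w hw
  -- the only left ideals between `M N` and `M` are these two
  have hsimple : ∀ X : Submodule D L, ⊤ * X ≤ X → M * N' ≤ X → (1 - e₀) * w ∈ X → M ≤ X := by
    intro X hX hle hmem
    obtain ⟨X', hX'l, hX'⟩ := exists_mul_eq_of_le_of_invertible hϖ0 hME hEM hE (X := X ⊓ M)
      (le_inf ((mul_le_mul_right inf_le_left _).trans hX)
        ((mul_le_mul_right inf_le_right _).trans hMl.le)) inf_le_right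
    have hNX : N' ≤ X' := le_of_mul_le_mul_of_invertible hϖ0 hEM hX'l
      (hX' ▸ le_inf hle hMN)
    have hmem' : (1 - e₀) * w ∈ M * X' :=
      hX' ▸ ⟨hmem, hMl.le (Submodule.mul_mem_mul Submodule.mem_top hwM)⟩
    have h1 : (1 : L) ∈ X' := by
      by_contra h1
      let T : Ideal L := { X' with
        smul_mem' := fun b c hc => hX'l (Submodule.mul_mem_mul Submodule.mem_top hc) }
      have hT : N = T := hN.eq_of_le ((Ideal.ne_top_iff_one T).2 h1) hNX
      refine hw (mul_le_mul_right (fun a ha => ?_) M hmem')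
      rw [hN', mem_idealSubmodule, hT]
      exact ha
    have : M * ⊤ ≤ M * X' := mul_le_mul_right (fun a _ => by
      simpa using hX'l (Submodule.mul_mem_mul (Submodule.mem_top (x := a)) h1)) M
    rw [hMr, hX'] at this
    exact this.trans inf_le_left
  set y := e₀ * e₀ + (1 - e₀) * w with hy
  have hyN : y ∈ N := N.add_mem (N.mul_mem_left _ he₀) (N.mul_mem_left _ (hiN hwM))
  refine ⟨y, hyN, ?_⟩
  set X := idealSubmodule D (Ideal.span {y}) ⊔ M * N' with hXdef
  have hXl : ⊤ * X ≤ X := by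
    rw [hXdef, Submodule.mul_sup, ← mul_assoc, hMl]
    exact sup_le_sup_right (top_mul_idealSubmodule_le _) _
  have hspan : ∀ b, b * y ∈ X := fun b =>
    Submodule.mem_sup_left (Ideal.mem_span_singleton'.2 ⟨b, rfl⟩)
  have hMNX : M * N' ≤ X := le_sup_right
  have hee : e₀ * e₀ ∈ X := by
    have h1 : e₀ * e₀ = e₀ * y - (e₀ - e₀ * e₀) * w + (e₀ - e₀ * e₀) * e₀ := by
      rw [hy]; noncomm_ring
    rw [h1]
    exact add_mem (sub_mem (hspan _) (hMNX (Submodule.mul_mem_mul hide (hiN hwM))))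
      (hMNX (Submodule.mul_mem_mul hide he₀))
  have hMX : M ≤ X := hsimple X hXl hMNX (by
    have h1 : (1 - e₀) * w = 1 * y - e₀ * e₀ := by rw [hy]; noncomm_ring
    rw [h1]
    exact sub_mem (hspan 1) hee)
  intro a ha
  have h1 : a = (a - a * e₀) + a * (e₀ - e₀ * e₀) + a * (e₀ * e₀) := by noncomm_ring
  rw [h1]
  exact add_mem (add_mem (hMX (hmod a ha))
    (hMX (hMl.le (Submodule.mul_mem_mul Submodule.mem_top hide))))
    (hXl (Submodule.mul_mem_mul Submodule.mem_top hee))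

/-- A maximal left ideal is locally generated by one element at each maximal two-sided ideal, hence
principal by the Chinese remainder theorem and Nakayama's lemma. -/
theorem exists_eq_span_singleton_of_isMaximal [∀ i, IsSemisimpleRing (S i)]
    (hL : IsMaximalOrder D L) (hψ : Function.Surjective ψ)
    (hψker : ∀ b, ψ b = 0 ↔ b ∈ Ring.jacobson L) (hϖ0 : ϖ ≠ 0)
    (hϖ : IsLocalRing.maximalIdeal D = Ideal.span {ϖ}) (N : Ideal L) [N.IsMaximal] :
    ∃ y, N = Ideal.span {y} ∧ ∀ b, b * y = 0 → b = 0 := by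
  classical
  have := hL.finite
  have := hL.torsionFree
  obtain ⟨i, hi⟩ := exists_vanishingSubmodule_le_of_isMaximal D ψ hψ hψker N
  have hloc : ∀ k, ∃ y ∈ N, idealSubmodule D N ≤
      idealSubmodule D (Ideal.span {y}) ⊔ vanishingSubmodule D ψ {k} * idealSubmodule D N := by
    intro k
    rcases eq_or_ne i k with rfl | hk
    · exact exists_generator_mod_self hL hψ hψker hϖ0 hϖ hi
    · exact exists_generator_mod_of_ne hL hψ hψker hϖ0 hϖ hk hi
  choose v hvN hv using hloc
  choose c hc using fun k : Fin n => hψ (Pi.single k 1)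
  set y := ∑ k, c k * v k with hy
  have hyN : y ∈ N := sum_mem fun k _ => N.mul_mem_left _ (hvN k)
  have hdiff : ∀ k, v k - y ∈ vanishingSubmodule D ψ {k} * idealSubmodule D N := by
    intro k
    have h1 : v k - y = (1 - c k) * v k - ∑ l ∈ Finset.univ.erase k, c l * v l := by
      rw [hy, ← Finset.add_sum_erase _ _ (Finset.mem_univ k)]
      noncomm_ring
    rw [h1]
    refine sub_mem (Submodule.mul_mem_mul (fun l hl => ?_) (hvN k))
      (sum_mem fun l hl => Submodule.mul_mem_mul (fun l' hl' => ?_) (hvN l))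
    · rw [Set.mem_singleton_iff] at hl
      rw [hl, map_sub, map_one, hc, Pi.sub_apply, Pi.single_eq_same, Pi.one_apply, sub_self]
    · rw [Set.mem_singleton_iff] at hl'
      rw [hl', hc, Pi.single_eq_of_ne (Finset.ne_of_mem_erase hl).symm]
  have hy' : ∀ k, idealSubmodule D N ≤
      idealSubmodule D (Ideal.span {y}) ⊔ vanishingSubmodule D ψ {k} * idealSubmodule D N := by
    intro k
    refine (hv k).trans (sup_le ?_ le_sup_right)
    intro a ha
    obtain ⟨b, rfl⟩ := Ideal.mem_span_singleton'.1 ha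
    rw [show b * v k = b * y + b * (v k - y) by noncomm_ring]
    refine Submodule.add_mem_sup (Ideal.mem_span_singleton'.2 ⟨b, rfl⟩) ?_
    rw [← top_mul_vanishingSubmodule (D := D) ψ, mul_assoc]
    exact Submodule.mul_mem_mul Submodule.mem_top (hdiff k)
  have hword : ∀ l : List (Fin n), idealSubmodule D N ≤
      idealSubmodule D (Ideal.span {y}) ⊔ idealWord D ψ l * idealSubmodule D N := by
    intro l
    induction l with
    | nil => exact (le_top_mul _).trans le_sup_right
    | cons k l ih =>
      refine (hy' k).trans (sup_le le_sup_left ((mul_le_mul_right ih _).trans ?_))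
      rw [Submodule.mul_sup, idealWord, mul_assoc]
      exact sup_le_sup_right ((mul_le_mul_left le_top _).trans (top_mul_idealSubmodule_le _)) _
  obtain ⟨l, hl⟩ := exists_idealWord_le_smul_top ψ hψker hϖ
  have hNy : idealSubmodule D N ≤ idealSubmodule D (Ideal.span {y}) := by
    refine Submodule.le_of_le_smul_of_le_jacobson_bot (I := IsLocalRing.maximalIdeal D)
      (IsNoetherian.noetherian _) (IsLocalRing.maximalIdeal_le_jacobson _)
      ((hword l).trans (sup_le_sup_left ((mul_le_mul_left hl _).trans ?_) _))
    rw [hϖ, Submodule.ideal_span_singleton_smul, smul_mul_assoc]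
    exact Submodule.map_mono (top_mul_idealSubmodule_le N)
  have hspan : N = Ideal.span {y} := le_antisymm (fun a ha => hNy ha)
    ((Ideal.span_singleton_le_iff_mem N).2 hyN)
  refine ⟨y, hspan, fun b hb => ?_⟩
  -- `y` divides `ϖ`, so that it is invertible in the generic fibre
  obtain ⟨a, ha⟩ : ∃ a, a * y = algebraMap D L ϖ := Ideal.mem_span_singleton'.1
    (hspan ▸ Ring.jacobson_le_of_isMaximal N
      (algebraMap_mem_jacobson D (hϖ ▸ Ideal.mem_span_singleton_self ϖ)))
  have := hL.artinian
  set ι := (Algebra.TensorProduct.includeRight : L →ₐ[D] FractionRing D ⊗[D] L) with hι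
  have hinj : Function.Injective ι := includeRight_injective_of_torsionFree
  have h1 : (algebraMap D (FractionRing D) ϖ)⁻¹ • ι a * ι y = 1 := by
    rw [smul_mul_assoc, ← map_mul, ha, AlgHom.commutes,
      Algebra.algebraMap_eq_smul_one (A := FractionRing D ⊗[D] L), ← algebraMap_smul (FractionRing D) ϖ, smul_smul,
      inv_mul_cancel₀ (isUnit_algebraMap_fractionRing hϖ0).ne_zero, one_smul]
  have h2 := mul_eq_one_symm h1
  refine hinj ?_
  rw [map_zero, ← mul_one (ι b), ← h2, ← mul_assoc, ← map_mul, hb, map_zero, zero_mul]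

end MaximalIdeal

/-! ### Homogeneity of products of maximal orders -/

theorem finite_quotient_of_mem_iff {B C : Type*} [Ring B] [Ring C] (f : B →+ C) {N : Ideal C}
    [Finite (C ⧸ N)] {N' : Ideal B} (h : ∀ b, b ∈ N' ↔ f b ∈ N) : Finite (B ⧸ N') := by
  let g : B ⧸ N'.toAddSubgroup →+ C ⧸ N.toAddSubgroup :=
    QuotientAddGroup.map _ _ f fun b hb => (h b).1 hb
  have : Finite (C ⧸ N.toAddSubgroup) := ‹Finite (C ⧸ N)›
  refine Finite.of_injective g ((injective_iff_map_eq_zero g).2 fun b => ?_)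
  induction b using QuotientAddGroup.induction_on with
  | H b =>
    intro hb
    exact (QuotientAddGroup.eq_zero_iff b).2 ((h b).2 ((QuotientAddGroup.eq_zero_iff (f b)).1 hb))

/-- If the maximal left ideals are generated by right regular elements, then so are all left ideals
of finite index. This is by induction on the index: a left ideal inside `B y` is `N' y` with `N'` of
smaller index. -/
theorem isHomogeneousRing_of_isMaximal {B : Type*} [Ring B]
    (h : ∀ N : Ideal B, N.IsMaximal → ∃ y, N = Ideal.span {y} ∧ ∀ b, b * y = 0 → b = 0) :
    IsHomogeneousRing B := by
  have key : ∀ k : ℕ, ∀ N : Ideal B, Finite (B ⧸ N) → Nat.card (B ⧸ N) = k →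
      ∃ y, N = Ideal.span {y} ∧ ∀ b, b * y = 0 → b = 0 := by
    intro k
    induction k using Nat.strong_induction_on with
    | _ k ih =>
      intro N hfin hk
      rcases eq_or_ne N ⊤ with rfl | hN
      · exact ⟨1, by rw [Ideal.span_singleton_one], fun b hb => by rwa [mul_one] at hb⟩
      obtain ⟨P, hP, hNP⟩ := Ideal.exists_le_maximal N hN
      obtain ⟨y, hy, hyreg⟩ := h P hP
      obtain ⟨N', rfl⟩ := exists_mulRightIdeal_eq (hy ▸ hNP)
      have hcard := card_quotient_mulRightIdeal hyreg N'
      rw [← hy] at hcard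
      have hpos : 0 < Nat.card (B ⧸ mulRightIdeal N' y) := Nat.card_pos
      have hfinP : Finite (B ⧸ P) := Finite.of_surjective _ (Submodule.factor_surjective hNP)
      have hone : 1 < Nat.card (B ⧸ P) := by
        have : Nontrivial (B ⧸ P) := Submodule.Quotient.nontrivial_iff.2 hP.ne_top
        exact Finite.one_lt_card
      have hpos' : 0 < Nat.card (B ⧸ N') := Nat.pos_of_mul_pos_right (hcard ▸ hpos)
      obtain ⟨y', hy', hreg'⟩ := ih _ (hk ▸ hcard ▸ lt_mul_of_one_lt_right hpos' hone) N'
        (Nat.finite_of_card_ne_zero hpos'.ne') rfl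
      refine ⟨y' * y, ?_, fun b hb => hreg' b (hyreg _ (by rwa [mul_assoc]))⟩
      ext b
      rw [mem_mulRightIdeal, Ideal.mem_span_singleton', hy']
      simp only [Ideal.mem_span_singleton']
      constructor
      · rintro ⟨_, ⟨a, rfl⟩, rfl⟩
        exact ⟨a, (mul_assoc _ _ _).symm⟩
      · rintro ⟨a, rfl⟩
        exact ⟨_, ⟨a, rfl⟩, mul_assoc _ _ _⟩
  exact fun N hN => key _ N hN rfl

theorem isHomogeneousRing_of_isMaximalOrder {D : Type*} {L : Type u} [CommRing D] [IsDomain D]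
    [IsDiscreteValuationRing D] [Ring L] [Algebra D L] (hL : IsMaximalOrder D L)
    [Finite (L ⧸ Ring.jacobson L)] : IsHomogeneousRing L := by
  have := hL.finite
  have : Nontrivial L := by
    by_contra hnon
    rw [not_nontrivial_iff_subsingleton] at hnon
    have := hL.simple
    have h1 : (1 : FractionRing D ⊗[D] L) = 0 := by
      rw [Algebra.TensorProduct.one_def, Subsingleton.elim (1 : L) 0, TensorProduct.tmul_zero]
    exact one_ne_zero h1
  have : Nontrivial (L ⧸ Ring.jacobson L) := by
    obtain ⟨P, hP⟩ := Ideal.exists_maximal L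
    exact Submodule.Quotient.nontrivial_iff.2
      (ne_top_of_le_ne_top hP.ne_top (Ring.jacobson_le_of_isMaximal P))
  have : Finite (IsLocalRing.ResidueField D) := by
    let f : D →+* L ⧸ Ring.jacobson L := (Ideal.Quotient.mk (Ring.jacobson L)).comp (algebraMap D L)
    let g : IsLocalRing.ResidueField D →+* L ⧸ Ring.jacobson L :=
      Ideal.Quotient.lift (IsLocalRing.maximalIdeal D) f fun a ha =>
        Ideal.Quotient.eq_zero_iff_mem.2 (algebraMap_mem_jacobson D ha)
    exact Finite.of_injective g g.injective
  obtain ⟨ϖ, hϖ⟩ := IsDiscreteValuationRing.exists_irreducible D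
  obtain ⟨n, S, _, ψ, hsimple, hss, hψ, hψker⟩ := exists_radical_quotient_decomposition L
  exact isHomogeneousRing_of_isMaximal fun N hN =>
    exists_eq_span_singleton_of_isMaximal hL hψ hψker hϖ.ne_zero hϖ.maximalIdeal_eq N

theorem isHomogeneousRing_pi {n : ℕ} {L : Fin n → Type*} [∀ i, Ring (L i)]
    (h : ∀ i, IsHomogeneousRing (L i)) : IsHomogeneousRing (∀ i, L i) := by
  classical
  intro N hfin
  let f : ∀ i, L i →+ ∀ i, L i := fun i => AddMonoidHom.single L i
  let N' : ∀ i, Ideal (L i) := fun i =>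
    { carrier := {a | f i a ∈ N}
      add_mem' := fun {a b} ha hb => by
        change f i (a + b) ∈ N
        rw [map_add]
        exact N.add_mem ha hb
      zero_mem' := by
        change f i 0 ∈ N
        rw [map_zero]
        exact N.zero_mem
      smul_mem' := fun c a ha => by
        change Pi.single i (c * a) ∈ N
        rw [Pi.single_mul]
        exact N.mul_mem_left _ ha }
  choose y hy hreg using fun i => h i (N' i) (finite_quotient_of_mem_iff (f i) fun b => Iff.rfl)
  refine ⟨y, ?_, fun b hb => funext fun i => hreg i _ (congrFun hb i)⟩
  refine le_antisymm (fun a ha => ?_) ((Ideal.span_singleton_le_iff_mem N).2 ?_)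
  · have h1 : ∀ i, ∃ c, c * y i = a i := fun i => Ideal.mem_span_singleton'.1 <| hy i ▸ by
      change Pi.single i (a i) ∈ N
      rw [show Pi.single i (a i) = Pi.single i 1 * a by rw [← Pi.single_mul_left, one_mul]]
      exact N.mul_mem_left _ ha
    choose c hc using h1
    exact Ideal.mem_span_singleton'.2 ⟨c, funext hc⟩
  · rw [← Finset.univ_sum_single y]
    exact sum_mem fun i _ =>
      (show y i ∈ N' i from (hy i).ge (Ideal.mem_span_singleton_self (y i)))

theorem IsHomogeneousRing.of_ringEquiv {B C : Type*} [Ring B] [Ring C] (h : IsHomogeneousRing C)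
    (e : B ≃+* C) : IsHomogeneousRing B := by
  intro N hfin
  let N' : Ideal C := N.comap (e.symm : C →+* B)
  obtain ⟨y, hy, hreg⟩ := h N' (finite_quotient_of_mem_iff (e.symm : C →+ B) fun b => Iff.rfl)
  refine ⟨e.symm y, ?_, fun b hb => ?_⟩
  · ext b
    have h1 : b ∈ N ↔ e b ∈ N' := by simp [N']
    rw [h1, hy, Ideal.mem_span_singleton', Ideal.mem_span_singleton']
    constructor
    · rintro ⟨a, ha⟩
      exact ⟨e.symm a, by rw [← map_mul, ha, e.symm_apply_apply]⟩
    · rintro ⟨a, rfl⟩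
      exact ⟨e a, by rw [map_mul, e.apply_symm_apply]⟩
  · have := hreg (e b) (by rw [← e.apply_symm_apply y, ← map_mul, hb, map_zero])
    simpa using this

theorem isHomogeneousRing_of_isProductOfMaximalOrders {B : Type u} [Ring B]
    [Finite (B ⧸ Ring.jacobson B)] (h : IsProductOfMaximalOrders B) : IsHomogeneousRing B := by
  obtain ⟨n, D, L, _, _, _, _, _, hL, ⟨e⟩⟩ := h
  refine IsHomogeneousRing.of_ringEquiv (isHomogeneousRing_pi fun i => ?_) e
  let f : B →+* L i := (Pi.evalRingHom L i).comp (e : B →+* ∀ i, L i)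
  have hf : Function.Surjective f := (Function.surjective_eval i).comp e.surjective
  have hle : Ring.jacobson B ≤ (Ring.jacobson (L i)).comap f :=
    haveI : RingHomSurjective f := ⟨hf⟩
    Ring.le_comap_jacobson f
  have : Finite (L i ⧸ Ring.jacobson (L i)) :=
    Finite.of_surjective (Ideal.quotientMap (Ring.jacobson (L i)) f hle)
      (Ideal.quotientMap_surjective hf)
  exact isHomogeneousRing_of_isMaximalOrder (hL i)

/-! ### Dirichlet series of weighted families -/

/-- The formal Dirichlet series `∑ w i (ν i)⁻ˢ` over the indices with `ν i ≠ 0`. It is meaningful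
when each nonzero value of `ν` is taken finitely often. -/
noncomputable def famSeries {ι : Type*} (ν : ι → ℕ) (w : ι → ℚ) : ArithmeticFunction ℚ where
  toFun N := if N = 0 then 0 else ∑ᶠ i ∈ {i | ν i = N}, w i
  map_zero' := if_pos rfl

/-- Each nonzero value is taken finitely often. -/
def FiniteFibres {ι : Type*} (ν : ι → ℕ) : Prop :=
  ∀ N, N ≠ 0 → {i | ν i = N}.Finite

section FamSeries

variable {ι κ : Type*} {ν : ι → ℕ} {ν' : κ → ℕ} {w : ι → ℚ} {w' : κ → ℚ}

theorem famSeries_apply {N : ℕ} (hN : N ≠ 0) : famSeries ν w N = ∑ᶠ i ∈ {i | ν i = N}, w i :=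
  if_neg hN

theorem famSeries_apply_eq_sum (h : FiniteFibres ν) {N : ℕ} (hN : N ≠ 0) :
    famSeries ν w N = ∑ i ∈ (h N hN).toFinset, w i := by
  rw [famSeries_apply hN, finsum_mem_eq_finite_toFinset_sum]

theorem FiniteFibres.finite_dvd (h : FiniteFibres ν) {N : ℕ} (hN : N ≠ 0) :
    {i | ν i ∣ N}.Finite := by
  refine (Set.Finite.biUnion (N.divisors.finite_toSet)
    (t := fun d => if d = 0 then ∅ else {i | ν i = d}) fun d _ => ?_).subset fun i hi => ?_
  · split
    · exact Set.finite_empty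
    · exact h d ‹_›
  · have hi' : ν i ∣ N := hi
    have h0 : ν i ≠ 0 := fun h0 => hN (zero_dvd_iff.1 (h0 ▸ hi'))
    refine Set.mem_biUnion (x := ν i) (by simpa using ⟨hi', hN⟩) ?_
    rw [if_neg h0]
    rfl

theorem FiniteFibres.mul (h : FiniteFibres ν) (h' : FiniteFibres ν') :
    FiniteFibres fun p : ι × κ => ν p.1 * ν' p.2 := fun _ hN =>
  ((h.finite_dvd hN).prod (h'.finite_dvd hN)).subset fun _ hp =>
    ⟨Dvd.intro _ hp, Dvd.intro_left _ hp⟩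

theorem FiniteFibres.of_finite [Finite ι] : FiniteFibres ν := fun _ _ => Set.toFinite _

theorem famSeries_mul (h : FiniteFibres ν) (h' : FiniteFibres ν') :
    famSeries (fun p : ι × κ => ν p.1 * ν' p.2) (fun p => w p.1 * w' p.2) =
      famSeries ν w * famSeries ν' w' := by
  classical
  ext N
  rcases eq_or_ne N 0 with rfl | hN
  · simp
  rw [famSeries_apply_eq_sum (h.mul h') hN, ArithmeticFunction.mul_apply,
    ← Finset.sum_fiberwise_of_maps_to (g := fun p => (ν p.1, ν' p.2))
      (t := N.divisorsAntidiagonal)]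
  · refine Finset.sum_congr rfl fun d hd => ?_
    obtain ⟨h1, -⟩ := Nat.mem_divisorsAntidiagonal.1 hd
    have hd1 : d.1 ≠ 0 := fun h0 => hN (by rw [← h1, h0, zero_mul])
    have hd2 : d.2 ≠ 0 := fun h0 => hN (by rw [← h1, h0, mul_zero])
    rw [famSeries_apply_eq_sum h hd1, famSeries_apply_eq_sum h' hd2, Finset.sum_mul_sum,
      ← Finset.sum_product']
    refine Finset.sum_congr ?_ fun _ _ => rfl
    ext p
    simp only [Finset.mem_filter, Set.Finite.mem_toFinset, Set.mem_ofPred_eq, Finset.mem_product]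
    constructor
    · rintro ⟨-, rfl⟩
      exact ⟨rfl, rfl⟩
    · rintro ⟨h3, h4⟩
      exact ⟨by rw [h3, h4, h1], by rw [h3, h4]⟩
  · intro p hp
    rw [Set.Finite.mem_toFinset] at hp
    exact Nat.mem_divisorsAntidiagonal.2 ⟨hp, hN⟩

/-- Summation along the fibres of a map. -/
theorem famSeries_eq_of_fibres (hν : FiniteFibres ν) (φ : ι → κ) (hφ : ∀ i, ν' (φ i) = ν i)
    (hw : ∀ k, ν' k ≠ 0 → ∑ᶠ i ∈ {i | φ i = k}, w i = w' k) :
    famSeries ν w = famSeries ν' w' := by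
  classical
  ext N
  rcases eq_or_ne N 0 with rfl | hN
  · simp
  set T := (hν N hN).toFinset with hT
  have hmem : ∀ i, i ∈ T ↔ ν i = N := fun i => by rw [hT, Set.Finite.mem_toFinset]; rfl
  rw [famSeries_apply_eq_sum hν hN, famSeries_apply hN,
    finsum_mem_eq_sum_of_subset (t := T.image φ),
    ← Finset.sum_fiberwise_of_maps_to (g := φ) (t := T.image φ) fun i => Finset.mem_image_of_mem φ]
  · refine Finset.sum_congr rfl fun k hk => ?_
    obtain ⟨i, hi, rfl⟩ := Finset.mem_image.1 hk
    have hi' := (hmem i).1 hi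
    rw [← hw _ (by rw [hφ, hi']; exact hN), ← finsum_mem_coe_finset]
    refine finsum_mem_congr (Set.ext fun j => ?_) fun _ _ => rfl
    refine ⟨fun h => (Finset.mem_filter.1 h).2, fun h => ?_⟩
    refine Finset.mem_filter.2 ⟨(hmem j).2 ?_, h⟩
    rw [← hφ, show φ j = φ i from h, hφ, hi']
  · rintro k ⟨hk, hk'⟩
    by_contra hne
    refine hk' ?_
    have hk0 : ν' k = N := hk
    rw [← hw k (by rw [hk0]; exact hN)]
    rw [show {i | φ i = k} = ∅ from ?_, finsum_mem_empty]
    refine Set.eq_empty_iff_forall_notMem.2 fun i hi => hne ?_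
    have hi' : φ i = k := hi
    exact Finset.mem_coe.2 (Finset.mem_image.2 ⟨i, (hmem i).2 (by rw [← hφ, hi', hk0]), hi'⟩)
  · intro k hk
    obtain ⟨i, hi, rfl⟩ := Finset.mem_image.1 (Finset.mem_coe.1 hk)
    change ν' (φ i) = N
    rw [hφ, (hmem i).1 hi]

theorem famSeries_add (hν : FiniteFibres ν) (v : ι → ℚ) :
    famSeries ν (fun i => w i + v i) = famSeries ν w + famSeries ν v := by
  ext N
  rcases eq_or_ne N 0 with rfl | hN
  · simp
  rw [ArithmeticFunction.add_apply, famSeries_apply_eq_sum hν hN, famSeries_apply_eq_sum hν hN,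
    famSeries_apply_eq_sum hν hN, Finset.sum_add_distrib]

theorem famSeries_const (ι : Type*) [Finite ι] (b : ℕ) (a : ℚ) :
    famSeries (fun _ : ι => b) (fun _ => a) = dirichletTerm (Nat.card ι * a) b := by
  have := Fintype.ofFinite ι
  ext N
  rcases eq_or_ne N 0 with rfl | hN
  · simp
  rw [famSeries_apply hN]
  change _ = if N = 0 then 0 else if N = b then _ else _
  rw [if_neg hN]
  split
  · rename_i h
    simp [h, finsum_eq_sum_of_fintype]
  · rename_i h
    rw [show {i : ι | b = N} = ∅ from Set.eq_empty_iff_forall_notMem.2 fun i hi => h hi.symm,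
      finsum_mem_empty]

theorem famSeries_self (f : ArithmeticFunction ℚ) : famSeries (fun k : ℕ => k) f = f := by
  ext N
  rcases eq_or_ne N 0 with rfl | hN
  · simp
  rw [famSeries_apply hN]
  simp

theorem finiteFibres_self : FiniteFibres fun k : ℕ => k := fun N _ => by simp

theorem FiniteFibres.pow (h : FiniteFibres ν) (n : ℕ) : FiniteFibres fun i => ν i ^ (n + 1) := by
  intro N hN
  rcases Set.eq_empty_or_nonempty {i | ν i ^ (n + 1) = N} with he | ⟨i₀, hi₀⟩
  · rw [he]
    exact Set.finite_empty
  · have hi₀' : ν i₀ ^ (n + 1) = N := hi₀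
    refine (h (ν i₀) fun h0 => hN ?_).subset fun i hi => ?_
    · rw [← hi₀', h0, zero_pow (Nat.succ_ne_zero n)]
    · exact Nat.pow_left_injective (Nat.succ_ne_zero n) (hi.trans hi₀'.symm)

theorem dirichletSubst_eq_famSeries (n : ℕ) (f : ArithmeticFunction ℚ) :
    dirichletSubst n f = famSeries (fun k : ℕ => k ^ (n + 1)) (fun k => (k : ℚ) ^ n * f k) := by
  ext N
  rcases eq_or_ne N 0 with rfl | hN
  · simp
  rw [famSeries_apply hN]
  change ∑ k ∈ N.divisors with k ^ (n + 1) = N, (k : ℚ) ^ n * f k = _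
  rw [← finsum_mem_coe_finset]
  refine finsum_mem_congr (Set.ext fun k => ?_) fun _ _ => rfl
  refine ⟨fun h => (Finset.mem_filter.1 h).2, fun h => ?_⟩
  have h' : k ^ (n + 1) = N := h
  exact Finset.mem_filter.2 ⟨Nat.mem_divisors.2 ⟨h' ▸ dvd_pow_self k (Nat.succ_ne_zero n), hN⟩, h⟩

theorem dirichletSubst_famSeries (hν : FiniteFibres ν) (n : ℕ) :
    dirichletSubst n (famSeries ν w) =
      famSeries (fun i => ν i ^ (n + 1)) (fun i => (ν i : ℚ) ^ n * w i) := by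
  rw [dirichletSubst_eq_famSeries]
  refine (famSeries_eq_of_fibres (hν.pow n) ν (fun _ => rfl) fun k hk => ?_).symm
  have hk0 : k ≠ 0 := fun h0 => hk (by rw [h0, zero_pow (Nat.succ_ne_zero n)])
  rw [famSeries_apply hk0, mul_finsum_mem]
  refine finsum_mem_congr rfl fun i hi => ?_
  have : ν i = k := hi
  rw [this]

theorem dirichletSubst_mul (n : ℕ) (f g : ArithmeticFunction ℚ) :
    dirichletSubst n (f * g) = dirichletSubst n f * dirichletSubst n g := by
  rw [dirichletSubst_eq_famSeries n f, dirichletSubst_eq_famSeries n g,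
    ← famSeries_mul (finiteFibres_self.pow n) (finiteFibres_self.pow n)]
  conv_lhs => rw [← famSeries_self f, ← famSeries_self g,
    ← famSeries_mul finiteFibres_self finiteFibres_self,
    dirichletSubst_famSeries (finiteFibres_self.mul finiteFibres_self)]
  congr 1
  · funext p
    rw [mul_pow]
  · funext p
    push_cast
    ring

theorem dirichletSubst_add (n : ℕ) (f g : ArithmeticFunction ℚ) :
    dirichletSubst n (f + g) = dirichletSubst n f + dirichletSubst n g := by
  ext N
  change ∑ k ∈ N.divisors with k ^ (n + 1) = N, (k : ℚ) ^ n * (f k + g k) =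
    ∑ k ∈ N.divisors with k ^ (n + 1) = N, (k : ℚ) ^ n * f k +
      ∑ k ∈ N.divisors with k ^ (n + 1) = N, (k : ℚ) ^ n * g k
  rw [← Finset.sum_add_distrib]
  exact Finset.sum_congr rfl fun k _ => mul_add _ _ _

theorem dirichletTerm_eq_famSeries (a : ℚ) (b : ℕ) :
    dirichletTerm a b = famSeries (fun _ : Unit => b) (fun _ => a) := by
  rw [famSeries_const, Nat.card_unique, Nat.cast_one, one_mul]

theorem dirichletTerm_mul (a c : ℚ) (b d : ℕ) :
    dirichletTerm a b * dirichletTerm c d = dirichletTerm (a * c) (b * d) := by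
  rw [dirichletTerm_eq_famSeries, dirichletTerm_eq_famSeries,
    ← famSeries_mul FiniteFibres.of_finite FiniteFibres.of_finite, famSeries_const]
  simp

theorem dirichletTerm_one_one : dirichletTerm 1 1 = 1 := by
  ext N
  change (if N = 0 then (0 : ℚ) else if N = 1 then 1 else 0) = _
  rw [ArithmeticFunction.one_apply]
  rcases eq_or_ne N 0 with rfl | hN
  · simp
  · rw [if_neg hN]

theorem dirichletTerm_pow (a : ℚ) (b k : ℕ) :
    dirichletTerm a b ^ k = dirichletTerm (a ^ k) (b ^ k) := by
  induction k with
  | zero => rw [pow_zero, pow_zero, pow_zero, dirichletTerm_one_one]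
  | succ k ih => rw [pow_succ, ih, dirichletTerm_mul, pow_succ, pow_succ]

theorem smul_dirichletTerm (c a : ℚ) (b : ℕ) : c • dirichletTerm a b = dirichletTerm (c * a) b := by
  ext N
  change c * (if N = 0 then (0 : ℚ) else if N = b then a else 0) =
    if N = 0 then 0 else if N = b then c * a else 0
  split_ifs <;> simp

theorem dirichletSubst_dirichletTerm (n : ℕ) (a : ℚ) (b : ℕ) :
    dirichletSubst n (dirichletTerm a b) = dirichletTerm ((b : ℚ) ^ n * a) (b ^ (n + 1)) := by
  rw [dirichletTerm_eq_famSeries, dirichletTerm_eq_famSeries,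
    dirichletSubst_famSeries FiniteFibres.of_finite]

/-- The substitution `s ↦ (n + 1) s - n` as a ring homomorphism. -/
noncomputable def dirichletSubstHom (n : ℕ) : ArithmeticFunction ℚ →+* ArithmeticFunction ℚ :=
  RingHom.mk' ⟨⟨dirichletSubst n, by
    rw [← dirichletTerm_one_one, dirichletSubst_dirichletTerm]
    simp⟩, dirichletSubst_mul n⟩ (dirichletSubst_add n)

theorem dirichletSubstHom_apply (n : ℕ) (f : ArithmeticFunction ℚ) :
    dirichletSubstHom n f = dirichletSubst n f := rfl

theorem ZetaDefined.finiteFibres {B : Type*} [Ring B] (hB : ZetaDefined B) :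
    FiniteFibres fun I : {I : Ideal B // Finite (B ⧸ I)} => Nat.card (B ⧸ I.1) := fun N hN =>
  (hB N hN).preimage Subtype.val_injective.injOn

theorem ZetaDefined.zetaSeries_eq {B : Type*} [Ring B] (hB : ZetaDefined B) :
    zetaSeries B = famSeries (fun I : {I : Ideal B // Finite (B ⧸ I)} => Nat.card (B ⧸ I.1))
      (fun _ => 1) := by
  ext N
  rcases eq_or_ne N 0 with rfl | hN
  · simp
  rw [famSeries_apply_eq_sum hB.finiteFibres hN, Finset.sum_const,
    ← Set.ncard_eq_toFinset_card _ (hB.finiteFibres N hN),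
    ← Set.ncard_image_of_injective _ Subtype.val_injective, nsmul_one]
  change (if N = 0 then (0 : ℚ) else _) = _
  rw [if_neg hN]
  congr 2
  ext I
  constructor
  · intro h
    have h' : Nat.card (B ⧸ I) = N := h
    exact ⟨⟨I, Nat.finite_of_card_ne_zero (h' ▸ hN)⟩, h', rfl⟩
  · rintro ⟨I', h, rfl⟩
    exact h

end FamSeries

/-! ### Infinite products -/

theorem mul_apply_eq_of_agree {N : ℕ} {f : ArithmeticFunction ℚ}
    (hf : ∀ k < N, f k = (1 : ArithmeticFunction ℚ) k) (g : ArithmeticFunction ℚ) {k : ℕ}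
    (hk : k < N) : (g * f) k = g k := by
  conv_rhs => rw [← mul_one g]
  rw [ArithmeticFunction.mul_apply, ArithmeticFunction.mul_apply]
  refine Finset.sum_congr rfl fun p hp => ?_
  rw [hf p.2 (lt_of_le_of_lt (Nat.divisor_le (Nat.snd_mem_divisors_of_mem_antidiagonal hp)) hk)]

/-- If `g = f 0 * ⋯ * f (n - 1) * h n`, where the coefficients of `f n` and `h n` with index less
than `2 ^ n` are those of `1`, then `g` is the infinite product of the `f n`. -/
theorem hasFormalProd_of_agree {f h : ℕ → ArithmeticFunction ℚ} {g : ArithmeticFunction ℚ}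
    (h0 : h 0 = g) (hstep : ∀ n, h n = f n * h (n + 1))
    (hf : ∀ n, ∀ k < 2 ^ n, f n k = (1 : ArithmeticFunction ℚ) k)
    (hh : ∀ n, ∀ k < 2 ^ n, h n k = (1 : ArithmeticFunction ℚ) k) : HasFormalProd f g := by
  intro k
  have hprod : ∀ n, g = (∏ i ∈ Finset.range n, f i) * h n := by
    intro n
    induction n with
    | zero => rw [Finset.prod_range_zero, one_mul, h0]
    | succ n ih => rw [ih, Finset.prod_range_succ, hstep n, mul_assoc]
  have hk : k < 2 ^ k := Nat.lt_two_pow_self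
  filter_upwards [Filter.eventually_ge_atTop (Finset.range k)] with s hs
  rw [hprod k, mul_apply_eq_of_agree (hh k) _ hk, ← Finset.prod_sdiff hs, mul_comm]
  have key : ∀ T : Finset ℕ, (∀ i ∈ T, k ≤ i) →
      ((∏ i ∈ Finset.range k, f i) * ∏ i ∈ T, f i) k = (∏ i ∈ Finset.range k, f i) k := by
    intro T
    induction T using Finset.induction_on with
    | empty => intro _; rw [Finset.prod_empty, mul_one]
    | insert i T hi ih =>
      intro hT
      rw [Finset.prod_insert hi, mul_comm (f i), ← mul_assoc,
        mul_apply_eq_of_agree (N := 2 ^ k) (fun l hl => hf i l (hl.trans_le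
          (Nat.pow_le_pow_right two_pos (hT i (Finset.mem_insert_self i T))))) _ hk]
      exact ih fun j hj => hT j (Finset.mem_insert_of_mem hj)
  refine key _ fun i hi => ?_
  simpa using (Finset.mem_sdiff.1 hi).2

theorem HasFormalProd.of_equiv {ι κ : Type*} (e : ι ≃ κ) {f : κ → ArithmeticFunction ℚ}
    {g : ArithmeticFunction ℚ} (h : HasFormalProd f g) : HasFormalProd (fun i => f (e i)) g := by
  intro k
  obtain ⟨s₀, hs₀⟩ := Filter.eventually_atTop.1 (h k)
  filter_upwards [Filter.eventually_ge_atTop (s₀.map e.symm.toEmbedding)] with s hs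
  rw [← hs₀ (s.map e.toEmbedding) fun j hj =>
    Finset.mem_map.2 ⟨e.symm j, hs (Finset.mem_map_of_mem _ hj), e.apply_symm_apply j⟩,
    Finset.prod_map]
  rfl

/-! ### Left ideals of finite index -/

/-- The submodules `𝔪ᵏ A + I` increase the index strictly until `𝔪ᵏ A ⊆ I`, by Nakayama's lemma. -/
theorem maximalIdeal_pow_smul_top_le_of_card (R : Type*) {A : Type*} [CommRing R] [IsLocalRing R]
    [IsNoetherianRing R] [Ring A] [Algebra R A] [Module.Finite R A] (I : Ideal A) (hI : Nat.card (A ⧸ I) ≠ 0) :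
    IsLocalRing.maximalIdeal R ^ Nat.card (A ⧸ I) • (⊤ : Submodule R A) ≤ idealSubmodule R I := by
  set N := idealSubmodule R I with hN
  set X : ℕ → Submodule R A := fun k => IsLocalRing.maximalIdeal R ^ k • (⊤ : Submodule R A)
    with hX
  have hNfin : N.toAddSubgroup.FiniteIndex := ⟨hI⟩
  have hfin : ∀ k, (X k ⊔ N).toAddSubgroup.FiniteIndex := fun k =>
    AddSubgroup.finiteIndex_of_le (H := N.toAddSubgroup) fun a ha => Submodule.mem_sup_right ha
  have key : ∀ k, X k ≤ N ∨ k < (X k ⊔ N).toAddSubgroup.index := by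
    intro k
    induction k with
    | zero => exact Or.inr (Nat.pos_of_ne_zero (hfin 0).index_ne_zero)
    | succ k ih =>
      have hsucc : X (k + 1) = IsLocalRing.maximalIdeal R • X k := by
        simp only [hX]
        rw [pow_succ', Submodule.mul_smul]
      have hle : X (k + 1) ≤ X k := hsucc ▸ Submodule.smul_le_right
      refine ih.elim (fun h => Or.inl (hle.trans h)) fun h => ?_
      by_cases hXk : X k ≤ X (k + 1) ⊔ N
      · refine Or.inl (hle.trans (Submodule.le_of_le_smul_of_le_jacobson_bot
          (IsNoetherian.noetherian _) (IsLocalRing.maximalIdeal_le_jacobson _) ?_))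
        rwa [← hsucc, sup_comm]
      · refine Or.inr (lt_of_le_of_lt h (AddSubgroup.index_strictAnti (lt_of_le_of_ne ?_ ?_)))
        · exact fun a ha => sup_le_sup_right hle N ha
        · exact fun heq => hXk fun a ha => heq.ge (Submodule.mem_sup_left ha)
  refine (key _).resolve_right (not_lt.2 ?_)
  exact AddSubgroup.index_antitone (H := N.toAddSubgroup) fun a ha => Submodule.mem_sup_right ha

theorem zetaDefined_of_finite (R A : Type*) [CommRing R] [IsLocalRing R] [IsNoetherianRing R]
    [Finite (IsLocalRing.ResidueField R)] [Ring A] [Algebra R A] [Module.Finite R A] :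
    ZetaDefined A := by
  intro n hn
  have := finite_quotient_maximalIdeal_pow_smul_top R A n
  let p := (IsLocalRing.maximalIdeal R ^ n • (⊤ : Submodule R A)).mkQ
  refine Set.Finite.of_finite_image (f := fun I : Ideal A => p '' (I : Set A)) (Set.toFinite _) ?_
  have key : ∀ I ∈ {I : Ideal A | Nat.card (A ⧸ I) = n}, ∀ a, a ∈ I ↔ p a ∈ p '' (I : Set A) := by
    intro I hI a
    have hI' : Nat.card (A ⧸ I) = n := hI
    refine ⟨fun h => ⟨a, h, rfl⟩, ?_⟩
    rintro ⟨b, hb, hab⟩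
    have h1 : b - a ∈ I := by
      have h2 := maximalIdeal_pow_smul_top_le_of_card R I (hI' ▸ hn)
      rw [hI'] at h2
      exact h2 ((Submodule.Quotient.eq _).1 hab)
    simpa using I.sub_mem hb h1
  intro I hI I' hI' h
  ext a
  rw [key I hI, key I' hI', show p '' (I : Set A) = p '' (I' : Set A) from h]

/-! ### Hey's formula -/

open scoped Matrix in
/-- If the rows of the form `u Y` take arbitrary values at the places in `T`, then the columns of
`Y` with indices in `T` are independent, and an invertible matrix moves them to the corresponding
columns of the unit matrix. -/
theorem exists_isUnit_mul_apply_eq_one {F : Type*} [Field F] {r : ℕ} (Y : Matrix (Fin r) (Fin r) F)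
    (T : Set (Fin r)) (h : ∀ v : Fin r → F, ∃ u : Fin r → F, ∀ k ∈ T, (u ᵥ* Y) k = v k) :
    ∃ U : Matrix (Fin r) (Fin r) F, IsUnit U ∧
      ∀ k ∈ T, ∀ a, (U * Y) a k = (1 : Matrix (Fin r) (Fin r) F) a k := by
  let W : Submodule F (Fin r → F) :=
    { carrier := {v | ∀ k ∉ T, v k = 0}
      add_mem' := fun {v v'} hv hv' k hk => by rw [Pi.add_apply, hv k hk, hv' k hk, add_zero]
      zero_mem' := fun _ _ => rfl
      smul_mem' := fun c v hv k hk => by rw [Pi.smul_apply, hv k hk, smul_zero] }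
  let f : W →ₗ[F] (Fin r → F) := Y.mulVecLin ∘ₗ W.subtype
  have hf : Function.Injective f := (injective_iff_map_eq_zero f).2 fun v hv => by
    have hv' : Y *ᵥ (v : Fin r → F) = 0 := hv
    refine Subtype.ext (funext fun k => ?_)
    by_cases hk : k ∈ T
    · obtain ⟨u, hu⟩ := h (Pi.single k 1)
      have h1 : (u ᵥ* Y) ⬝ᵥ (v : Fin r → F) = 0 := by
        rw [← Matrix.dotProduct_mulVec, hv', dotProduct_zero]
      rw [dotProduct, Finset.sum_eq_single k] at h1
      · rwa [hu k hk, Pi.single_eq_same, one_mul] at h1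
      · intro l _ hl
        by_cases hlT : l ∈ T
        · rw [hu l hlT, Pi.single_eq_of_ne hl, zero_mul]
        · rw [v.2 l hlT, mul_zero]
      · exact fun hk' => absurd (Finset.mem_univ k) hk'
    · exact v.2 k hk
  obtain ⟨g, hg⟩ := Submodule.exists_linearEquiv_restrict_eq (LinearEquiv.ofInjective f hf)
  refine ⟨LinearMap.toMatrix' (g.symm : (Fin r → F) →ₗ[F] (Fin r → F)), ?_, fun k hk a => ?_⟩
  · rw [← Matrix.isUnit_toLin'_iff, Matrix.toLin'_toMatrix']
    exact (LinearMap.isUnit_iff_ker_eq_bot _).2 (LinearEquiv.ker g.symm)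
  · have hkW : (Pi.single k 1 : Fin r → F) ∈ W := fun l hl =>
      Pi.single_eq_of_ne (fun hlk => hl (by rwa [hlk])) _
    have h1 : Y *ᵥ (Pi.single k 1 : Fin r → F) = g (Pi.single k 1) := hg ⟨_, hkW⟩
    have h2 : (LinearMap.toMatrix' (g.symm : (Fin r → F) →ₗ[F] (Fin r → F)) * Y) *ᵥ
        Pi.single k 1 = Pi.single k 1 := by
      rw [← Matrix.mulVec_mulVec, h1, LinearMap.toMatrix'_mulVec]
      exact g.symm_apply_apply _
    have h3 := congrFun h2 a
    rw [Matrix.mulVec_single_one] at h3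
    rw [Matrix.one_apply]
    refine h3.trans ?_
    rw [Pi.single_apply]

section RowSpace

variable {F B : Type*} [Field F] [Ring B] {m r : ℕ} (ψ : B →+* (Fin m → Matrix (Fin r) (Fin r) F))

/-- The `i`-th row space of a left ideal `I`: under Morita equivalence it corresponds to the image
of `I` in the `i`-th matrix ring. -/
def rowSpace (hψ : Function.Surjective ψ) (I : Ideal B) (i : Fin m) : Submodule F (Fin r → F) where
  carrier := {u | ∃ b ∈ I, ∀ a, ψ b i a = u}
  add_mem' := by
    rintro u v ⟨b, hb, hbu⟩ ⟨c, hc, hcv⟩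
    exact ⟨b + c, I.add_mem hb hc, fun a => by
      rw [map_add, Pi.add_apply, ← hbu a, ← hcv a]; rfl⟩
  zero_mem' := ⟨0, I.zero_mem, fun a => by rw [map_zero]; rfl⟩
  smul_mem' := by
    rintro c u ⟨b, hb, hbu⟩
    obtain ⟨d, hd⟩ := hψ (algebraMap F _ c)
    refine ⟨d * b, I.mul_mem_left d hb, fun a => ?_⟩
    rw [map_mul, hd, ← Algebra.smul_def, Pi.smul_apply, ← hbu a]
    rfl

/-- The rows of the image of `I` take arbitrary values at the places of `S`. -/
def IsFullOn (hψ : Function.Surjective ψ) (I : Ideal B) (S : Finset (Fin m × Fin r)) : Prop :=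
  ∀ i (v : Fin r → F), ∃ u ∈ rowSpace ψ hψ I i, ∀ k, (i, k) ∈ S → u k = v k

variable {ψ} (hψ : Function.Surjective ψ)

theorem row_mem_rowSpace {I : Ideal B} {b : B} (hb : b ∈ I) (i : Fin m) (a : Fin r) :
    ψ b i a ∈ rowSpace ψ hψ I i := by
  obtain ⟨c, hc⟩ := hψ (Pi.single i (Matrix.of fun _ k => if k = a then 1 else 0))
  refine ⟨c * b, I.mul_mem_left c hb, fun a' => ?_⟩
  rw [map_mul, hc, Pi.mul_apply, Pi.single_eq_same]
  funext k
  simp [Matrix.mul_apply]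

theorem IsFullOn.subset {I : Ideal B} {S S' : Finset (Fin m × Fin r)} (h : IsFullOn ψ hψ I S)
    (hS : S' ⊆ S) : IsFullOn ψ hψ I S' := fun i v =>
  let ⟨u, hu, huv⟩ := h i v
  ⟨u, hu, fun k hk => huv k (hS hk)⟩

theorem isFullOn_empty (I : Ideal B) : IsFullOn ψ hψ I ∅ := fun _ _ =>
  ⟨0, zero_mem _, fun _ hk => absurd hk (Finset.notMem_empty _)⟩

theorem isFullOn_univ_iff (hker : ∀ b, ψ b = 0 ↔ b ∈ Ring.jacobson B) (I : Ideal B) :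
    IsFullOn ψ hψ I Finset.univ ↔ I = ⊤ := by
  constructor
  · intro h
    choose u hu huv using fun (i : Fin m) (a : Fin r) => h i (Pi.single a 1)
    choose b hb hbu using hu
    choose c hc using fun (i : Fin m) (a : Fin r) => hψ (Pi.single i (Matrix.single a a 1))
    set d := ∑ i, ∑ a, c i a * b i a with hd
    have hdI : d ∈ I := sum_mem fun i _ => sum_mem fun a _ => I.mul_mem_left _ (hb i a)
    have hd1 : ψ d = 1 := by
      rw [hd, map_sum, ← Finset.univ_sum_single (1 : Fin m → Matrix (Fin r) (Fin r) F)]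
      refine Finset.sum_congr rfl fun i _ => ?_
      rw [map_sum, Pi.one_apply]
      have h1 : ∀ a, ψ (c i a * b i a) = Pi.single i (Matrix.single a a 1) := by
        intro a
        rw [map_mul, hc, ← Pi.single_mul_left]
        congr 1
        ext k l
        rcases eq_or_ne a k with rfl | hk
        · rw [Matrix.single_mul_apply_same, one_mul, hbu i a, huv i a l (Finset.mem_univ _),
            Pi.single_apply, Matrix.single_apply]
          simp [eq_comm]
        · rw [Matrix.single_mul_apply_of_ne _ _ _ _ _ hk.symm, Matrix.single_apply_of_row_ne hk]
      simp only [h1]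
      have h2 : ∑ a, Matrix.single a a 1 = (1 : Matrix (Fin r) (Fin r) F) := by
        rw [← Matrix.diagonal_one, ← Matrix.sum_single_eq_diagonal]
      rw [← h2]
      exact (map_sum (AddMonoidHom.single (fun _ : Fin m => Matrix (Fin r) (Fin r) F) i) _ _).symm
    by_contra hI
    obtain ⟨P, hP, hIP⟩ := Ideal.exists_le_maximal I hI
    refine (Ideal.ne_top_iff_one P).1 hP.ne_top ?_
    have h1 : d - 1 ∈ P := Ring.jacobson_le_of_isMaximal P
      ((hker _).1 (by rw [map_sub, hd1, map_one, sub_self]))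
    simpa using P.sub_mem (hIP hdI) h1
  · rintro rfl i v
    obtain ⟨b, hb⟩ := hψ (Pi.single i (Matrix.of fun _ => v))
    exact ⟨v, ⟨b, Submodule.mem_top, fun a => by rw [hb, Pi.single_eq_same]; rfl⟩, fun _ _ => rfl⟩

open scoped Matrix in
theorem mem_rowSpace_mulRightIdeal {N : Ideal B} {y : B} {i : Fin m} {u : Fin r → F} :
    u ∈ rowSpace ψ hψ (mulRightIdeal N y) i ↔ ∃ v ∈ rowSpace ψ hψ N i, v ᵥ* ψ y i = u := by
  have hrow : ∀ a k, ψ (a * y) i k = ψ a i k ᵥ* ψ y i := fun a k => by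
    rw [map_mul, Pi.mul_apply, Matrix.mul_apply_eq_vecMul]
  constructor
  · rintro ⟨b, hb, hbu⟩
    obtain ⟨a, ha, rfl⟩ := mem_mulRightIdeal.1 hb
    rcases isEmpty_or_nonempty (Fin r) with hr | ⟨⟨k⟩⟩
    · exact ⟨0, zero_mem _, Subsingleton.elim _ _⟩
    · exact ⟨_, row_mem_rowSpace hψ ha i k, by rw [← hrow, hbu]⟩
  · rintro ⟨v, ⟨a, ha, hav⟩, rfl⟩
    exact ⟨a * y, mem_mulRightIdeal.2 ⟨a, ha, rfl⟩, fun k => by rw [hrow, hav]⟩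

/-- The generator of a principal left ideal can be adjusted by a unit. -/
theorem exists_isUnit_mul_map_eq_one (hker : ∀ b, ψ b = 0 ↔ b ∈ Ring.jacobson B) {y : B}
    {S : Finset (Fin m × Fin r)} (h : IsFullOn ψ hψ (Ideal.span {y}) S) :
    ∃ c, IsUnit c ∧ ∀ i k, (i, k) ∈ S → ∀ a,
      ψ (c * y) i a k = (1 : Matrix (Fin r) (Fin r) F) a k := by
  have hspan : mulRightIdeal ⊤ y = Ideal.span {y} := by
    ext b
    rw [mem_mulRightIdeal, Ideal.mem_span_singleton']
    simp
  choose U hU hUY using fun i => exists_isUnit_mul_apply_eq_one (ψ y i) {k | (i, k) ∈ S} fun v => by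
    obtain ⟨u, hu, huv⟩ := h i v
    rw [← hspan] at hu
    obtain ⟨w, -, rfl⟩ := (mem_rowSpace_mulRightIdeal hψ).1 hu
    exact ⟨w, huv⟩
  obtain ⟨c, hc⟩ := hψ U
  obtain ⟨V, hV⟩ := Pi.isUnit_iff.2 hU
  obtain ⟨d, hd⟩ := hψ ↑V⁻¹
  refine ⟨c, isUnit_of_isUnit_mod_jacobson (c := d) (d := d) ?_ ?_, fun i k hk a => ?_⟩
  · rw [← hker, map_sub, map_mul, hc, hd, ← hV, Units.inv_mul, map_one, sub_self]
  · rw [← hker, map_sub, map_mul, hc, hd, ← hV, Units.mul_inv, map_one, sub_self]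
  · rw [map_mul, hc]
    exact hUY i k hk a

theorem isFullOn_mulRightIdeal_iff {N : Ideal B} {y : B} {S : Finset (Fin m × Fin r)}
    (hy : ∀ i k, (i, k) ∈ S → ∀ a, ψ y i a k = (1 : Matrix (Fin r) (Fin r) F) a k) :
    IsFullOn ψ hψ (mulRightIdeal N y) S ↔ IsFullOn ψ hψ N S := by
  have key : ∀ i k, (i, k) ∈ S → ∀ v : Fin r → F, (Matrix.vecMul v (ψ y i)) k = v k := by
    intro i k hk v
    have h1 : ∀ a, v a * ψ y i a k = v a * (1 : Matrix (Fin r) (Fin r) F) a k := fun a => by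
      rw [hy i k hk]
    simp only [Matrix.vecMul, dotProduct, h1]
    simp [Matrix.one_apply]
  constructor
  · intro h i v
    obtain ⟨u, hu, huv⟩ := h i v
    obtain ⟨w, hw, rfl⟩ := (mem_rowSpace_mulRightIdeal hψ).1 hu
    exact ⟨w, hw, fun k hk => by rw [← huv k hk, key i k hk]⟩
  · intro h i v
    obtain ⟨w, hw, hwv⟩ := h i v
    exact ⟨_, (mem_rowSpace_mulRightIdeal hψ).2 ⟨w, hw, rfl⟩, fun k hk => by
      rw [key i k hk, hwv k hk]⟩

/-! ### The left ideals on which a given column depends on the previous ones -/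

/-- The linear form `u ↦ u j - ∑ θ k * u k`. -/
def columnForm (S : Finset (Fin m × Fin r)) (i : Fin m) (j : Fin r)
    (θ : {k // (i, k) ∈ S} → F) : (Fin r → F) →ₗ[F] F :=
  LinearMap.proj j - ∑ k, θ k • LinearMap.proj k.1

theorem columnForm_apply (S : Finset (Fin m × Fin r)) (i : Fin m) (j : Fin r)
    (θ : {k // (i, k) ∈ S} → F) (u : Fin r → F) :
    columnForm S i j θ u = u j - ∑ k, θ k * u k.1 := by
  simp [columnForm]

variable (ψ)

/-- The left ideal of the elements whose image has in its `i`-th block the `j`-th column equal to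
the linear combination with coefficients `θ` of the columns in `S`. -/
def columnIdeal (S : Finset (Fin m × Fin r)) (i : Fin m) (j : Fin r)
    (θ : {k // (i, k) ∈ S} → F) : Ideal B where
  carrier := {b | ∀ a, columnForm S i j θ (ψ b i a) = 0}
  add_mem' := fun {b c} hb hc a => by
    rw [map_add, Pi.add_apply]
    change columnForm S i j θ (ψ b i a + ψ c i a) = 0
    rw [map_add, hb, hc, add_zero]
  zero_mem' := fun a => by
    rw [map_zero]
    exact map_zero _
  smul_mem' := fun c b hb a => by
    have h1 : ψ (c • b) i a = ∑ l, ψ c i a l • ψ b i l := by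
      funext k
      rw [smul_eq_mul, map_mul, Pi.mul_apply, Matrix.mul_apply]
      simp
    rw [h1, map_sum]
    refine Finset.sum_eq_zero fun l _ => ?_
    rw [map_smul, hb, smul_zero]

variable {ψ}
variable {S : Finset (Fin m × Fin r)} {i : Fin m} {j : Fin r}

theorem le_columnIdeal_iff {θ : {k // (i, k) ∈ S} → F} {I : Ideal B} :
    I ≤ columnIdeal ψ S i j θ ↔ ∀ u ∈ rowSpace ψ hψ I i, columnForm S i j θ u = 0 := by
  constructor
  · rintro h u ⟨b, hb, hbu⟩
    rw [← hbu j]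
    exact h hb j
  · exact fun h b hb a => h _ (row_mem_rowSpace hψ hb i a)

theorem card_quotient_columnIdeal (hψ : Function.Surjective ψ) (θ : {k // (i, k) ∈ S} → F) (hj : (i, j) ∉ S) :
    Nat.card (B ⧸ columnIdeal ψ S i j θ) = Nat.card F ^ r := by
  let g : B →+ (Fin r → F) :=
    AddMonoidHom.mk' (fun b a => columnForm S i j θ (ψ b i a)) fun b c => by
      funext a
      rw [map_add]
      exact map_add (columnForm S i j θ) (ψ b i a) (ψ c i a)
  have hg : Function.Surjective g := by
    intro t
    obtain ⟨b, hb⟩ := hψ (Pi.single i (Matrix.of fun a k => if k = j then t a else 0))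
    refine ⟨b, funext fun a => ?_⟩
    change columnForm S i j θ (ψ b i a) = t a
    rw [columnForm_apply, hb, Pi.single_eq_same, Matrix.of_apply, if_pos rfl, sub_eq_self]
    refine Finset.sum_eq_zero fun k _ => ?_
    rw [Matrix.of_apply, if_neg fun hk => hj (by rw [← hk]; exact k.2), mul_zero]
  have h1 : (columnIdeal ψ S i j θ).toAddSubgroup = g.ker := by
    ext b
    exact ⟨fun h => funext h, fun h a => congrFun h a⟩
  have h2 := AddSubgroup.index_ker g
  rw [← h1, AddMonoidHom.range_eq_top.2 hg, Nat.card_congr AddSubgroup.topEquiv.toEquiv] at h2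
  refine h2.trans ?_
  rw [Nat.card_fun, Nat.card_fin]

theorem isFullOn_columnIdeal (θ : {k // (i, k) ∈ S} → F) (hj : (i, j) ∉ S) :
    IsFullOn ψ hψ (columnIdeal ψ S i j θ) S := by
  classical
  intro i' v
  rcases eq_or_ne i i' with rfl | hi
  · let u := Function.update v j (∑ k, θ k * v k.1)
    have huv : ∀ k, (i, k) ∈ S → u k = v k := fun k hk =>
      Function.update_of_ne (fun hkj => hj (by rwa [← hkj])) _ _
    obtain ⟨b, hb⟩ := hψ (Pi.single i (Matrix.of fun _ => u))
    refine ⟨u, ⟨b, fun a => ?_, fun a => by rw [hb, Pi.single_eq_same]; rfl⟩, huv⟩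
    rw [hb, Pi.single_eq_same]
    change columnForm S i j θ u = 0
    rw [columnForm_apply, sub_eq_zero]
    refine (Function.update_self ..).trans ?_
    exact Finset.sum_congr rfl fun k _ => by rw [huv k.1 k.2]
  · obtain ⟨b, hb⟩ := hψ (Pi.single i' (Matrix.of fun _ => v))
    refine ⟨v, ⟨b, fun a => ?_, fun a => by rw [hb, Pi.single_eq_same]; rfl⟩, fun _ _ => rfl⟩
    rw [hb, Pi.single_eq_of_ne hi]
    exact map_zero _

theorem not_isFullOn_insert_of_le {θ : {k // (i, k) ∈ S} → F} (hj : (i, j) ∉ S) {I : Ideal B}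
    (hI : I ≤ columnIdeal ψ S i j θ) : ¬ IsFullOn ψ hψ I (insert (i, j) S) := by
  intro h
  obtain ⟨u, hu, huv⟩ := h i (Pi.single j 1)
  have h1 := (le_columnIdeal_iff hψ).1 hI u hu
  rw [columnForm_apply, huv j (Finset.mem_insert_self _ _), Pi.single_eq_same,
    Finset.sum_eq_zero, sub_zero] at h1
  · exact one_ne_zero h1
  · intro k _
    rw [huv k.1 (Finset.mem_insert_of_mem k.2),
      Pi.single_eq_of_ne (fun hk => hj (by rw [← hk]; exact k.2)), mul_zero]

/-- If `I` is full on `S` but not on `S ∪ {(i, j)}`, then the `j`-th column of the `i`-th block is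
determined by the columns in `S`, so `I` lies in a column ideal. -/
theorem exists_le_columnIdeal (hj : (i, j) ∉ S) {I : Ideal B} (h : IsFullOn ψ hψ I S)
    (h' : ¬ IsFullOn ψ hψ I (insert (i, j) S)) : ∃ θ, I ≤ columnIdeal ψ S i j θ := by
  have hzero : ∀ u ∈ rowSpace ψ hψ I i, (∀ k, (i, k) ∈ S → u k = 0) → u j = 0 := by
    intro u hu huS
    by_contra huj
    refine h' fun i' v => ?_
    obtain ⟨w, hw, hwv⟩ := h i' v
    rcases eq_or_ne i i' with rfl | hi
    · refine ⟨w + ((v j - w j) / u j) • u, add_mem hw (Submodule.smul_mem _ _ hu), fun k hk => ?_⟩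
      rcases Finset.mem_insert.1 hk with hk | hk
      · obtain rfl : k = j := congrArg Prod.snd hk
        rw [Pi.add_apply, Pi.smul_apply, smul_eq_mul, div_mul_cancel₀ _ huj, add_sub_cancel]
      · rw [Pi.add_apply, Pi.smul_apply, huS k hk, smul_zero, add_zero, hwv k hk]
    · refine ⟨w, hw, fun k hk => hwv k ((Finset.mem_insert.1 hk).resolve_left fun hk => hi ?_)⟩
      exact (congrArg Prod.fst hk).symm
  classical
  choose e he hev using fun k : {k // (i, k) ∈ S} => h i (Pi.single k.1 1)
  refine ⟨fun k => e k j, (le_columnIdeal_iff hψ).2 fun u hu => ?_⟩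
  have h1 := hzero (u - ∑ k : {k // (i, k) ∈ S}, u k.1 • e k)
    (sub_mem hu (sum_mem fun k _ => Submodule.smul_mem _ _ (he k))) fun k hk => by
      rw [Pi.sub_apply, Finset.sum_apply, Finset.sum_eq_single ⟨k, hk⟩, Pi.smul_apply,
        hev _ k hk, Pi.single_eq_same, smul_eq_mul, mul_one, sub_self]
      · intro l _ hl
        rw [Pi.smul_apply, hev l k hk, Pi.single_eq_of_ne, smul_zero]
        exact fun hkl => hl (Subtype.ext hkl.symm)
      · exact fun hk' => absurd (Finset.mem_univ _) hk'
  rw [columnForm_apply, ← h1, Pi.sub_apply, Finset.sum_apply]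
  congr 1
  exact Finset.sum_congr rfl fun k _ => mul_comm _ _

/-- The column ideal containing a left ideal that is full on `S` is unique. -/
theorem eq_of_le_columnIdeal {θ θ' : {k // (i, k) ∈ S} → F} {I : Ideal B} (h : IsFullOn ψ hψ I S)
    (hI : I ≤ columnIdeal ψ S i j θ) (hI' : I ≤ columnIdeal ψ S i j θ') : θ = θ' := by
  classical
  funext k
  obtain ⟨u, hu, huv⟩ := h i (Pi.single k.1 1)
  have key : ∀ θ : {k // (i, k) ∈ S} → F, ∑ l, θ l * u l.1 = θ k := by
    intro θ
    rw [Finset.sum_eq_single k]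
    · rw [huv k.1 k.2, Pi.single_eq_same, mul_one]
    · intro l _ hl
      rw [huv l.1 l.2, Pi.single_eq_of_ne (fun hkl => hl (Subtype.ext hkl)), mul_zero]
    · exact fun hk' => absurd (Finset.mem_univ _) hk'
  have h1 := (le_columnIdeal_iff hψ).1 hI u hu
  have h2 := (le_columnIdeal_iff hψ).1 hI' u hu
  rw [columnForm_apply, key, sub_eq_zero] at h1 h2
  rw [← h1, ← h2]

end RowSpace

section Hey

variable {F B : Type*} [Field F] [Ring B] {m r : ℕ}
  {ψ : B →+* (Fin m → Matrix (Fin r) (Fin r) F)} (hψ : Function.Surjective ψ)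

open Classical in
/-- The part of the zeta function of `B` that is contributed by the left ideals which are full
on `S`. -/
noncomputable def fullSeries (S : Finset (Fin m × Fin r)) : ArithmeticFunction ℚ :=
  famSeries (fun I : {I : Ideal B // Finite (B ⧸ I)} => Nat.card (B ⧸ I.1))
    fun I => if IsFullOn ψ hψ I.1 S then 1 else 0

theorem fullSeries_empty (hB : ZetaDefined B) : fullSeries hψ ∅ = zetaSeries B := by
  rw [fullSeries, hB.zetaSeries_eq]
  congr 1
  funext I
  rw [if_pos (isFullOn_empty hψ I.1)]

theorem fullSeries_univ (hker : ∀ b, ψ b = 0 ↔ b ∈ Ring.jacobson B) :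
    fullSeries hψ Finset.univ = 1 := by
  classical
  have hfin : Finite (B ⧸ (⊤ : Ideal B)) := inferInstance
  rw [← dirichletTerm_one_one, dirichletTerm_eq_famSeries, fullSeries]
  refine (famSeries_eq_of_fibres FiniteFibres.of_finite (fun _ => ⟨⊤, hfin⟩) (fun _ => ?_)
    fun I _ => ?_).symm
  · exact Nat.card_unique
  · by_cases hI : I.1 = ⊤
    · rw [if_pos ((isFullOn_univ_iff hψ hker I.1).2 hI)]
      have hI' : (⟨⊤, hfin⟩ : {I : Ideal B // Finite (B ⧸ I)}) = I := Subtype.ext hI.symm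
      simp only [hI', Set.ofPred_true, finsum_mem_univ]
      rw [finsum_eq_sum_of_fintype]
      simp
    · rw [if_neg fun h => hI ((isFullOn_univ_iff hψ hker I.1).1 h)]
      refine finsum_mem_of_eqOn_zero fun x hx => absurd ?_ hI
      have hx' : (⟨⊤, hfin⟩ : {I : Ideal B // Finite (B ⧸ I)}) = I := hx
      rw [← hx']

/-- If `I` is full on `S` but not on `S ∪ {(i, j)}`, then the `j`-th column depends on the columns
in `S` with unique coefficients `θ`. This means `I = I' y` for the generator `y` of an ideal of
index `qʳ` determined by `θ`; here `y` can be chosen such that `I'` is full on `S` exactly if `I`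
is. -/
theorem fullSeries_eq_insert_add [Finite F] (H : IsHomogeneousRing B) (hB : ZetaDefined B)
    (hker : ∀ b, ψ b = 0 ↔ b ∈ Ring.jacobson B) {S : Finset (Fin m × Fin r)} {i : Fin m} {j : Fin r}
    (hj : (i, j) ∉ S) :
    fullSeries hψ S = fullSeries hψ (insert (i, j) S) +
      dirichletTerm ((Nat.card F : ℚ) ^ Nat.card {k // (i, k) ∈ S}) (Nat.card F ^ r) *
        fullSeries hψ S := by
  classical
  have hgen : ∀ θ : {k // (i, k) ∈ S} → F, ∃ y, columnIdeal ψ S i j θ = Ideal.span {y} ∧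
      (∀ b, b * y = 0 → b = 0) ∧
      ∀ i' k, (i', k) ∈ S → ∀ a, ψ y i' a k = (1 : Matrix (Fin r) (Fin r) F) a k := by
    intro θ
    have hcard := card_quotient_columnIdeal hψ θ hj
    have hfin : Finite (B ⧸ columnIdeal ψ S i j θ) := Nat.finite_of_card_ne_zero <| by
      rw [hcard]
      exact pow_ne_zero _ Nat.card_pos.ne'
    obtain ⟨y, hy, hreg⟩ := H _ hfin
    obtain ⟨c, hc, hcy⟩ := exists_isUnit_mul_map_eq_one hψ hker
      (hy ▸ isFullOn_columnIdeal hψ θ hj)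
    refine ⟨c * y, ?_, fun b hb => ?_, hcy⟩
    · obtain ⟨d, rfl⟩ := hc
      rw [hy]
      ext b
      rw [Ideal.mem_span_singleton', Ideal.mem_span_singleton']
      constructor
      · rintro ⟨a, rfl⟩
        exact ⟨a * ↑d⁻¹, by rw [mul_assoc, Units.inv_mul_cancel_left]⟩
      · rintro ⟨a, rfl⟩
        exact ⟨a * d, mul_assoc _ _ _⟩
    · exact hc.mul_left_eq_zero.1 (hreg _ (by rw [mul_assoc, hb]))
  choose y hy hreg hyS using hgen
  have hcardy : ∀ θ (N : Ideal B), Nat.card (B ⧸ mulRightIdeal N (y θ)) =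
      Nat.card F ^ r * Nat.card (B ⧸ N) := fun θ N => by
    rw [card_quotient_mulRightIdeal (hreg θ), ← hy, card_quotient_columnIdeal hψ θ hj, mul_comm]
  have hle : ∀ θ (N : Ideal B), mulRightIdeal N (y θ) ≤ columnIdeal ψ S i j θ := fun θ N b hb => by
    obtain ⟨a, -, rfl⟩ := mem_mulRightIdeal.1 hb
    rw [hy]
    exact Ideal.mem_span_singleton'.2 ⟨a, rfl⟩
  let φ : ({k // (i, k) ∈ S} → F) × {I : Ideal B // Finite (B ⧸ I)} →
      {I : Ideal B // Finite (B ⧸ I)} := fun p => ⟨mulRightIdeal p.2.1 (y p.1), by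
    have := p.2.2
    refine Nat.finite_of_card_ne_zero ?_
    rw [hcardy]
    exact mul_ne_zero (pow_ne_zero _ Nat.card_pos.ne') Nat.card_pos.ne'⟩
  have hφfull : ∀ p, IsFullOn ψ hψ (φ p).1 S ↔ IsFullOn ψ hψ p.2.1 S := fun p =>
    isFullOn_mulRightIdeal_iff hψ (hyS p.1)
  have h1 := famSeries_mul (w := fun _ : {k // (i, k) ∈ S} → F => 1)
    (w' := fun I : {I : Ideal B // Finite (B ⧸ I)} => if IsFullOn ψ hψ I.1 S then (1 : ℚ) else 0)
    (FiniteFibres.of_finite (ν := fun _ : {k // (i, k) ∈ S} → F => Nat.card F ^ r)) hB.finiteFibres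
  have h2 := famSeries_eq_of_fibres
    (ν' := fun I : {I : Ideal B // Finite (B ⧸ I)} => Nat.card (B ⧸ I.1))
    (w := fun p => 1 * if IsFullOn ψ hψ p.2.1 S then (1 : ℚ) else 0)
    (w' := fun I => if IsFullOn ψ hψ I.1 S ∧ ¬ IsFullOn ψ hψ I.1 (insert (i, j) S) then 1 else 0)
    ((FiniteFibres.of_finite (ν := fun _ : {k // (i, k) ∈ S} → F => Nat.card F ^ r)).mul
      hB.finiteFibres) φ (fun p => hcardy p.1 p.2.1) fun I _ => by
      split
      · rename_i hI
        obtain ⟨θ, hθ⟩ := exists_le_columnIdeal hψ hj hI.1 hI.2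
        rw [hy] at hθ
        obtain ⟨N, hN⟩ := exists_mulRightIdeal_eq hθ
        have hNfin : Finite (B ⧸ N) := Nat.finite_of_card_ne_zero fun h0 => by
          have h3 := hcardy θ N
          rw [h0, mul_zero, hN] at h3
          have := I.2
          exact Nat.card_pos.ne' h3
        have hφN : φ (θ, ⟨N, hNfin⟩) = I := Subtype.ext hN
        have hset : {p | φ p = I} = {(θ, ⟨N, hNfin⟩)} := by
          ext p
          refine ⟨fun hp => ?_, fun hp => by rw [Set.mem_singleton_iff.1 hp]; exact hφN⟩
          have hp' : φ p = I := hp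
          have hpI : mulRightIdeal p.2.1 (y p.1) = I.1 := congrArg Subtype.val hp'
          have hθ' : p.1 = θ := eq_of_le_columnIdeal hψ hI.1 (hpI ▸ hle p.1 p.2.1)
            (hy θ ▸ hθ)
          refine Prod.ext hθ' (Subtype.ext (mulRightIdeal_injective (hreg θ) ?_))
          change mulRightIdeal p.2.1 (y θ) = mulRightIdeal N (y θ)
          rw [← hθ', hpI, hθ', hN]
        rw [hset, finsum_mem_singleton, one_mul, if_pos ((hφfull _).1 (hφN ▸ hI.1))]
      · rename_i hI
        refine finsum_mem_of_eqOn_zero fun p hp => ?_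
        have hp' : φ p = I := hp
        change 1 * (if _ then (1 : ℚ) else 0) = 0
        rw [if_neg, mul_zero]
        intro hfull
        refine hI ⟨hp' ▸ (hφfull p).2 hfull, ?_⟩
        rw [← hp']
        exact not_isFullOn_insert_of_le hψ hj (hle p.1 p.2.1)
  rw [famSeries_const, mul_one, Nat.card_fun, Nat.cast_pow] at h1
  conv_rhs => rw [fullSeries, fullSeries]
  rw [← h1, h2, ← famSeries_add hB.finiteFibres, fullSeries]
  congr 1
  funext I
  by_cases h3 : IsFullOn ψ hψ I.1 (insert (i, j) S)
  · rw [if_pos h3, if_pos (h3.subset hψ (Finset.subset_insert _ _)), if_neg fun h => h.2 h3,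
      add_zero]
  · by_cases h4 : IsFullOn ψ hψ I.1 S
    · rw [if_pos h4, if_neg h3, if_pos ⟨h4, h3⟩, zero_add]
    · rw [if_neg h4, if_neg h3, if_neg fun h => h4 h.1, add_zero]

/-- Hey's formula for a ring whose left ideals of finite index are free of rank one. -/
theorem zetaSeries_mul_prod_eq_one [Finite F] (H : IsHomogeneousRing B) (hB : ZetaDefined B)
    (hψ : Function.Surjective ψ) (hker : ∀ b, ψ b = 0 ↔ b ∈ Ring.jacobson B) :
    zetaSeries B * ∏ j ∈ Finset.range r,
      (1 - dirichletTerm ((Nat.card F : ℚ) ^ j) (Nat.card F ^ r)) ^ m = 1 := by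
  classical
  set T : ℕ → ArithmeticFunction ℚ := fun c =>
    1 - dirichletTerm ((Nat.card F : ℚ) ^ c) (Nat.card F ^ r) with hT
  let c : Finset (Fin m × Fin r) → Fin m → ℕ := fun S i => Nat.card {k // (i, k) ∈ S}
  have key : ∀ S : Finset (Fin m × Fin r),
      zetaSeries B * ∏ i, ∏ k ∈ Finset.range (c S i), T k = fullSeries hψ S := by
    intro S
    induction S using Finset.induction_on with
    | empty => simp [c, fullSeries_empty hψ hB]
    | insert p S hp ih =>
      obtain ⟨i, j⟩ := p
      have h1 : c (insert (i, j) S) i = c S i + 1 := by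
        simp only [c, Nat.card_eq_fintype_card, Fintype.card_subtype]
        rw [← Finset.card_insert_of_notMem (a := j) (by simpa using hp)]
        congr 1
        ext k
        simp
      have h2 : ∀ i', i' ≠ i → c (insert (i, j) S) i' = c S i' := by
        intro i' hi'
        simp only [c, Nat.card_eq_fintype_card, Fintype.card_subtype]
        congr 1
        ext k
        simp [hi']
      have h3 : ∏ i', ∏ k ∈ Finset.range (c (insert (i, j) S) i'), T k =
          (∏ i', ∏ k ∈ Finset.range (c S i'), T k) * T (c S i) := by
        rw [← Finset.mul_prod_erase Finset.univ _ (Finset.mem_univ i), h1, Finset.prod_range_succ,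
          ← Finset.mul_prod_erase Finset.univ (fun i' => ∏ k ∈ Finset.range (c S i'), T k)
            (Finset.mem_univ i), mul_right_comm]
        congr 2
        exact Finset.prod_congr rfl fun i' hi' => by rw [h2 i' (Finset.ne_of_mem_erase hi')]
      rw [h3, ← mul_assoc, ih]
      have h4 := fullSeries_eq_insert_add hψ H hB hker hp
      simp only [hT]
      rw [mul_sub, mul_one, sub_eq_iff_eq_add, mul_comm]
      exact h4
  have h1 := key Finset.univ
  rw [fullSeries_univ hψ hker] at h1
  have h2 : ∀ i, c Finset.univ i = r := fun i => by simp [c]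
  simp only [h2, Finset.prod_const, Finset.card_univ, Fintype.card_fin] at h1
  rw [Finset.prod_pow]
  exact h1

end Hey

/-! ### Left ideals of an order and of its slice -/

section Slice

variable {A B : Type*} [Ring A] [Ring B] {z : A} {τ : A ≃+* A} {π : A →+* B}

/-- The left ideal of the `a` with `z a ∈ I`, where `z` is normal. -/
def divIdeal (hτ : ∀ a, z * a = τ a * z) (I : Ideal A) : Ideal A where
  carrier := {a | z * a ∈ I}
  add_mem' := fun {a b} ha hb => by
    change z * (a + b) ∈ I
    rw [mul_add]
    exact I.add_mem ha hb
  zero_mem' := by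
    change z * 0 ∈ I
    rw [mul_zero]
    exact I.zero_mem
  smul_mem' := fun c a ha => by
    change z * (c * a) ∈ I
    rw [← mul_assoc, hτ, mul_assoc]
    exact I.mul_mem_left _ ha

theorem mem_divIdeal {hτ : ∀ a, z * a = τ a * z} {I : Ideal A} {a : A} :
    a ∈ divIdeal hτ I ↔ z * a ∈ I := Iff.rfl

theorem le_divIdeal (hτ : ∀ a, z * a = τ a * z) (I : Ideal A) : I ≤ divIdeal hτ I := fun _ ha =>
  mem_divIdeal.2 (I.mul_mem_left z ha)

/-- The exact sequence `0 → A / z⁻¹I → A / I → B / π(I) → 0`, whose first map is multiplication by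
`z`. -/
theorem card_quotient_eq_mul (hτ : ∀ a, z * a = τ a * z) (hπ : Function.Surjective π)
    (hker : ∀ a, π a = 0 ↔ ∃ c, a = z * c) (I : Ideal A) :
    Nat.card (A ⧸ I) = Nat.card (A ⧸ divIdeal hτ I) * Nat.card (B ⧸ I.map π) := by
  have h1 : (divIdeal hτ I).toAddSubgroup = I.toAddSubgroup.comap (AddMonoidHom.mulLeft z) := rfl
  have h2 : (I.map π).toAddSubgroup.comap (π : A →+ B) =
      I.toAddSubgroup ⊔ (AddMonoidHom.mulLeft z).range := by
    ext a
    rw [AddSubgroup.mem_sup]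
    constructor
    · intro ha
      obtain ⟨b, hb, hab⟩ := (Ideal.mem_map_iff_of_surjective π hπ).1 ha
      obtain ⟨c, hc⟩ := (hker (a - b)).1 (by rw [map_sub, hab]; exact sub_self _)
      exact ⟨b, hb, z * c, ⟨c, rfl⟩, by rw [← hc, add_sub_cancel]⟩
    · rintro ⟨b, hb, _, ⟨c, rfl⟩, rfl⟩
      have h3 : π (z * c) = 0 := (hker _).2 ⟨c, rfl⟩
      refine (Ideal.mem_map_iff_of_surjective π hπ).2 ⟨b, hb, ?_⟩
      change π b = π (b + z * c)
      rw [map_add, h3, add_zero]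
  have h3 := AddSubgroup.index_comap I.toAddSubgroup (AddMonoidHom.mulLeft z)
  have h4 := AddSubgroup.index_comap_of_surjective (I.map π).toAddSubgroup (f := (π : A →+ B)) hπ
  have h5 := AddSubgroup.relIndex_mul_index
    (le_sup_left : I.toAddSubgroup ≤ I.toAddSubgroup ⊔ (AddMonoidHom.mulLeft z).range)
  rw [sup_comm, AddSubgroup.relIndex_sup_right, ← h3, ← h1, sup_comm, ← h2, h4] at h5
  exact h5.symm

theorem map_le_map_divIdeal (hτ : ∀ a, z * a = τ a * z) (I : Ideal A) :
    I.map π ≤ (divIdeal hτ I).map π := Ideal.map_mono (le_divIdeal hτ I)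

theorem mul_symm_mul_eq (hτ : ∀ a, z * a = τ a * z) (b c : A) :
    z * (τ.symm b * c) = b * (z * c) := by
  rw [← mul_assoc, hτ, τ.apply_symm_apply, mul_assoc]

/-- The left ideal `A y + z G`. -/
def extensionIdeal (hτ : ∀ a, z * a = τ a * z) (G : Ideal A) (y : A) : Ideal A where
  carrier := {a | ∃ b, ∃ g ∈ G, a = b * y + z * g}
  add_mem' := by
    rintro _ _ ⟨b, g, hg, rfl⟩ ⟨b', g', hg', rfl⟩
    exact ⟨b + b', g + g', G.add_mem hg hg', by noncomm_ring⟩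
  zero_mem' := ⟨0, 0, G.zero_mem, by simp⟩
  smul_mem' := by
    rintro c _ ⟨b, g, hg, rfl⟩
    refine ⟨c * b, τ.symm c * g, G.mul_mem_left _ hg, ?_⟩
    rw [smul_eq_mul, mul_add, mul_assoc, mul_symm_mul_eq hτ]

theorem self_mem_extensionIdeal (hτ : ∀ a, z * a = τ a * z) (G : Ideal A) (y : A) :
    y ∈ extensionIdeal hτ G y := ⟨1, 0, G.zero_mem, by simp⟩

theorem map_extensionIdeal (hτ : ∀ a, z * a = τ a * z) (hπ : Function.Surjective π)
    (hker : ∀ a, π a = 0 ↔ ∃ c, a = z * c) (G : Ideal A) (y : A) :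
    (extensionIdeal hτ G y).map π = Ideal.span {π y} := by
  have hz : ∀ c, π (z * c) = 0 := fun c => (hker _).2 ⟨c, rfl⟩
  refine le_antisymm (fun b hb => ?_) ?_
  · obtain ⟨_, ⟨a, g, -, rfl⟩, rfl⟩ := (Ideal.mem_map_iff_of_surjective π hπ).1 hb
    exact Ideal.mem_span_singleton'.2 ⟨π a, by rw [map_add, hz, add_zero, map_mul]⟩
  · rw [Ideal.span_singleton_le_iff_mem]
    exact Ideal.mem_map_of_mem π (self_mem_extensionIdeal hτ G y)

theorem divIdeal_extensionIdeal (hτ : ∀ a, z * a = τ a * z) (hz : ∀ a, z * a = 0 → a = 0)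
    (hker : ∀ a, π a = 0 ↔ ∃ c, a = z * c) {G : Ideal A} {y : A} (hyG : y ∈ G)
    (hy : ∀ b, b * π y = 0 → b = 0) : divIdeal hτ (extensionIdeal hτ G y) = G := by
  ext a
  rw [mem_divIdeal]
  constructor
  · rintro ⟨b, g, hg, hab⟩
    have h1 : π b * π y = 0 := by
      have h2 := congrArg π hab
      rwa [map_add, (hker (z * a)).2 ⟨a, rfl⟩, (hker (z * g)).2 ⟨g, rfl⟩, add_zero, map_mul,
        eq_comm] at h2
    obtain ⟨c, rfl⟩ := (hker b).1 (hy _ h1)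
    have h2 : a = c * y + g := sub_eq_zero.1 (hz _ (by
      rw [mul_sub, mul_add, hab, mul_assoc, sub_self]))
    rw [h2]
    exact G.add_mem (G.mul_mem_left _ hyG) hg
  · exact fun ha => ⟨0, a, ha, by simp⟩

theorem eq_extensionIdeal (hτ : ∀ a, z * a = τ a * z) (hker : ∀ a, π a = 0 ↔ ∃ c, a = z * c)
    (hπ : Function.Surjective π) {I : Ideal A} {y : A} (hyI : y ∈ I)
    (hy : I.map π = Ideal.span {π y}) : extensionIdeal hτ (divIdeal hτ I) y = I := by
  ext a
  constructor
  · rintro ⟨b, g, hg, rfl⟩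
    exact I.add_mem (I.mul_mem_left b hyI) hg
  · intro ha
    obtain ⟨b, hb⟩ := Ideal.mem_span_singleton'.1 (hy ▸ Ideal.mem_map_of_mem π ha)
    obtain ⟨b, rfl⟩ := hπ b
    obtain ⟨c, hc⟩ := (hker (a - b * y)).1 (by rw [map_sub, map_mul, hb, sub_self])
    refine ⟨b, c, ?_, by rw [← hc, add_sub_cancel]⟩
    rw [mem_divIdeal, ← hc]
    exact I.sub_mem ha (I.mul_mem_left b hyI)

theorem extensionIdeal_eq_iff (hτ : ∀ a, z * a = τ a * z) (hz : ∀ a, z * a = 0 → a = 0)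
    (hker : ∀ a, π a = 0 ↔ ∃ c, a = z * c) {G : Ideal A} {y : A} (hyG : y ∈ G)
    (hy : ∀ b, b * π y = 0 → b = 0) {c c' : A} (hc : z * c ∈ G) :
    extensionIdeal hτ G (y + z * c) = extensionIdeal hτ G (y + z * c') ↔ c - c' ∈ G := by
  have hπz : ∀ c, π (z * c) = 0 := fun c => (hker _).2 ⟨c, rfl⟩
  constructor
  · intro h
    have h1 : z * (c - c') ∈ extensionIdeal hτ G (y + z * c) := by
      rw [show z * (c - c') = (y + z * c) - (y + z * c') by noncomm_ring]
      exact Ideal.sub_mem _ (self_mem_extensionIdeal hτ G _)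
        (h ▸ self_mem_extensionIdeal hτ G _)
    rwa [← mem_divIdeal (hτ := hτ), divIdeal_extensionIdeal hτ hz hker (G.add_mem hyG hc)
      (by rwa [map_add, hπz, add_zero])] at h1
  · intro h
    ext a
    constructor
    · rintro ⟨b, g, hg, rfl⟩
      refine ⟨b, τ.symm b * (c - c') + g, G.add_mem (G.mul_mem_left _ h) hg, ?_⟩
      rw [mul_add z, mul_symm_mul_eq hτ]
      noncomm_ring
    · rintro ⟨b, g, hg, rfl⟩
      refine ⟨b, g - τ.symm b * (c - c'), G.sub_mem hg (G.mul_mem_left _ h), ?_⟩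
      rw [mul_sub z, mul_symm_mul_eq hτ]
      noncomm_ring

/-- Given a left ideal `G` of `A` and an element `x` of its image in `B`, there are `|B / π(G)|` left
ideals `I` of `A` with image `B x` and `{a | z a ∈ I} = G`. They are the ideals `A y + z G`, where
`y` runs over the lifts of `x` in `G` modulo `z G`. -/
theorem card_fibre_eq (hτ : ∀ a, z * a = τ a * z) (hz : ∀ a, z * a = 0 → a = 0)
    (hπ : Function.Surjective π) (hker : ∀ a, π a = 0 ↔ ∃ c, a = z * c) {G : Ideal A}
    (hG : Nat.card (A ⧸ G) ≠ 0) {x : B} (hxG : x ∈ G.map π) (hx : ∀ b, b * x = 0 → b = 0) :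
    Nat.card {I : Ideal A // divIdeal hτ I = G ∧ I.map π = Ideal.span {x}} =
      Nat.card (B ⧸ G.map π) := by
  obtain ⟨y, hyG, rfl⟩ := (Ideal.mem_map_iff_of_surjective π hπ).1 hxG
  have hπz : ∀ c, π (z * c) = 0 := fun c => (hker _).2 ⟨c, rfl⟩
  set G' := divIdeal hτ G with hG'
  let H := G.toAddSubgroup.addSubgroupOf G'.toAddSubgroup
  have hprop : ∀ c ∈ G', divIdeal hτ (extensionIdeal hτ G (y + z * c)) = G ∧
      (extensionIdeal hτ G (y + z * c)).map π = Ideal.span {π y} := fun c hc => by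
    have h1 : π (y + z * c) = π y := by rw [map_add, hπz, add_zero]
    exact ⟨divIdeal_extensionIdeal hτ hz hker (G.add_mem hyG hc) (by rwa [h1]),
      by rw [map_extensionIdeal hτ hπ hker, h1]⟩
  let f : G'.toAddSubgroup → {I : Ideal A // divIdeal hτ I = G ∧ I.map π = Ideal.span {π y}} :=
    fun c => ⟨extensionIdeal hτ G (y + z * c), hprop c c.2⟩
  have hf : ∀ c c', f c = f c' ↔ (QuotientAddGroup.mk c : G'.toAddSubgroup ⧸ H) =
      QuotientAddGroup.mk c' := by
    intro c c'
    rw [eq_comm (a := (QuotientAddGroup.mk c : G'.toAddSubgroup ⧸ H)), QuotientAddGroup.eq,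
      Subtype.ext_iff, neg_add_eq_sub]
    exact extensionIdeal_eq_iff hτ hz hker hyG hx c.2
  have hfsurj : Function.Surjective f := by
    rintro ⟨I, hI, hIπ⟩
    obtain ⟨y', hy', hyy'⟩ := (Ideal.mem_map_iff_of_surjective π hπ).1
      (hIπ ▸ Ideal.mem_span_singleton_self (π y))
    obtain ⟨c, hc⟩ := (hker (y' - y)).1 (by rw [map_sub, hyy', sub_self])
    have hcG : c ∈ G' := by
      rw [hG', mem_divIdeal, ← hc]
      exact G.sub_mem (hI ▸ le_divIdeal hτ I hy') hyG
    refine ⟨⟨c, hcG⟩, Subtype.ext ?_⟩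
    change extensionIdeal hτ G (y + z * c) = I
    rw [← hc, add_sub_cancel, ← hI]
    exact eq_extensionIdeal hτ hker hπ hy' (by rw [hyy', hIπ])
  let g : G'.toAddSubgroup ⧸ H → {I : Ideal A // divIdeal hτ I = G ∧ I.map π = Ideal.span {π y}} :=
    Quotient.lift f fun c c' h => (hf c c').2 (Quotient.sound h)
  have hg : Function.Bijective g := by
    constructor
    · intro p q
      induction p using QuotientAddGroup.induction_on
      induction q using QuotientAddGroup.induction_on
      exact fun h => (hf _ _).1 h
    · intro I
      obtain ⟨c, hc⟩ := hfsurj I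
      exact ⟨QuotientAddGroup.mk c, hc⟩
  rw [← Nat.card_congr (Equiv.ofBijective g hg)]
  change G.toAddSubgroup.relIndex G'.toAddSubgroup = _
  have h1 := AddSubgroup.relIndex_mul_index (H := G.toAddSubgroup) (K := G'.toAddSubgroup)
    fun a ha => le_divIdeal hτ G ha
  have h2 : G.toAddSubgroup.index = G'.toAddSubgroup.index * Nat.card (B ⧸ G.map π) :=
    card_quotient_eq_mul hτ hπ hker G
  have h3 : G'.toAddSubgroup.index ≠ 0 := fun h0 => hG (by
    rw [h0, zero_mul] at h2
    exact h2)
  exact Nat.eq_of_mul_eq_mul_left (Nat.pos_of_ne_zero h3) (by rw [← h2, mul_comm]; exact h1)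

theorem eq_top_of_map_eq_top (hker : ∀ a, π a = 0 ↔ ∃ c, a = z * c) (hπ : Function.Surjective π)
    (hrad : z ∈ Ring.jacobson A) {I : Ideal A} (h : I.map π = ⊤) : I = ⊤ := by
  by_contra hI
  obtain ⟨P, hP, hIP⟩ := Ideal.exists_le_maximal I hI
  obtain ⟨a, ha, ha1⟩ := (Ideal.mem_map_iff_of_surjective π hπ).1
    (h ▸ Submodule.mem_top : (1 : B) ∈ I.map π)
  obtain ⟨c, hc⟩ := (hker (1 - a)).1 (by rw [map_sub, map_one, ha1, sub_self])
  refine (Ideal.ne_top_iff_one P).1 hP.ne_top ?_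
  have h1 : 1 - a ∈ P := Ring.jacobson_le_of_isMaximal P (hc ▸ mul_mem_jacobson_right hrad c)
  have h2 := P.add_mem h1 (hIP ha)
  rwa [sub_add_cancel] at h2

end Slice

/-! ### The zeta function of an order in terms of its slice -/

theorem famSeries_agree {ι : Type*} {ν : ι → ℕ} {w : ι → ℚ} (i₀ : ι) (h0 : ν i₀ = 1)
    (hw : w i₀ = 1) {N : ℕ} (h : ∀ i, i ≠ i₀ → N ≤ ν i) {k : ℕ} (hk : k < N) :
    famSeries ν w k = (1 : ArithmeticFunction ℚ) k := by
  rcases eq_or_ne k 0 with rfl | hk0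
  · simp
  rw [famSeries_apply hk0, ArithmeticFunction.one_apply]
  rcases eq_or_ne k 1 with rfl | hk1
  · rw [if_pos rfl, show {i | ν i = 1} = {i₀} from ?_, finsum_mem_singleton, hw]
    ext i
    refine ⟨fun hi => ?_, fun hi => by rw [Set.mem_singleton_iff.1 hi]; exact h0⟩
    by_contra hne
    exact absurd (h i hne) (not_le.2 (lt_of_eq_of_lt hi hk))
  · rw [if_neg hk1]
    refine finsum_mem_of_eqOn_zero fun i hi => ?_
    have hi' : ν i = k := hi
    by_cases hii : i = i₀
    · exact absurd (by rw [← hi', hii, h0]) hk1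
    · exact absurd (h i hii) (not_le.2 (lt_of_eq_of_lt hi' hk))

section SliceSeries

variable {A B : Type*} [Ring A] [Ring B] {z : A} {τ : A ≃+* A} {π : A →+* B}

/-- The series `∑ |B / π(I)|ⁿ (|A / I| |B / π(I)|ⁿ)⁻ˢ` over the left ideals `I` of finite index. -/
noncomputable def sliceSeries (π : A →+* B) (n : ℕ) : ArithmeticFunction ℚ :=
  famSeries
    (fun I : {I : Ideal A // Finite (A ⧸ I)} =>
      Nat.card (A ⧸ I.1) * Nat.card (B ⧸ I.1.map π) ^ n)
    fun I => (Nat.card (B ⧸ I.1.map π) : ℚ) ^ n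

theorem sliceSeries_zero (π : A →+* B) (hA : ZetaDefined A) : sliceSeries π 0 = zetaSeries A := by
  simp only [sliceSeries, pow_zero, mul_one]
  exact hA.zetaSeries_eq.symm

theorem sliceSeries_finiteFibres (π : A →+* B) (hA : ZetaDefined A) (n : ℕ) :
    FiniteFibres fun I : {I : Ideal A // Finite (A ⧸ I)} =>
      Nat.card (A ⧸ I.1) * Nat.card (B ⧸ I.1.map π) ^ n := fun _ hN =>
  (hA.finiteFibres.finite_dvd hN).subset fun _ hI => Dvd.intro _ hI

/-- The left ideals `I` are sorted according to `G = {a | z a ∈ I}` and the left ideal `L` with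
`π(I) = L g`, where `π(G) = B g`. -/
theorem sliceSeries_eq_mul (H : IsHomogeneousRing B) (hA : ZetaDefined A) (hB : ZetaDefined B)
    (hτ : ∀ a, z * a = τ a * z) (hz : ∀ a, z * a = 0 → a = 0)
    (hπ : Function.Surjective π) (hker : ∀ a, π a = 0 ↔ ∃ c, a = z * c) (n : ℕ) :
    sliceSeries π n = dirichletSubst n (zetaSeries B) * sliceSeries π (n + 1) := by
  have hcard := card_quotient_eq_mul hτ hπ hker
  have hfin : ∀ I : {I : Ideal A // Finite (A ⧸ I)},
      Finite (A ⧸ divIdeal hτ I.1) ∧ Finite (B ⧸ I.1.map π) := fun I => by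
    have := I.2
    have h1 : Nat.card (A ⧸ I.1) ≠ 0 := Nat.card_pos.ne'
    rw [hcard] at h1
    exact ⟨Nat.finite_of_card_ne_zero (left_ne_zero_of_mul h1),
      Nat.finite_of_card_ne_zero (right_ne_zero_of_mul h1)⟩
  choose g hg hreg using fun G : {I : Ideal A // Finite (A ⧸ I)} => H _ (hfin G).2
  let G : {I : Ideal A // Finite (A ⧸ I)} → {I : Ideal A // Finite (A ⧸ I)} := fun I =>
    ⟨divIdeal hτ I.1, (hfin I).1⟩
  choose L hL using fun I : {I : Ideal A // Finite (A ⧸ I)} =>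
    exists_mulRightIdeal_eq (hg (G I) ▸ map_le_map_divIdeal (π := π) hτ I.1)
  have hcardL : ∀ I, Nat.card (B ⧸ I.1.map π) =
      Nat.card (B ⧸ L I) * Nat.card (B ⧸ (G I).1.map π) := fun I => by
    rw [← hL, card_quotient_mulRightIdeal (hreg _), ← hg]
  have hLfin : ∀ I, Finite (B ⧸ L I) := fun I => by
    have := (hfin I).2
    have h1 : Nat.card (B ⧸ I.1.map π) ≠ 0 := Nat.card_pos.ne'
    rw [hcardL] at h1
    exact Nat.finite_of_card_ne_zero (left_ne_zero_of_mul h1)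
  rw [hB.zetaSeries_eq, dirichletSubst_famSeries hB.finiteFibres, sliceSeries, sliceSeries,
    ← famSeries_mul (hB.finiteFibres.pow n) (sliceSeries_finiteFibres π hA (n + 1))]
  refine famSeries_eq_of_fibres (sliceSeries_finiteFibres π hA n)
    (fun I => (⟨L I, hLfin I⟩, G I)) (fun I => ?_) fun p _ => ?_
  · change Nat.card (B ⧸ L I) ^ (n + 1) * (Nat.card (A ⧸ divIdeal hτ I.1) *
      Nat.card (B ⧸ (G I).1.map π) ^ (n + 1)) = _
    rw [hcard I.1, hcardL I]
    ring
  · obtain ⟨⟨L', hL'⟩, G'⟩ := p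
    obtain ⟨l, hl, hlreg⟩ := H L' hL'
    have hspan : mulRightIdeal L' (g G') = Ideal.span {l * g G'} := by
      ext b
      rw [mem_mulRightIdeal, Ideal.mem_span_singleton', hl]
      simp only [Ideal.mem_span_singleton']
      constructor
      · rintro ⟨_, ⟨a, rfl⟩, rfl⟩
        exact ⟨a, (mul_assoc _ _ _).symm⟩
      · rintro ⟨a, rfl⟩
        exact ⟨_, ⟨a, rfl⟩, mul_assoc _ _ _⟩
    have hmem : l * g G' ∈ G'.1.map π := by
      rw [hg G']
      exact Ideal.mem_span_singleton'.2 ⟨l, rfl⟩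
    have hlg : ∀ b, b * (l * g G') = 0 → b = 0 := fun b hb =>
      hlreg b (hreg G' _ (by rw [mul_assoc, hb]))
    have hcardfin : Nat.card (A ⧸ G'.1) ≠ 0 := by
      have := G'.2
      exact Nat.card_pos.ne'
    have hfib := card_fibre_eq hτ hz hπ hker hcardfin hmem hlg
    have hcardspan : Nat.card (B ⧸ Ideal.span {l * g G'}) =
        Nat.card (B ⧸ L') * Nat.card (B ⧸ G'.1.map π) := by
      rw [← hspan, card_quotient_mulRightIdeal (hreg _), ← hg]
    have hpos : Nat.card (B ⧸ G'.1.map π) ≠ 0 := by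
      have := (hfin G').2
      exact Nat.card_pos.ne'
    have hiff : ∀ I : {I : Ideal A // Finite (A ⧸ I)},
        ((⟨L I, hLfin I⟩, G I) : {I : Ideal B // Finite (B ⧸ I)} × _) = (⟨L', hL'⟩, G') ↔
          divIdeal hτ I.1 = G'.1 ∧ I.1.map π = Ideal.span {l * g G'} := by
      intro I
      rw [Prod.ext_iff, Subtype.ext_iff, Subtype.ext_iff, and_comm]
      refine and_congr_right fun hGI => ?_
      have hGI' : G I = G' := Subtype.ext hGI
      rw [← hL I, ← hspan, hGI']
      exact (mulRightIdeal_injective (hreg G')).eq_iff.symm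
    set T := {I : {I : Ideal A // Finite (A ⧸ I)} |
      ((⟨L I, hLfin I⟩, G I) : {I : Ideal B // Finite (B ⧸ I)} × _) = (⟨L', hL'⟩, G')} with hT
    have himage : Subtype.val '' T =
        {I : Ideal A | divIdeal hτ I = G'.1 ∧ I.map π = Ideal.span {l * g G'}} := by
      ext I
      constructor
      · rintro ⟨I, hI, rfl⟩
        exact (hiff I).1 hI
      · intro hI
        have hIcard := hcard I
        rw [hI.1, hI.2, hcardspan] at hIcard
        have hIfin : Finite (A ⧸ I) := Nat.finite_of_card_ne_zero (by
          rw [hIcard]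
          exact mul_ne_zero hcardfin (mul_ne_zero Nat.card_pos.ne' hpos))
        exact ⟨⟨I, hIfin⟩, (hiff _).2 hI, rfl⟩
    have hTcard : T.ncard = Nat.card (B ⧸ G'.1.map π) := by
      rw [← Set.ncard_image_of_injective T Subtype.val_injective, himage, ← hfib]
      rfl
    have hTfin : T.Finite := Set.finite_of_ncard_ne_zero (hTcard ▸ hpos)
    rw [finsum_mem_congr rfl (g := fun _ => ((Nat.card (B ⧸ L') : ℚ) *
      Nat.card (B ⧸ G'.1.map π)) ^ n), finsum_mem_eq_finite_toFinset_sum _ hTfin,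
      Finset.sum_const, ← Set.ncard_eq_toFinset_card _ hTfin, hTcard, nsmul_eq_mul]
    · change _ = ((Nat.card (B ⧸ L') : ℚ) ^ n * 1) * (Nat.card (B ⧸ G'.1.map π) : ℚ) ^ (n + 1)
      ring
    · intro I hI
      rw [((hiff I).1 hI).2, hcardspan, Nat.cast_mul]

/-- The zeta function of `A` is the product of the series `ζ_B ((n + 1) s - n)`. -/
theorem hasFormalProd_dirichletSubst (H : IsHomogeneousRing B) (hA : ZetaDefined A)
    (hB : ZetaDefined B) (hτ : ∀ a, z * a = τ a * z) (hz : ∀ a, z * a = 0 → a = 0)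
    (hπ : Function.Surjective π) (hker : ∀ a, π a = 0 ↔ ∃ c, a = z * c)
    (hrad : z ∈ Ring.jacobson A) :
    HasFormalProd (fun n => dirichletSubst n (zetaSeries B)) (zetaSeries A) := by
  have htwo : ∀ I : Ideal B, I ≠ ⊤ → Finite (B ⧸ I) → 2 ≤ Nat.card (B ⧸ I) := fun I hI _ => by
    have : Nontrivial (B ⧸ I) := Submodule.Quotient.nontrivial_iff.2 hI
    exact Finite.one_lt_card
  have htopA : Finite (A ⧸ (⊤ : Ideal A)) := inferInstance
  have htopB : Finite (B ⧸ (⊤ : Ideal B)) := inferInstance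
  have hmaptop : (⊤ : Ideal A).map π = ⊤ := Ideal.map_top π
  refine hasFormalProd_of_agree (sliceSeries_zero π hA)
    (sliceSeries_eq_mul H hA hB hτ hz hπ hker) (fun n k hk => ?_) fun n k hk => ?_
  · rw [hB.zetaSeries_eq, dirichletSubst_famSeries hB.finiteFibres]
    refine famSeries_agree ⟨⊤, htopB⟩ ?_ ?_ (fun I hI => ?_) hk
    · simp
    · simp
    · refine (Nat.pow_le_pow_left (htwo I.1 (fun h => hI (Subtype.ext h)) I.2) n).trans
        (Nat.pow_le_pow_right ?_ (Nat.le_succ n))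
      have := I.2
      exact Nat.card_pos
  · refine famSeries_agree ⟨⊤, htopA⟩ ?_ ?_ (fun I hI => ?_) hk
    · simp [hmaptop]
    · simp [hmaptop]
    · have := I.2
      have hpos : 0 < Nat.card (A ⧸ I.1) := Nat.card_pos
      have hfinI : Finite (B ⧸ I.1.map π) := by
        have h1 := hpos.ne'
        rw [card_quotient_eq_mul hτ hπ hker] at h1
        exact Nat.finite_of_card_ne_zero (right_ne_zero_of_mul h1)
      exact (Nat.pow_le_pow_left (htwo _ (fun h => hI (Subtype.ext
        (eq_top_of_map_eq_top hker hπ hrad h))) hfinI) n).trans (Nat.le_mul_of_pos_left _ hpos)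

end SliceSeries

/-! ### The slice ring -/

theorem mem_span_singleton_iff_of_isNormalElement {A : Type*} [Ring A] {z : A}
    (hz : IsNormalElement z) {a : A} : a ∈ TwoSidedIdeal.span {z} ↔ ∃ c, a = z * c := by
  constructor
  · intro ha
    let I : TwoSidedIdeal A := TwoSidedIdeal.mk' {a | ∃ c, a = z * c} ⟨0, (mul_zero z).symm⟩
      (by
        rintro _ _ ⟨c, rfl⟩ ⟨d, rfl⟩
        exact ⟨c + d, (mul_add z c d).symm⟩)
      (by
        rintro _ ⟨c, rfl⟩
        exact ⟨-c, (mul_neg z c).symm⟩)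
      (by
        rintro b _ ⟨c, rfl⟩
        obtain ⟨d, hd⟩ := hz.2 b
        exact ⟨d * c, by rw [← mul_assoc, hd, mul_assoc]⟩)
      (by
        rintro _ b ⟨c, rfl⟩
        exact ⟨c * b, mul_assoc z c b⟩)
    have h1 : a ∈ I := TwoSidedIdeal.mem_span_iff.1 ha I fun b hb =>
      (TwoSidedIdeal.mem_mk' ..).2 ⟨1, by rw [mul_one, Set.mem_singleton_iff.1 hb]⟩
    rw [TwoSidedIdeal.mem_mk'] at h1
    exact h1
  · rintro ⟨c, rfl⟩
    exact TwoSidedIdeal.mul_mem_right _ _ _ (TwoSidedIdeal.subset_span rfl)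

/-- The projection of `A` onto `A / (z)`. -/
def sliceProj (R : Type*) {A : Type*} [CommRing R] [Ring A] [Algebra R A] (z : A) :
    A →ₐ[R] SliceRing z :=
  { (TwoSidedIdeal.span {z}).ringCon.mk' with commutes' := fun _ => rfl }

theorem sliceProj_surjective (R : Type*) {A : Type*} [CommRing R] [Ring A] [Algebra R A] (z : A) :
    Function.Surjective (sliceProj R z) :=
  RingCon.mk'_surjective (TwoSidedIdeal.span {z}).ringCon

theorem sliceProj_eq_zero_iff (R : Type*) {A : Type*} [CommRing R] [Ring A] [Algebra R A] {z : A}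
    (hz : IsNormalElement z) {a : A} : sliceProj R z a = 0 ↔ ∃ c, a = z * c := by
  rw [← mem_span_singleton_iff_of_isNormalElement hz, TwoSidedIdeal.mem_iff]
  exact RingCon.eq _

theorem mem_sliceSubmodule_iff {A : Type*} [Ring A] {z : A} (hz : IsNormalElement z) {a : A} :
    a ∈ sliceSubmodule A z ↔ ∃ c, a = z * c := by
  constructor
  · intro ha
    induction ha using Submodule.span_induction with
    | mem x hx =>
      obtain ⟨c, rfl⟩ := hx
      exact ⟨c, rfl⟩
    | zero => exact ⟨0, (mul_zero z).symm⟩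
    | add x y _ _ hx hy =>
      obtain ⟨c, rfl⟩ := hx
      obtain ⟨d, rfl⟩ := hy
      exact ⟨c + d, (mul_add z c d).symm⟩
    | smul b x _ hx =>
      obtain ⟨c, rfl⟩ := hx
      obtain ⟨d, hd⟩ := hz.2 b
      exact ⟨d * c, by rw [smul_eq_mul, ← mul_assoc, hd, mul_assoc]⟩
  · rintro ⟨c, rfl⟩
    exact Submodule.subset_span ⟨c, rfl⟩

theorem exists_algEquiv_of_surjective {R A B : Type*} [CommRing R] [Ring A] [Ring B] [Algebra R A]
    [Algebra R B] (π : A →ₐ[R] B) (hπ : Function.Surjective π) (τ : A ≃ₐ[R] A)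
    (hτ : ∀ a, π (τ a) = 0 ↔ π a = 0) : ∃ τ' : B ≃ₐ[R] B, ∀ a, π (τ a) = τ' (π a) := by
  let f₀ : B →+* B := RingHom.liftOfSurjective (π : A →+* B) hπ
    ⟨(π : A →+* B).comp (τ : A →+* A), fun a ha => (hτ a).2 ha⟩
  have hf : ∀ a, f₀ (π a) = π (τ a) := fun a => RingHom.liftOfSurjective_comp_apply ..
  let f : B →ₐ[R] B :=
    { f₀ with
      commutes' := fun r => by
        change f₀ (algebraMap R B r) = _
        rw [← π.commutes, hf, τ.commutes] }
  refine ⟨AlgEquiv.ofBijective f ⟨(injective_iff_map_eq_zero f).2 fun b hb => ?_, fun b => ?_⟩,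
    fun a => (hf a).symm⟩
  · obtain ⟨a, rfl⟩ := hπ b
    exact (hτ a).1 ((hf a).symm.trans hb)
  · obtain ⟨a, rfl⟩ := hπ b
    exact ⟨π (τ.symm a), (hf _).trans (by rw [τ.apply_symm_apply])⟩

theorem map_mem_jacobson_iff {A B : Type*} [Ring A] [Ring B] {π : A →+* B}
    (hπ : Function.Surjective π) (hker : ∀ a, π a = 0 → a ∈ Ring.jacobson A) {a : A} :
    π a ∈ Ring.jacobson B ↔ a ∈ Ring.jacobson A := by
  have : RingHomSurjective π := ⟨hπ⟩
  constructor
  · intro ha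
    rw [← Ring.map_jacobson_of_ker_le (f := π) hker] at ha
    obtain ⟨b, hb, hab⟩ := ha
    have h1 := hker (b - a) (by rw [map_sub, sub_eq_zero]; exact hab)
    have h2 := sub_mem hb h1
    rwa [sub_sub_cancel] at h2
  · exact fun ha => Ring.le_comap_jacobson π ha

/-! ### Homogeneous slices and homogeneous rings -/

theorem finite_of_isFiniteLength {A : Type*} [Ring A] [Finite (A ⧸ Ring.jacobson A)] {M : Type*}
    [AddCommGroup M] [Module A M] (h : IsFiniteLength A M) : Finite M := by
  induction h with
  | of_subsingleton => infer_instance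
  | @of_simple_quotient M _ _ N hN _ ih =>
    obtain ⟨P, hP, ⟨e⟩⟩ := isSimpleModule_iff_quot_maximal.1 hN
    have : Finite (A ⧸ P) :=
      Finite.of_surjective _ (Submodule.factor_surjective (Ring.jacobson_le_of_isMaximal P))
    have : Finite (M ⧸ N) := Finite.of_equiv _ e.symm.toEquiv
    have h1 := AddSubgroup.card_eq_card_quotient_mul_card_addSubgroup N.toAddSubgroup
    refine Nat.finite_of_card_ne_zero ?_
    rw [h1]
    exact mul_ne_zero (Nat.card_pos (α := M ⧸ N)).ne' (Nat.card_pos (α := N)).ne'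

theorem card_quotient_eq_of_mem_iff {A B M : Type*} [Ring A] [Ring B] [AddCommGroup M] [Module A M]
    {q : A →ₗ[A] M} (hq : Function.Surjective q) {π : A →+* B} (hπ : Function.Surjective π)
    {N' : Submodule A M} {N : Ideal B} (h : ∀ a, q a ∈ N' ↔ π a ∈ N) :
    Nat.card (M ⧸ N') = Nat.card (B ⧸ N) := by
  have h1 := AddSubgroup.index_comap_of_surjective N'.toAddSubgroup (f := q.toAddMonoidHom) hq
  have h2 := AddSubgroup.index_comap_of_surjective N.toAddSubgroup (f := (π : A →+ B)) hπ
  have h3 : N'.toAddSubgroup.comap q.toAddMonoidHom = N.toAddSubgroup.comap (π : A →+ B) := by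
    ext a
    exact h a
  exact h1.symm.trans ((congrArg _ h3).trans h2)

theorem isHomogeneousSlice_iff {A B : Type*} [Ring A] [Ring B] [Finite (A ⧸ Ring.jacobson A)]
    {z : A} (hreg : IsRegular z) (hnorm : IsNormalElement z) (hrad : z ∈ Ring.jacobson A)
    {π : A →+* B} (hπ : Function.Surjective π) (hker : ∀ a, π a = 0 ↔ ∃ c, a = z * c) :
    IsHomogeneousSlice A z ↔ IsHomogeneousRing B := by
  let q : A →ₗ[A] A ⧸ sliceSubmodule A z := (sliceSubmodule A z).mkQ
  have hq : Function.Surjective q := Submodule.mkQ_surjective _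
  have hqπ : ∀ a, q a = 0 ↔ π a = 0 := fun a => by
    rw [hker, ← mem_sliceSubmodule_iff hnorm]
    exact Submodule.Quotient.mk_eq_zero _
  have hqsmul : ∀ a b : A, q (a * b) = a • q b := fun a b => map_smul q a b
  constructor
  · intro H N hN
    let P : Ideal A := N.comap π
    have hP : ∀ a, q a ∈ Submodule.map q P ↔ π a ∈ N := fun a => by
      constructor
      · rintro ⟨b, hb, hab⟩
        have h1 : π (a - b) = 0 := (hqπ _).1 (by rw [map_sub, hab, sub_self])
        rw [map_sub, sub_eq_zero] at h1
        rw [h1]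
        exact hb
      · exact fun ha => ⟨a, ha, rfl⟩
    have hcard := card_quotient_eq_of_mem_iff hq hπ hP
    have hfin : Finite ((A ⧸ sliceSubmodule A z) ⧸ Submodule.map q P) :=
      Nat.finite_of_card_ne_zero (hcard ▸ Nat.card_pos.ne')
    obtain ⟨e⟩ := H.homogeneous (Submodule.map q P)
      (isFiniteLength_iff_isNoetherian_isArtinian.2 ⟨inferInstance, inferInstance⟩)
    obtain ⟨y, hyP, hy⟩ := (e.symm (q 1)).2
    have hspan : ∀ a, q (a * y) = e.symm (q a) := fun a => by
      rw [hqsmul, hy, ← Submodule.coe_smul, ← map_smul, ← hqsmul, mul_one]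
    refine ⟨π y, le_antisymm (fun b hb => ?_) ((Ideal.span_singleton_le_iff_mem N).2 hyP),
      fun b hb => ?_⟩
    · obtain ⟨a, rfl⟩ := hπ b
      obtain ⟨c, hc⟩ := hq (e ⟨q a, (hP a).2 hb⟩)
      have h1 := hspan c
      rw [hc, e.symm_apply_apply, ← sub_eq_zero, ← map_sub, hqπ, map_sub, sub_eq_zero,
        map_mul] at h1
      exact Ideal.mem_span_singleton'.2 ⟨π c, h1⟩
    · obtain ⟨a, rfl⟩ := hπ b
      rw [← map_mul, ← hqπ, hspan] at hb
      rw [← hqπ, ← e.symm.map_eq_zero_iff]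
      exact Subtype.ext hb
  · intro H
    refine ⟨inferInstance, hreg, hnorm, hrad, fun N' hN' => ?_⟩
    have hfin := finite_of_isFiniteLength hN'
    let N : Ideal B := Ideal.map π (N'.comap q)
    have hN : ∀ a, q a ∈ N' ↔ π a ∈ N := fun a => by
      refine ⟨fun ha => Ideal.mem_map_of_mem π ha, fun ha => ?_⟩
      obtain ⟨b, hb, hab⟩ := (Ideal.mem_map_iff_of_surjective π hπ).1 ha
      have h1 : q (b - a) = 0 := (hqπ _).2 (by rw [map_sub, hab, sub_self])
      rw [map_sub, sub_eq_zero] at h1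
      rw [← h1]
      exact hb
    obtain ⟨y, hy, hyreg⟩ := H N (Nat.finite_of_card_ne_zero
      (card_quotient_eq_of_mem_iff hq hπ hN ▸ Nat.card_pos.ne'))
    obtain ⟨y, rfl⟩ := hπ y
    have hyN : q y ∈ N' := (hN y).2 (hy ▸ Ideal.mem_span_singleton_self (π y))
    let f : A →ₗ[A] N' := LinearMap.toSpanSingleton A N' ⟨q y, hyN⟩
    have hfq : ∀ a, (f a : A ⧸ sliceSubmodule A z) = q (a * y) := fun a => (hqsmul a y).symm
    have hf : Function.Surjective f := by
      rintro ⟨x, hx⟩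
      obtain ⟨a, rfl⟩ := hq x
      obtain ⟨b, hb⟩ := Ideal.mem_span_singleton'.1 (hy ▸ (hN a).1 hx)
      obtain ⟨c, rfl⟩ := hπ b
      refine ⟨c, Subtype.ext ?_⟩
      rw [hfq, ← sub_eq_zero, ← map_sub, hqπ, map_sub, map_mul, hb, sub_self]
    have hfker : LinearMap.ker f = sliceSubmodule A z := by
      ext a
      rw [LinearMap.mem_ker, Subtype.ext_iff, hfq, Submodule.coe_zero, hqπ, map_mul,
        mem_sliceSubmodule_iff hnorm, ← hker]
      exact ⟨hyreg _, fun h => by rw [h, zero_mul]⟩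
    exact ⟨(f.quotKerEquivOfSurjective hf).symm.trans (Submodule.quotEquivOfEq _ _ hfker)⟩

/-! ### The product formulas -/

theorem eq_prod_inverse_pow {M ι : Type*} [CommRing M] {s : Finset ι} {f : ι → M} {m : ℕ} {x : M}
    (h : x * ∏ i ∈ s, f i ^ m = 1) : x = ∏ i ∈ s, Ring.inverse (f i) ^ m := by
  have h1 : (∏ i ∈ s, f i ^ m) * ∏ i ∈ s, Ring.inverse (f i) ^ m = 1 := by
    rw [← Finset.prod_mul_distrib]
    refine Finset.prod_eq_one fun i hi => ?_
    rcases eq_or_ne m 0 with rfl | hm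
    · rw [pow_zero, pow_zero, mul_one]
    · have h2 := IsUnit.prod_iff.1 (IsUnit.of_mul_eq_one_right x h) i hi
      rw [← mul_pow, Ring.mul_inverse_cancel _ ((isUnit_pow_iff hm).1 h2), one_pow]
  rw [← mul_one x, ← h1, ← mul_assoc, h, one_mul]

theorem dirichletSubst_eq_prod {f : ArithmeticFunction ℚ} {q m r : ℕ}
    (hf : f * ∏ j ∈ Finset.range r, (1 - dirichletTerm ((q : ℚ) ^ j) (q ^ r)) ^ m = 1) (n : ℕ) :
    dirichletSubst n f = ∏ j ∈ Finset.Icc 1 r,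
      Ring.inverse (1 - dirichletTerm ((q : ℚ) ^ ((n + 1) * r - j)) (q ^ ((n + 1) * r))) ^ m := by
  refine eq_prod_inverse_pow ?_
  have h1 := congrArg (dirichletSubstHom n) hf
  rw [map_mul, map_one, map_prod] at h1
  refine Eq.trans ?_ h1
  rw [dirichletSubstHom_apply]
  congr 1
  refine Finset.prod_nbij' (fun j => r - j) (fun j => r - j) ?_ ?_ ?_ ?_ fun j hj => ?_
  · intro j hj
    rw [Finset.mem_Icc] at hj
    rw [Finset.mem_range]
    omega
  · intro j hj
    rw [Finset.mem_range] at hj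
    rw [Finset.mem_Icc]
    omega
  · intro j hj
    rw [Finset.mem_Icc] at hj
    omega
  · intro j hj
    rw [Finset.mem_range] at hj
    omega
  · rw [Finset.mem_Icc] at hj
    rw [map_pow, map_sub, map_one, dirichletSubstHom_apply, dirichletSubst_dirichletTerm]
    have h2 : (n + 1) * r - j = r * n + (r - j) := by
      rw [add_mul, one_mul, mul_comm n]
      omega
    rw [h2, pow_add, Nat.cast_pow, ← pow_mul, ← pow_mul, mul_comm r (n + 1)]

theorem dirichletTerm_pow_sub {q j k : ℕ} (hq : q ≠ 0) (hj : j ≤ k) :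
    dirichletTerm ((q : ℚ) ^ (k - j)) (q ^ k) =
      ((q : ℚ) ^ j)⁻¹ • ((q : ℚ) • dirichletTerm 1 q) ^ k := by
  rw [smul_dirichletTerm, mul_one, dirichletTerm_pow, smul_dirichletTerm,
    pow_sub₀ _ (Nat.cast_ne_zero.2 hq) hj, mul_comm]

theorem mainTheorem2 {R : Type*} {A : Type*}
    [CommRing R] [IsDomain R] [IsLocalRing R] [IsNoetherianRing R] [IsIntegrallyClosed R]
    [Finite (IsLocalRing.ResidueField R)] [Ring A] [Algebra R A]
    (hA : IsCentralOrder R A)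
    (z : A) (hreg : IsRegular z) (hnormal : IsNormalElement z) (hrad : z ∈ Ring.jacobson A) :
    -- the two forms of the hypothesis are equivalent
    (IsHomogeneousSlice A z ↔ IsProductOfMaximalOrders (SliceRing z)) ∧
    ∀ (F : Type*) [Field F] [Finite F] (q m r : ℕ), Nat.card F = q →
      Nonempty ((A ⧸ Ring.jacobson A) ≃+* (Fin m → Matrix (Fin r) (Fin r) F)) →
      IsHomogeneousSlice A z →
        ZetaDefined A ∧ ZetaDefined (SliceRing z) ∧
        -- the formula in terms of `q⁻ˢ`
        HasFormalProd
          (fun n : ℕ+ => ∏ j ∈ Finset.Icc 1 r,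
            Ring.inverse (1 - dirichletTerm ((q : ℚ) ^ ((n : ℕ) * r - j)) (q ^ ((n : ℕ) * r))) ^ m)
          (zetaSeries A) ∧
        -- the same formula in terms of `t = q⁻ˢ`
        HasFormalProd
          (fun n : ℕ+ => ∏ j ∈ Finset.Icc 1 r,
            Ring.inverse (1 - ((q : ℚ) ^ j)⁻¹ • ((q : ℚ) • dirichletTerm 1 q) ^ ((n : ℕ) * r)) ^ m)
          (zetaSeries A) ∧
        -- the formula in terms of the zeta function of `A/(z)`
        HasFormalProd (fun n : ℕ => dirichletSubst n (zetaSeries (SliceRing z)))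
          (zetaSeries A) ∧
        -- Hey's formula for `A/(z)`
        zetaSeries (SliceRing z) =
          ∏ j ∈ Finset.range r, Ring.inverse (1 - dirichletTerm ((q : ℚ) ^ j) (q ^ r)) ^ m := by
  have := hA.finite
  have hzz : ∀ a, z * a = 0 → a = 0 := fun a ha => hreg.left (by simpa using ha)
  let π := sliceProj R z
  have hπ : Function.Surjective π := sliceProj_surjective R z
  have hker : ∀ a, π a = 0 ↔ ∃ c, a = z * c := fun a => sliceProj_eq_zero_iff R hnormal
  have hfinA := finite_quotient_jacobson R A
  have : Module.Finite R (SliceRing z) := Module.Finite.of_surjective π.toLinearMap hπ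
  have hfinB := finite_quotient_jacobson R (SliceRing z)
  have hiff : IsHomogeneousSlice A z ↔ IsHomogeneousRing (SliceRing z) :=
    isHomogeneousSlice_iff hreg hnormal hrad (π := (π : A →+* SliceRing z)) hπ hker
  obtain ⟨τ, hτ⟩ := exists_algEquiv_of_isNormalElement R hreg hnormal
  refine ⟨hiff.trans ⟨fun H => ?_, isHomogeneousRing_of_isProductOfMaximalOrders⟩, ?_⟩
  · have : Nontrivial A := by
      by_contra hnon
      rw [not_nontrivial_iff_subsingleton] at hnon
      have := hA.simple
      have h1 : (1 : FractionRing R ⊗[R] A) = 0 := by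
        rw [Algebra.TensorProduct.one_def, Subsingleton.elim (1 : A) 0, TensorProduct.tmul_zero]
      exact one_ne_zero h1
    have : Nontrivial (SliceRing z) := by
      by_contra hnon
      rw [not_nontrivial_iff_subsingleton] at hnon
      have h1 := eq_top_of_map_eq_top (π := (π : A →+* SliceRing z)) hker hπ hrad (I := ⊥)
        (Subsingleton.elim _ _)
      exact bot_ne_top h1
    have hτz : τ z = z := hreg.right (hτ z).symm
    obtain ⟨τ', hτ'⟩ := exists_algEquiv_of_surjective π hπ τ fun a => by
      rw [hker, hker]
      constructor
      · rintro ⟨c, hc⟩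
        refine ⟨τ.symm c, τ.injective ?_⟩
        rw [map_mul, hτz, τ.apply_symm_apply, hc]
      · rintro ⟨c, rfl⟩
        exact ⟨τ c, by rw [map_mul, hτz]⟩
    exact isProductOfMaximalOrders_of_homogeneous
      (fun a ha => exists_algebraMap_eq_of_central hA ha) hnormal hrad τ hτ π hπ hker τ' hτ' H
  · rintro F _ _ q m r rfl ⟨e⟩ H
    have hZA := zetaDefined_of_finite R A
    have hZB := zetaDefined_of_finite R (SliceRing z)
    have HB := hiff.1 H
    have hkerJ : ∀ a, π a = 0 → a ∈ Ring.jacobson A := fun a ha => by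
      obtain ⟨c, rfl⟩ := (hker a).1 ha
      exact mul_mem_jacobson_right hrad c
    let ψ₀ : A →+* (Fin m → Matrix (Fin r) (Fin r) F) :=
      (e : (A ⧸ Ring.jacobson A) →+* _).comp (Ideal.Quotient.mk (Ring.jacobson A))
    have hψ₀ : ∀ a, ψ₀ a = 0 ↔ a ∈ Ring.jacobson A := fun a =>
      (map_eq_zero_iff e e.injective).trans Ideal.Quotient.eq_zero_iff_mem
    let ψ : SliceRing z →+* (Fin m → Matrix (Fin r) (Fin r) F) :=
      RingHom.liftOfSurjective (π : A →+* SliceRing z) hπ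
        ⟨ψ₀, fun a ha => (hψ₀ a).2 (hkerJ a ha)⟩
    have hψπ : ∀ a, ψ (π a) = ψ₀ a := fun a => RingHom.liftOfSurjective_comp_apply ..
    have hψ : Function.Surjective ψ := fun w => by
      obtain ⟨a, ha⟩ := (e.surjective.comp Ideal.Quotient.mk_surjective) w
      exact ⟨π a, (hψπ a).trans ha⟩
    have hψker : ∀ b, ψ b = 0 ↔ b ∈ Ring.jacobson (SliceRing z) := fun b => by
      obtain ⟨a, rfl⟩ := hπ b
      rw [hψπ, hψ₀]
      exact (map_mem_jacobson_iff (π := (π : A →+* SliceRing z)) hπ hkerJ).symm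
    have hHey := zetaSeries_mul_prod_eq_one HB hZB hψ hψker
    have hprod : HasFormalProd (fun n : ℕ => dirichletSubst n (zetaSeries (SliceRing z)))
        (zetaSeries A) :=
      hasFormalProd_dirichletSubst HB hZA hZB (τ := (τ : A ≃+* A)) hτ hzz
        (π := (π : A →+* SliceRing z)) hπ hker hrad
    have hprod' := hprod.of_equiv Equiv.pnatEquivNat
    have hsucc : ∀ n : ℕ+, Equiv.pnatEquivNat n + 1 = n := fun n => PNat.natPred_add_one n
    simp only [dirichletSubst_eq_prod hHey, hsucc] at hprod'
    refine ⟨hZA, hZB, hprod', ?_, hprod, eq_prod_inverse_pow hHey⟩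
    convert hprod' using 2 with n
    refine Finset.prod_congr rfl fun j hj => ?_
    rw [dirichletTerm_pow_sub Nat.card_pos.ne'
      ((Finset.mem_Icc.1 hj).2.trans (Nat.le_mul_of_pos_left r n.pos))]
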